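/- Let $\Phi^t$, $t\in\mathbb R$, be a continuous flow on a metric space $\mathcal M$ with an ergodic invariant Borel probability measure $\mu$. Let $H=L^2(\mu;\mathbb C)$, let $U^tf=f\circ\Phi^t$ be the Koopman operators on $H$, and let $Vf=\lim_{t\to0}(U^tf-f)/t$ be their generator, defined on all $f\in H$ for which the limit exists in norm. $V$ is skew-adjoint and $U^t=e^{tV}$. Let $\tilde H=\{f\in H:\langle \mathbf 1,f\rangle=0\}$ and let $\tilde\Pi$ be the orthogonal projection of $H$ onto $\tilde H$; $V$ restricts to a skew-adjoint operator on $\tilde H$. Functions of skew-adjoint operators are understood through the Borel functional calculus $h(A)=\int_{i\mathbb R}h\,dE_A$, where $E_A$ is the spectral measure of $A$. For $z>0$ let $q_z(i\omega)=\dfrac{i\omega}{z^2+\omega^2}$, let $Q_z=q_z(V|_{\tilde H})$, an everywhere defined (hence bounded) skew-adjoint operator on $\tilde H$, and let $$\tilde q_z^{-1}(i\lambda)=i\,\frac{1+\sqrt{1-4z^2\lambda^2}}{2\lambda},\qquad 0<|\lambda|\le\frac1{2z},$$ be the inverse of the restriction of $q_z$ to $\{i\omega:|\omega|\ge z\}$.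 The complement of $\{i\lambda: 0<|\lambda|\le 1/(2z)\}$ has zero spectral measure with respect to $Q_z$, so $\tilde V_z=\tilde q_z^{-1}(Q_z)$ is a well-defined operator on $\tilde H$. Let $V_z=\tilde\Pi\tilde V_z\tilde\Pi$, with domain $\{f\in H:\tilde\Pi f\in D(\tilde V_z)\}$; it is a skew-adjoint operator on $H$. Theorem. As $z\to0^+$, $V_z$ converges to $V$ in strong resolvent sense: $(w-V_z)^{-1}f\to(w-V)^{-1}f$ for all $f\in H$ and all $w\in\mathbb C\setminus i\mathbb R$. As a result, it converges to $V$ in strong dynamical sense, that is, $e^{tV_z}f\to e^{tV}f=U^tf$ for all $f\in H$ and $t\in\mathbb R$, and it converges to $V$ spectrally in the following sense. 1. For every $\lambda\in\sigma(V)$ there are a sequence $z_1>z_2>\dots>0$ with $z_n\to0$ and $\lambda_n\in\sigma(V_{z_n})$ with $\lambda_n\to\lambda$. 2. For every bounded continuous $h:i\mathbb R\to\mathbb C$ and every $f\in H$, $h(V_z)f\to h(V)f$ as $z\to0^+$. 3. For every bounded Borel set $\Theta\subseteq i\mathbb R$ with $E_V(\partial\Theta)=0$ (boundary in $i\mathbb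 R$) and every $f\in H$, $E_{V_z}(\Theta)f\to E_V(\Theta)f$ as $z\to0^+$. -/

import Mathlib

open MeasureTheory Filter Topology

noncomputable section

section Hilbert

variable {H : Type*} [NormedAddCommGroup H] [InnerProductSpace ℂ H]

/-! ### Unbounded operators -/

/-- A (densely defined) operator `A` is skew-adjoint if `A† = -A`. -/
def IsSkewAdjoint [CompleteSpace H] (A : H →ₗ.[ℂ] H) : Prop :=
  Dense (A.domain : Set H) ∧ A.adjoint = -A

/-- `R` is the bounded two-sided inverse of `w - A : D(A) → H`. -/
def IsResolventAt (A : H →ₗ.[ℂ] H) (w : ℂ) (R : H →L[ℂ] H) : Prop :=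
  (∀ x : A.domain, R (w • (x : H) - A x) = x) ∧
    ∀ y : H, ∃ h : R y ∈ A.domain, w • R y - A ⟨R y, h⟩ = y

/-- The resolvent set `ρ(A)`. -/
def unboundedResolventSet (A : H →ₗ.[ℂ] H) : Set ℂ :=
  {w | ∃ R : H →L[ℂ] H, IsResolventAt A w R}

/-- The spectrum `σ(A) = ℂ \ ρ(A)`. -/
def unboundedSpectrum (A : H →ₗ.[ℂ] H) : Set ℂ := (unboundedResolventSet A)ᶜ

open Classical in
/-- The resolvent `(w - A)⁻¹` for `w ∈ ρ(A)` (and `0` for `w ∉ ρ(A)`). -/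
def unboundedResolvent (A : H →ₗ.[ℂ] H) (w : ℂ) : H →L[ℂ] H :=
  if h : ∃ R : H →L[ℂ] H, IsResolventAt A w R then h.choose else 0

/-- The infinitesimal generator of a family `U t` of bounded operators:
`A f = lim_{t → 0} (U t f - f) / t`, on the space of all `f` for which the norm limit exists. -/
def infGenerator (U : ℝ → H →L[ℂ] H) : H →ₗ.[ℂ] H where
  domain :=
    { carrier := {f | ∃ g, Tendsto (fun t : ℝ => (t : ℂ)⁻¹ • (U t f - f)) (𝓝[≠] 0) (𝓝 g)}
      zero_mem' := ⟨0, by simp⟩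
      add_mem' := by
        rintro a b ⟨g, hg⟩ ⟨k, hk⟩
        refine ⟨g + k, (hg.add hk).congr fun t => ?_⟩
        rw [map_add, ← smul_add]; congr 1; abel
      smul_mem' := by
        rintro c a ⟨g, hg⟩
        refine ⟨c • g, (hg.const_smul c).congr fun t => ?_⟩
        rw [map_smul, ← smul_sub, smul_comm] }
  toFun :=
    { toFun := fun f => f.2.choose
      map_add' := by
        intro a b
        refine tendsto_nhds_unique (a + b).2.choose_spec
          ((a.2.choose_spec.add b.2.choose_spec).congr fun t => ?_)
        rw [Submodule.coe_add, map_add, ← smul_add]; congr 1; abel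
      map_smul' := by
        intro c a
        refine tendsto_nhds_unique (c • a).2.choose_spec
          ((a.2.choose_spec.const_smul c).congr fun t => ?_)
        rw [Submodule.coe_smul, map_smul, ← smul_sub, smul_comm] }

/-- The part of `A` in the closed subspace `K`: `x ∈ K ∩ D(A)` with `A x ∈ K` is sent to `A x`.
If `K` is invariant under `A`, this is the restriction of `A` to `K`. -/
def partIn (K : Submodule ℂ H) (A : H →ₗ.[ℂ] H) : K →ₗ.[ℂ] K where
  domain :=
    { carrier := {x | ∃ h : (x : H) ∈ A.domain, A ⟨x, h⟩ ∈ K}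
      zero_mem' := ⟨A.domain.zero_mem, by
        have : (⟨((0 : K) : H), A.domain.zero_mem⟩ : A.domain) = 0 := rfl
        rw [this, LinearPMap.map_zero]; exact K.zero_mem⟩
      add_mem' := by
        rintro a b ⟨ha, ha'⟩ ⟨hb, hb'⟩
        refine ⟨A.domain.add_mem ha hb, ?_⟩
        have := A.map_add ⟨a, ha⟩ ⟨b, hb⟩
        exact (congrArg (· ∈ K) this).mpr (K.add_mem ha' hb')
      smul_mem' := by
        rintro c a ⟨ha, ha'⟩
        refine ⟨A.domain.smul_mem c ha, ?_⟩
        have := A.map_smul c ⟨a, ha⟩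
        exact (congrArg (· ∈ K) this).mpr (K.smul_mem c ha') }
  toFun :=
    { toFun := fun x => ⟨A ⟨((x : K) : H), x.2.choose⟩, x.2.choose_spec⟩
      map_add' := fun a b => Subtype.ext (A.map_add ⟨a, a.2.choose⟩ ⟨b, b.2.choose⟩)
      map_smul' := fun c a => Subtype.ext (A.map_smul c ⟨a, a.2.choose⟩) }

/-- The operator `P B P` on `H`, where `P` is the orthogonal projection of `H` onto `K` and `B` is
an operator on `K`; its domain is `{x | P x ∈ D(B)}`. -/
def sandwich (K : Submodule ℂ H) [K.HasOrthogonalProjection] (B : K →ₗ.[ℂ] K) :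
    H →ₗ.[ℂ] H where
  domain := B.domain.comap K.orthogonalProjectionOnto.toLinearMap
  toFun :=
    { toFun := fun x => ((B ⟨K.orthogonalProjectionOnto x, x.2⟩ : K) : H)
      map_add' := fun a b => by
        have h : (⟨K.orthogonalProjectionOnto ((a + b : _) : H), (a + b).2⟩ : B.domain) =
            ⟨K.orthogonalProjectionOnto a, a.2⟩ + ⟨K.orthogonalProjectionOnto b, b.2⟩ :=
          Subtype.ext (map_add K.orthogonalProjectionOnto (a : H) b)
        rw [h, LinearPMap.map_add]; rfl
      map_smul' := fun c a => by
        have h : (⟨K.orthogonalProjectionOnto ((c • a : _) : H), (c • a).2⟩ : B.domain) =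
            c • ⟨K.orthogonalProjectionOnto a, a.2⟩ :=
          Subtype.ext (map_smul K.orthogonalProjectionOnto c (a : H))
        rw [h, LinearPMap.map_smul]; rfl }

/-! ### Projection-valued measures and spectral integrals -/

/-- A projection-valued measure on `ℝ`: orthogonal projections `E s`, `s` Borel, with `E ℝ = 1`,
countably additive in the strong operator topology (`E s` is set to `0` if `s` is not Borel).
The imaginary line is identified with `ℝ` throughout: `E s` stands for `E (i s)`. -/
structure ProjMeasure (H : Type*) [NormedAddCommGroup H] [InnerProductSpace ℂ H]
    [CompleteSpace H] where
  toFun : Set ℝ → H →L[ℂ] H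
  isProj : ∀ s, MeasurableSet s → IsStarProjection (toFun s)
  not_measurable : ∀ s, ¬ MeasurableSet s → toFun s = 0
  univ : toFun Set.univ = 1
  hasSum : ∀ s : ℕ → Set ℝ, (∀ n, MeasurableSet (s n)) → Pairwise (Function.onFun Disjoint s) →
    ∀ x, HasSum (fun n => toFun (s n) x) (toFun (⋃ n, s n) x)

namespace ProjMeasure

variable [CompleteSpace H]

instance : CoeFun (ProjMeasure H) (fun _ => Set ℝ → H →L[ℂ] H) := ⟨toFun⟩

open Classical in
/-- The point mass at `0`. -/
instance : Inhabited (ProjMeasure H) where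
  default :=
    { toFun := fun s => if MeasurableSet s ∧ (0 : ℝ) ∈ s then 1 else 0
      isProj := fun s _ => by
        split_ifs
        · exact IsStarProjection.one _
        · exact IsStarProjection.zero _
      not_measurable := fun s hs => by simp [hs]
      univ := by simp
      hasSum := fun s hs hd x => by
        by_cases h : ∃ n, (0 : ℝ) ∈ s n
        · obtain ⟨n, hn⟩ := h
          have h1 : (0 : ℝ) ∈ ⋃ n, s n := Set.mem_iUnion.2 ⟨n, hn⟩
          have := hasSum_single (f := fun m =>
            (if MeasurableSet (s m) ∧ (0 : ℝ) ∈ s m then (1 : H →L[ℂ] H) else 0) x) n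
            (fun m hm => by
              have : (0 : ℝ) ∉ s m := fun h0 => (Set.disjoint_left.1 (hd hm) h0) hn
              simp [this])
          simpa [h1, hs, hn, MeasurableSet.iUnion hs] using this
        · push Not at h
          simp [h] }

variable (E : ProjMeasure H)

theorem norm_sq_apply {s : Set ℝ} (hs : MeasurableSet s) (x : H) :
    ‖E s x‖ ^ 2 = RCLike.re (inner ℂ x (E s x)) := by
  have h := E.isProj s hs
  have h1 : E s (E s x) = E s x := by
    have := congrArg (fun T : H →L[ℂ] H => T x) h.isIdempotentElem.eq
    simpa using this
  have h2 : ContinuousLinearMap.adjoint (E s) = E s := h.isSelfAdjoint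
  rw [← inner_self_eq_norm_sq (𝕜 := ℂ)]
  conv_lhs => rw [← ContinuousLinearMap.adjoint_inner_right, h2, h1]

/-- The finite measure `s ↦ ‖E s x‖² = ⟨x, E s x⟩`. -/
def measureAt (x : H) : Measure ℝ :=
  Measure.ofMeasurable (fun s _ => ENNReal.ofReal (‖E s x‖ ^ 2))
    (by
      have h := E.hasSum (fun _ => ∅) (fun _ => .empty) (fun _ _ _ => by simp [Function.onFun]) x
      have h0 : E ∅ x = 0 := by
        have := h.summable.tendsto_atTop_zero
        exact tendsto_nhds_unique tendsto_const_nhds this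
      simp [h0])
    (by
      intro f hf hd
      have h1 : HasSum (fun n => ‖E (f n) x‖ ^ 2) (‖E (⋃ n, f n) x‖ ^ 2) := by
        rw [E.norm_sq_apply (.iUnion hf)]
        simp_rw [fun n => E.norm_sq_apply (hf n) x]
        exact RCLike.hasSum_re ℂ ((E.hasSum f hf hd x).mapL (innerSL ℂ x))
      rw [← h1.tsum_eq, ENNReal.ofReal_tsum_of_nonneg (fun n => by positivity) h1.summable])

theorem measureAt_apply (x : H) {s : Set ℝ} (hs : MeasurableSet s) :
    E.measureAt x s = ENNReal.ofReal (‖E s x‖ ^ 2) :=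
  Measure.ofMeasurable_apply s hs

instance (x : H) : IsFiniteMeasure (E.measureAt x) :=
  ⟨by rw [E.measureAt_apply x .univ]; exact ENNReal.ofReal_lt_top⟩

theorem measureAt_add_le (x y : H) :
    E.measureAt (x + y) ≤ (2 : ENNReal) • E.measureAt x + (2 : ENNReal) • E.measureAt y := by
  refine Measure.le_iff.2 fun s hs => ?_
  simp only [Measure.coe_add, Measure.coe_smul, Pi.add_apply, Pi.smul_apply, smul_eq_mul,
    E.measureAt_apply _ hs]
  rw [show (2 : ENNReal) = ENNReal.ofReal 2 by simp, ← ENNReal.ofReal_mul (by norm_num),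
    ← ENNReal.ofReal_mul (by norm_num), ← ENNReal.ofReal_add (by positivity) (by positivity)]
  refine ENNReal.ofReal_le_ofReal ?_
  rw [map_add]
  nlinarith [parallelogram_law_with_norm ℂ (E s x) (E s y), norm_nonneg (E s x - E s y)]

theorem measureAt_smul_le (c : ℂ) (x : H) :
    E.measureAt (c • x) ≤ ENNReal.ofReal (‖c‖ ^ 2) • E.measureAt x := by
  refine Measure.le_iff.2 fun s hs => ?_
  simp only [Measure.coe_smul, Pi.smul_apply, smul_eq_mul, E.measureAt_apply _ hs]
  rw [← ENNReal.ofReal_mul (by positivity), map_smul, norm_smul, mul_pow]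

/-- The spectral integral of a simple function, `∑ c, c • E {s = c}`. -/
def simpleIntegral (s : SimpleFunc ℝ ℂ) : H →L[ℂ] H :=
  ∑ c ∈ s.range, c • E (s ⁻¹' {c})

theorem apply_empty (x : H) : E ∅ x = 0 := by
  have h := E.measureAt_apply x .empty
  rw [measure_empty, eq_comm, ENNReal.ofReal_eq_zero] at h
  exact norm_eq_zero.1 (pow_eq_zero_iff two_ne_zero |>.1 (le_antisymm h (by positivity)))

theorem apply_union {s t : Set ℝ} (hs : MeasurableSet s) (ht : MeasurableSet t)
    (h : Disjoint s t) (x : H) : E (s ∪ t) x = E s x + E t x := by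
  let f : ℕ → Set ℝ := fun n => if n = 0 then s else if n = 1 then t else ∅
  have hf : ∀ n, MeasurableSet (f n) := fun n => by
    simp only [f]; split_ifs <;> simp [hs, ht]
  have hd : Pairwise (Function.onFun Disjoint f) := by
    intro i j hij
    simp only [f, Function.onFun]
    split_ifs <;> first | omega | simp [h, h.symm]
  have hu : ⋃ n, f n = s ∪ t := by
    ext a
    simp only [f, Set.mem_iUnion, Set.mem_union]
    constructor
    · rintro ⟨n, hn⟩
      split_ifs at hn
      · exact Or.inl hn
      · exact Or.inr hn
      · exact hn.elim
    · rintro (ha | ha)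
      · exact ⟨0, by simpa using ha⟩
      · exact ⟨1, by simpa using ha⟩
  have h1 := E.hasSum f hf hd x
  have h2 : HasSum (fun n => E (f n) x) (∑ n ∈ Finset.range 2, E (f n) x) :=
    hasSum_sum_of_ne_finset_zero (fun n hn => by
      have h0 : n ≠ 0 := by rintro rfl; simp at hn
      have h1 : n ≠ 1 := by rintro rfl; simp at hn
      simp [f, h0, h1, E.apply_empty])
  rw [hu] at h1
  rw [h1.unique h2]
  simp [f, Finset.sum_range_succ]

theorem inner_apply_of_disjoint {s t : Set ℝ} (hs : MeasurableSet s) (ht : MeasurableSet t)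
    (h : Disjoint s t) (x : H) : inner ℂ (E s x) (E t x) = 0 := by
  have idem : ∀ y, E s (E s y) = E s y := fun y => by
    have := congrArg (fun T : H →L[ℂ] H => T y) (E.isProj s hs).isIdempotentElem.eq
    simpa using this
  have adj : ContinuousLinearMap.adjoint (E t) = E t := (E.isProj t ht).isSelfAdjoint
  set y := E s x with hy
  have hys : E s y = y := idem x
  have hidem : E (s ∪ t) (E (s ∪ t) y) = E (s ∪ t) y := by
    have := congrArg (fun T : H →L[ℂ] H => T y) (E.isProj _ (hs.union ht)).isIdempotentElem.eq
    simpa using this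
  have hadj : ContinuousLinearMap.adjoint (E (s ∪ t)) = E (s ∪ t) :=
    (E.isProj _ (hs.union ht)).isSelfAdjoint
  have hle : ‖E (s ∪ t) y‖ ≤ ‖y‖ := by
    by_contra! hlt
    have h1 : ‖E (s ∪ t) y‖ ^ 2 ≤ ‖y‖ * ‖E (s ∪ t) y‖ := by
      rw [E.norm_sq_apply (hs.union ht)]
      exact (RCLike.re_le_norm _).trans (norm_inner_le_norm _ _)
    nlinarith [norm_nonneg y]
  have hkey : ‖E (s ∪ t) y‖ ^ 2 = ‖y‖ ^ 2 + ‖E t y‖ ^ 2 := by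
    rw [E.norm_sq_apply (hs.union ht), E.apply_union hs ht h, inner_add_right, map_add,
      ← E.norm_sq_apply hs, ← E.norm_sq_apply ht, hys]
  have hz : E t y = 0 := by
    have : ‖E t y‖ ^ 2 ≤ 0 := by nlinarith [norm_nonneg y, norm_nonneg (E (s ∪ t) y)]
    exact norm_eq_zero.1 (pow_eq_zero_iff two_ne_zero |>.1 (le_antisymm this (by positivity)))
  have h3 : inner ℂ y (E t x) = inner ℂ (E t y) x := by
    rw [← ContinuousLinearMap.adjoint_inner_left, adj]
  rw [h3, hz, inner_zero_left]

/-- The isometry property of the spectral integral of simple functions. -/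
theorem norm_simpleIntegral_sq (s : SimpleFunc ℝ ℂ) (x : H) :
    ‖E.simpleIntegral s x‖ₑ ^ 2 = ∫⁻ ω, ‖s ω‖ₑ ^ 2 ∂(E.measureAt x) := by
  have hR : ∫⁻ ω, ‖s ω‖ₑ ^ 2 ∂(E.measureAt x) =
      ∑ c ∈ s.range, ‖c‖ₑ ^ 2 * E.measureAt x (s ⁻¹' {c}) := by
    have := SimpleFunc.lintegral_eq_lintegral (s.map fun c : ℂ => ‖c‖ₑ ^ 2) (E.measureAt x)
    rw [SimpleFunc.map_lintegral] at this
    simpa using this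
  have hL : ‖E.simpleIntegral s x‖ ^ 2 = ∑ c ∈ s.range, ‖c‖ ^ 2 * ‖E (s ⁻¹' {c}) x‖ ^ 2 := by
    have h0 : E.simpleIntegral s x = ∑ c ∈ s.range, c • E (s ⁻¹' {c}) x := by
      simp [simpleIntegral]
    have horth : ∀ c ∈ s.range, ∀ d ∈ s.range, c ≠ d →
        inner ℂ (c • E (s ⁻¹' {c}) x) (d • E (s ⁻¹' {d}) x) = 0 := fun c _ d _ hcd => by
      rw [inner_smul_left, inner_smul_right, E.inner_apply_of_disjoint
        (s.measurableSet_fiber c) (s.measurableSet_fiber d), mul_zero, mul_zero]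
      exact Disjoint.preimage _ (by simpa using hcd)
    have h1 : (inner ℂ (∑ c ∈ s.range, c • E (s ⁻¹' {c}) x)
        (∑ d ∈ s.range, d • E (s ⁻¹' {d}) x) : ℂ) =
        ∑ c ∈ s.range, inner ℂ (c • E (s ⁻¹' {c}) x) (c • E (s ⁻¹' {c}) x) := by
      rw [sum_inner]
      refine Finset.sum_congr rfl fun c hc => ?_
      rw [inner_sum]
      exact Finset.sum_eq_single c (fun d hd hdc => horth c hc d hd hdc.symm)
        (fun h => absurd hc h)
    rw [← inner_self_eq_norm_sq (𝕜 := ℂ), h0, h1, map_sum]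
    refine Finset.sum_congr rfl fun c _ => ?_
    rw [inner_self_eq_norm_sq, norm_smul, mul_pow]
  rw [hR, ← ofReal_norm, ← ENNReal.ofReal_pow (norm_nonneg _), hL,
    ENNReal.ofReal_sum_of_nonneg (fun _ _ => by positivity)]
  refine Finset.sum_congr rfl fun c _ => ?_
  rw [E.measureAt_apply x (s.measurableSet_fiber c), ENNReal.ofReal_mul (by positivity),
    ENNReal.ofReal_pow (norm_nonneg _), ofReal_norm]

theorem simpleIntegral_sub (s t : SimpleFunc ℝ ℂ) (x : H) :
    E.simpleIntegral (s - t) x = E.simpleIntegral s x - E.simpleIntegral t x := by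
  let T : Set ℝ → ℂ →L[ℝ] H := fun u => (ContinuousLinearMap.id ℝ ℂ).smulRight (E u x)
  have hT : FinMeasAdditive (E.measureAt x) T := by
    intro u v hu hv _ _ huv
    ext <;> simp [T, E.apply_union hu hv huv]
  have h : ∀ r : SimpleFunc ℝ ℂ, E.simpleIntegral r x = r.setToSimpleFunc T := fun r => by
    simp [simpleIntegral, SimpleFunc.setToSimpleFunc, T]
  rw [h, h, h, SimpleFunc.setToSimpleFunc_sub T hT (SimpleFunc.integrable_of_isFiniteMeasure _)
    (SimpleFunc.integrable_of_isFiniteMeasure _)]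

theorem sq_eLpNorm_two (f : ℝ → ℂ) (ν : Measure ℝ) :
    eLpNorm f 2 ν ^ 2 = ∫⁻ ω, ‖f ω‖ₑ ^ 2 ∂ν := by
  rw [eLpNorm_eq_lintegral_rpow_enorm_toReal (by norm_num) (by norm_num), ← ENNReal.rpow_natCast,
    ← ENNReal.rpow_mul]
  norm_num

/-- Mathlib's sequence of simple functions that converges to `f` pointwise, and in `L²(ν)`
whenever `f ∈ L²(ν)`. -/
abbrev approx (f : ℝ → ℂ) (hf : Measurable f) (n : ℕ) : SimpleFunc ℝ ℂ :=
  SimpleFunc.approxOn f hf Set.univ 0 (Set.mem_univ 0) n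

/-- For `∫ |f|² d‖E(·)x‖² < ∞`, the spectral integrals of the approximating simple functions
converge. -/
theorem exists_tendsto_simpleIntegral (f : ℝ → ℂ) (hf : Measurable f) (x : H)
    (hx : ∫⁻ ω, ‖f ω‖ₑ ^ 2 ∂(E.measureAt x) < ⊤) :
    ∃ y, Tendsto (fun n => E.simpleIntegral (approx f hf n) x) atTop (𝓝 y) := by
  refine cauchySeq_tendsto_of_complete ?_
  have h0 : Tendsto (fun n => eLpNorm (⇑(approx f hf n) - f) 2 (E.measureAt x)) atTop (𝓝 0) :=
    SimpleFunc.tendsto_approxOn_Lp_eLpNorm hf (Set.mem_univ 0) (by simp) (by simp)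
      (by
        rw [← sq_eLpNorm_two] at hx
        simpa using (ENNReal.pow_lt_top_iff.1 hx).resolve_right two_ne_zero)
  have hnorm : ∀ s : SimpleFunc ℝ ℂ,
      ‖E.simpleIntegral s x‖ₑ = eLpNorm s 2 (E.measureAt x) := fun s => by
    have h1 := sq_eLpNorm_two (s : ℝ → ℂ) (E.measureAt x)
    rw [← E.norm_simpleIntegral_sq s x] at h1
    exact ((ENNReal.pow_right_strictMono two_ne_zero).injective h1).symm
  have hb : ∀ n m, edist (E.simpleIntegral (approx f hf n) x) (E.simpleIntegral (approx f hf m) x)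
      ≤ eLpNorm (⇑(approx f hf n) - f) 2 (E.measureAt x) +
        eLpNorm (⇑(approx f hf m) - f) 2 (E.measureAt x) := fun n m => by
    rw [edist_eq_enorm_sub, ← E.simpleIntegral_sub, hnorm]
    have : (⇑(approx f hf n - approx f hf m) : ℝ → ℂ) =
        (⇑(approx f hf n) - f) - (⇑(approx f hf m) - f) := by
      ext ω; simp
    rw [this]
    exact eLpNorm_sub_le
      ((SimpleFunc.aestronglyMeasurable _).sub hf.aestronglyMeasurable)
      ((SimpleFunc.aestronglyMeasurable _).sub hf.aestronglyMeasurable) (by norm_num)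
  rw [EMetric.cauchySeq_iff]
  intro ε hε
  have hε2 : (0 : ENNReal) < ε / 2 := ENNReal.half_pos hε.ne'
  obtain ⟨N, hN⟩ := eventually_atTop.1 ((tendsto_order.1 h0).2 (ε / 2) hε2)
  refine ⟨N, fun m hm n hn => (hb m n).trans_lt ?_⟩
  calc _ < ε / 2 + ε / 2 := ENNReal.add_lt_add (hN m hm) (hN n hn)
    _ = ε := ENNReal.add_halves ε

/-- The spectral integral `∫ f dE` of a Borel function `f`, an unbounded operator with domain
`{x | ∫ |f|² d‖E(·)x‖² < ∞}`. -/
def integral (f : ℝ → ℂ) (hf : Measurable f) : H →ₗ.[ℂ] H where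
  domain :=
    { carrier := {x | ∫⁻ ω, ‖f ω‖ₑ ^ 2 ∂(E.measureAt x) < ⊤}
      zero_mem' := by
        have : E.measureAt (0 : H) = 0 := by
          ext s hs
          simp [E.measureAt_apply _ hs]
        simp [this]
      add_mem' := fun {a b} ha hb => by
        refine (lintegral_mono' (E.measureAt_add_le a b) le_rfl).trans_lt ?_
        rw [lintegral_add_measure, lintegral_smul_measure, lintegral_smul_measure]
        exact ENNReal.add_lt_top.2
          ⟨ENNReal.mul_lt_top (by simp) ha, ENNReal.mul_lt_top (by simp) hb⟩
      smul_mem' := fun c a ha => by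
        refine (lintegral_mono' (E.measureAt_smul_le c a) le_rfl).trans_lt ?_
        rw [lintegral_smul_measure]
        exact ENNReal.mul_lt_top ENNReal.ofReal_lt_top ha }
  toFun :=
    { toFun := fun x => (E.exists_tendsto_simpleIntegral f hf x x.2).choose
      map_add' := fun a b => by
        refine tendsto_nhds_unique (E.exists_tendsto_simpleIntegral f hf _ (a + b).2).choose_spec
          (((E.exists_tendsto_simpleIntegral f hf a a.2).choose_spec.add
            (E.exists_tendsto_simpleIntegral f hf b b.2).choose_spec).congr fun n => ?_)
        rw [Submodule.coe_add, map_add]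
      map_smul' := fun c a => by
        refine tendsto_nhds_unique (E.exists_tendsto_simpleIntegral f hf _ (c • a).2).choose_spec
          (((E.exists_tendsto_simpleIntegral f hf a a.2).choose_spec.const_smul c).congr
            fun n => ?_)
        rw [Submodule.coe_smul, map_smul] }

/-- `E` is the spectral measure of `A`, i.e. `A = ∫ iω dE(ω)`. -/
def IsSpectralMeasureOf (A : H →ₗ.[ℂ] H) : Prop :=
  E.integral (fun ω : ℝ => Complex.I * ω) (by fun_prop) = A

end ProjMeasure

variable [CompleteSpace H]

/-- The spectral measure of `A`: the projection-valued measure `E` with `A = ∫ iω dE(ω)`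
(arbitrary if there is none). -/
def spectralMeasure (A : H →ₗ.[ℂ] H) : ProjMeasure H :=
  Classical.epsilon fun E : ProjMeasure H => E.IsSpectralMeasureOf A

/-- The Borel functional calculus of `A`. A function on the imaginary line is written as a
function `f` of `ω`, its argument being `iω`: the result is `∫ f dE`, with `A = ∫ iω dE(ω)`. -/
def borelCalculus (A : H →ₗ.[ℂ] H) (f : ℝ → ℂ) (hf : Measurable f) : H →ₗ.[ℂ] H :=
  (spectralMeasure A).integral f hf

/-- `e^{tA}`, through the Borel functional calculus. -/
def expOp (t : ℝ) (A : H →ₗ.[ℂ] H) : H →ₗ.[ℂ] H :=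
  borelCalculus A (fun ω : ℝ => Complex.exp (Complex.I * ω * t)) (by fun_prop)

/-! ### Notions of convergence -/

/-- As `z → 0⁺` the operators `T z`, `z > 0`, converge strongly to `S`; this includes that all of
them are everywhere defined bounded operators. -/
def StrongOpConv (T : ℝ → H →ₗ.[ℂ] H) (S : H →ₗ.[ℂ] H) : Prop :=
  ∃ (T' : ℝ → H →L[ℂ] H) (S' : H →L[ℂ] H),
    (∀ z > 0, T z = (T' z).toLinearMap.toPMap ⊤) ∧ S = S'.toLinearMap.toPMap ⊤ ∧
      ∀ f : H, Tendsto (fun z => T' z f) (𝓝[>] 0) (𝓝 (S' f))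

/-- Convergence in strong resolvent sense of `A z` to `B` as `z → 0⁺`. -/
def StrongResolventConv (A : ℝ → H →ₗ.[ℂ] H) (B : H →ₗ.[ℂ] H) : Prop :=
  ∀ w : ℂ, w.re ≠ 0 → w ∈ unboundedResolventSet B ∧ (∀ z > 0, w ∈ unboundedResolventSet (A z)) ∧
    ∀ f : H, Tendsto (fun z => unboundedResolvent (A z) w f) (𝓝[>] 0)
      (𝓝 (unboundedResolvent B w f))

/-- Convergence in strong dynamical sense of `A z` to `B` as `z → 0⁺`. -/
def StrongDynamicalConv (A : ℝ → H →ₗ.[ℂ] H) (B : H →ₗ.[ℂ] H) : Prop :=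
  ∀ t : ℝ, StrongOpConv (fun z => expOp t (A z)) (expOp t B)

/-- Spectral convergence of `A z` to `B` as `z → 0⁺`. -/
structure SpectralConv (A : ℝ → H →ₗ.[ℂ] H) (B : H →ₗ.[ℂ] H) : Prop where
  /-- Every point of the spectrum of `B` is a limit of points of the spectra of `A (z n)`, for a
  sequence `z n ↘ 0`. -/
  spectrum : ∀ l ∈ unboundedSpectrum B, ∃ (z : ℕ → ℝ) (l' : ℕ → ℂ),
    (∀ n, 0 < z n) ∧ StrictAnti z ∧ Tendsto z atTop (𝓝 0) ∧
      (∀ n, l' n ∈ unboundedSpectrum (A (z n))) ∧ Tendsto l' atTop (𝓝 l)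
  /-- `h(A z) → h(B)` strongly, for bounded continuous `h`. -/
  calculus : ∀ h : BoundedContinuousFunction ℝ ℂ,
    StrongOpConv (fun z => borelCalculus (A z) h h.continuous.measurable)
      (borelCalculus B h h.continuous.measurable)
  /-- The spectral projections of `A z` on a bounded Borel set whose boundary has zero spectral
  measure with respect to `B` converge strongly to that of `B`. -/
  projections : ∀ Θ : Set ℝ, MeasurableSet Θ → Bornology.IsBounded Θ →
    spectralMeasure B (frontier Θ) = 0 →
      ∀ f : H, Tendsto (fun z => spectralMeasure (A z) Θ f) (𝓝[>] 0)
        (𝓝 (spectralMeasure B Θ f))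

end Hilbert

/-! ### The Koopman group of a measure-preserving flow and the approximation of its generator -/

/-- `q_z(iω) = iω / (z² + ω²)`, as a function of `ω`. -/
def qFun (z ω : ℝ) : ℂ := Complex.I * ω / (z ^ 2 + ω ^ 2)

/-- `q̃_z⁻¹(iλ) = i (1 + √(1 - 4 z² λ²)) / (2 λ)`, as a function of `λ`: the inverse of the
restriction of `q_z` to `|ω| ≥ z`, defined for `0 < |λ| ≤ 1 / (2z)`. (Outside that set Lean's
conventions give a value, which is not used: see `branchDomain`.) -/
def qInv (z l : ℝ) : ℂ := Complex.I * ((1 + √(1 - 4 * z ^ 2 * l ^ 2)) / (2 * l) : ℝ)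

/-- The set of `λ` for which `q̃_z⁻¹(iλ)` is defined. -/
def branchDomain (z : ℝ) : Set ℝ := {l | 0 < |l| ∧ |l| ≤ 1 / (2 * z)}

theorem measurable_qFun (z : ℝ) : Measurable (qFun z) := by unfold qFun; fun_prop

theorem measurable_qInv (z : ℝ) : Measurable (qInv z) := by unfold qInv; fun_prop

/-- `q̃_z⁻¹` inverts `q_z` on `|ω| ≥ z`: the value of `q_z(iω)` is `iλ` with `λ` in the domain of
the branch, and `q̃_z⁻¹(iλ) = iω`. -/
theorem qInv_qFun {z ω : ℝ} (hz : 0 < z) (hω : z ≤ |ω|) :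
    qFun z ω = Complex.I * (ω / (z ^ 2 + ω ^ 2) : ℝ) ∧ ω / (z ^ 2 + ω ^ 2) ∈ branchDomain z ∧
      qInv z (ω / (z ^ 2 + ω ^ 2)) = Complex.I * ω := by
  have hω0 : ω ≠ 0 := by rintro rfl; simp at hω; linarith
  have hω2 : z ^ 2 ≤ ω ^ 2 := by rw [← sq_abs ω]; gcongr
  have hp : 0 < z ^ 2 + ω ^ 2 := by positivity
  refine ⟨by simp [qFun, mul_div_assoc], ⟨by positivity, ?_⟩, ?_⟩
  · rw [abs_div, abs_of_pos hp, div_le_div_iff₀ hp (by positivity), ← sq_abs ω]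
    nlinarith [sq_nonneg (z - |ω|)]
  · have h1 : 1 - 4 * z ^ 2 * (ω / (z ^ 2 + ω ^ 2)) ^ 2 =
        ((ω ^ 2 - z ^ 2) / (z ^ 2 + ω ^ 2)) ^ 2 := by
      field_simp; ring
    rw [qInv, h1, Real.sqrt_sq (div_nonneg (by linarith) hp.le)]
    congr 2
    field_simp
    ring

/-- The closed subspace `H̃ = {f | ⟨1, f⟩ = 0}` of zero-mean functions. -/
abbrev zeroMean {M : Type*} [MeasurableSpace M] (μ : Measure M) [IsProbabilityMeasure μ] :
    Submodule ℂ (Lp ℂ 2 μ) :=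
  (ℂ ∙ Lp.const 2 μ (1 : ℂ))ᗮ

section Flow

variable {M : Type*} [TopologicalSpace M] [MeasurableSpace M] [BorelSpace M] [AddAction ℝ M]
  [ContinuousVAdd ℝ M] (μ : Measure M) [IsProbabilityMeasure μ] [ErgodicVAdd ℝ M μ]

/-- The Koopman operator `U^t f = f ∘ Φ^t` on `L²(μ)`, where `Φ^t x = t +ᵥ x`. -/
def koopman (t : ℝ) : Lp ℂ 2 μ →L[ℂ] Lp ℂ 2 μ :=
  (Lp.compMeasurePreservingₗᵢ ℂ (fun x : M => t +ᵥ x)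
    (measurePreserving_vadd t μ)).toContinuousLinearMap

/-- The generator `V` of the Koopman group. -/
def koopmanGenerator : Lp ℂ 2 μ →ₗ.[ℂ] Lp ℂ 2 μ := infGenerator (koopman μ)

/-- `Q_z = q_z(V)`, as an operator on `H̃`. -/
def Qop (z : ℝ) : zeroMean μ →ₗ.[ℂ] zeroMean μ :=
  borelCalculus (partIn (zeroMean μ) (koopmanGenerator μ)) (qFun z) (measurable_qFun z)

/-- `Ṽ_z = q̃_z⁻¹(Q_z)`, as an operator on `H̃`. -/
def Vtilde (z : ℝ) : zeroMean μ →ₗ.[ℂ] zeroMean μ :=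
  borelCalculus (Qop μ z) (qInv z) (measurable_qInv z)

/-- `V_z = Π̃ Ṽ_z Π̃`, as an operator on `L²(μ)`, with `Π̃` the orthogonal projection onto `H̃`. -/
def Vop (z : ℝ) : Lp ℂ 2 μ →ₗ.[ℂ] Lp ℂ 2 μ := sandwich (zeroMean μ) (Vtilde μ z)

end Flow

end

/-! All the operators are functions of one spectral measure. Let F be the spectral measure of the
Koopman group on H̃, and E its extension to H by a point mass at 0 on the constants. Then V = ∫ iω
dE. The functional calculi of V restricted to H̃ and of Q_z compose, so V_z = ∫ i p_z dE with p_z =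
q̃_z⁻¹ ∘ q_z and p_z(0) = 0. The branch undoes q_z exactly on |ω| ≥ z, where p_z(ω) = ω; on 0 < |ω|
< z it returns z²/ω instead. Hence, for each fixed ω, p_z(ω) is equal to ω for all small z, and not
merely close to it.

Consequently f(p_z(ω)) → f(ω) for every bounded Borel f, and dominated convergence in L²(‖E(·)x‖²)
gives ∫ f∘p_z dE x → ∫ f dE x (`tendsto_act_comp`). With f a resolvent function, an exponential, a
bounded continuous function or an indicator, this is the resolvent, dynamical and spectral
convergence. As for spectra, p_z is the identity near any ω₀ ≠ 0 once z is small, so a point iω₀ of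
σ(V) stays in σ(V_z), while 0 is in every σ(V_z) because of the constants (`spectralConv_pFun`).

Most of the work is the spectral theory behind this. Spectral integrals obey an isometry
(`enorm_act`), a product rule (`act_act`), an adjoint rule (`adjoint_integral`) and a change of
variables (`integral_map`), and an operator has at most one spectral measure
(`eq_of_integral_I_mul_eq`). Existence is Stone's theorem: Bochner's theorem (`exists_charFun_eq`)
represents t ↦ ⟨x, U t x⟩ by a measure, and polarisation assembles these measures into projections
(`projMeasure`). Ergodicity gives F{0} = 0 (`restrictMeasure_singleton`), which is why the
complement of the domain of the branch is null for Q_z. -/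

noncomputable section

namespace ProjMeasure

variable {H : Type*} [NormedAddCommGroup H] [InnerProductSpace ℂ H] [CompleteSpace H]
  (E : ProjMeasure H)

/-! ### Spectral integrals of simple functions -/

theorem enorm_simpleIntegral (s : SimpleFunc ℝ ℂ) (x : H) :
    ‖E.simpleIntegral s x‖ₑ = eLpNorm s 2 (E.measureAt x) := by
  have h1 := sq_eLpNorm_two (s : ℝ → ℂ) (E.measureAt x)
  rw [← E.norm_simpleIntegral_sq s x] at h1
  exact ((ENNReal.pow_right_strictMono two_ne_zero).injective h1).symm

/-- The vector-valued set function `s ↦ (c ↦ c • E s x)`. -/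
def vectorMeasureAt (x : H) (u : Set ℝ) : ℂ →L[ℝ] H :=
  (ContinuousLinearMap.id ℝ ℂ).smulRight (E u x)

theorem finMeasAdditive_vectorMeasureAt (x : H) :
    FinMeasAdditive (E.measureAt x) (E.vectorMeasureAt x) := by
  intro u v hu hv _ _ huv
  ext
  simp [vectorMeasureAt, E.apply_union hu hv huv]

/-- Puts the spectral sum in the form of `setToSimpleFunc`, whose general lemmas then give linearity
in the integrand. -/
theorem simpleIntegral_apply (s : SimpleFunc ℝ ℂ) (x : H) :
    E.simpleIntegral s x = s.setToSimpleFunc (E.vectorMeasureAt x) := by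
  simp [simpleIntegral, SimpleFunc.setToSimpleFunc, vectorMeasureAt]

theorem simpleIntegral_add (s t : SimpleFunc ℝ ℂ) (x : H) :
    E.simpleIntegral (s + t) x = E.simpleIntegral s x + E.simpleIntegral t x := by
  simp only [simpleIntegral_apply]
  exact SimpleFunc.setToSimpleFunc_add _ (E.finMeasAdditive_vectorMeasureAt x)
    (SimpleFunc.integrable_of_isFiniteMeasure _) (SimpleFunc.integrable_of_isFiniteMeasure _)

theorem simpleIntegral_smul (c : ℂ) (s : SimpleFunc ℝ ℂ) (x : H) :
    E.simpleIntegral (c • s) x = c • E.simpleIntegral s x := by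
  simp only [simpleIntegral_apply]
  exact SimpleFunc.setToSimpleFunc_smul _ (E.finMeasAdditive_vectorMeasureAt x)
    (fun c s x => by simp [vectorMeasureAt, mul_smul]) c
    (SimpleFunc.integrable_of_isFiniteMeasure _)

theorem simpleIntegral_indicator (c : ℂ) {s : Set ℝ} (hs : MeasurableSet s) (x : H) :
    E.simpleIntegral (SimpleFunc.piecewise s hs (SimpleFunc.const ℝ c) (SimpleFunc.const ℝ 0)) x
      = c • E s x := by
  rw [simpleIntegral_apply, SimpleFunc.setToSimpleFunc_indicator]
  · simp [vectorMeasureAt]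
  · simp [vectorMeasureAt, E.apply_empty]

/-! ### Spectral integrals applied to a vector -/

theorem memLp_iff {f : ℝ → ℂ} (hf : Measurable f) (x : H) :
    MemLp f 2 (E.measureAt x) ↔ ∫⁻ ω, ‖f ω‖ₑ ^ 2 ∂(E.measureAt x) < ⊤ := by
  rw [← sq_eLpNorm_two, MemLp, and_iff_right hf.aestronglyMeasurable]
  simp

open Classical in
/-- `(∫ f dE) x`, and `0` if `x` is not in the domain or `f` is not measurable. -/
def act (f : ℝ → ℂ) (x : H) : H :=
  if h : Measurable f ∧ ∫⁻ ω, ‖f ω‖ₑ ^ 2 ∂(E.measureAt x) < ⊤ then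
    (E.exists_tendsto_simpleIntegral f h.1 x h.2).choose
  else 0

variable {E} in
theorem mem_domain_integral {f : ℝ → ℂ} {hf : Measurable f} {x : H} :
    x ∈ (E.integral f hf).domain ↔ MemLp f 2 (E.measureAt x) :=
  (E.memLp_iff hf x).symm

theorem integral_apply {f : ℝ → ℂ} {hf : Measurable f} (x : (E.integral f hf).domain) :
    E.integral f hf x = E.act f x := by
  rw [act, dif_pos ⟨hf, x.2⟩]
  rfl

section Vector

variable {f g : ℝ → ℂ} {x : H}

theorem tendsto_act (hf : Measurable f) (h : MemLp f 2 (E.measureAt x)) :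
    Tendsto (fun n => E.simpleIntegral (approx f hf n) x) atTop (𝓝 (E.act f x)) := by
  rw [E.memLp_iff hf] at h
  rw [act, dif_pos ⟨hf, h⟩]
  exact (E.exists_tendsto_simpleIntegral f hf x h).choose_spec

theorem tendsto_eLpNorm_approx {ν : Measure ℝ} (hf : Measurable f) (h : MemLp f 2 ν) :
    Tendsto (fun n => eLpNorm (⇑(approx f hf n) - f) 2 ν) atTop (𝓝 0) :=
  SimpleFunc.tendsto_approxOn_Lp_eLpNorm hf (Set.mem_univ 0) (by simp) (by simp)
    (by simpa using h.2)

/-- The isometry for simple functions, passed to the limit in one argument. It frees `act` from the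
particular approximating sequence used to define it. -/
theorem edist_simpleIntegral_act_le (hf : Measurable f) (h : MemLp f 2 (E.measureAt x))
    (s : SimpleFunc ℝ ℂ) :
    edist (E.simpleIntegral s x) (E.act f x) ≤ eLpNorm (⇑s - f) 2 (E.measureAt x) := by
  have h1 : Tendsto (fun n => edist (E.simpleIntegral s x) (E.simpleIntegral (approx f hf n) x))
      atTop (𝓝 (edist (E.simpleIntegral s x) (E.act f x))) :=
    tendsto_const_nhds.edist (E.tendsto_act hf h)
  have h2 : Tendsto (fun n => eLpNorm (⇑s - f) 2 (E.measureAt x) +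
      eLpNorm (⇑(approx f hf n) - f) 2 (E.measureAt x)) atTop
      (𝓝 (eLpNorm (⇑s - f) 2 (E.measureAt x) + 0)) :=
    (tendsto_eLpNorm_approx hf h).const_add _
  rw [add_zero] at h2
  refine le_of_tendsto_of_tendsto' h1 h2 fun n => ?_
  rw [edist_eq_enorm_sub, ← E.simpleIntegral_sub, enorm_simpleIntegral]
  have : (⇑(s - approx f hf n) : ℝ → ℂ) = (⇑s - f) - (⇑(approx f hf n) - f) := by
    ext ω; simp
  rw [this]
  exact eLpNorm_sub_le ((SimpleFunc.aestronglyMeasurable _).sub hf.aestronglyMeasurable)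
    ((SimpleFunc.aestronglyMeasurable _).sub hf.aestronglyMeasurable) (by norm_num)

theorem tendsto_simpleIntegral_act {ι : Type*} {l : Filter ι} {s : ι → SimpleFunc ℝ ℂ}
    (hf : Measurable f) (h : MemLp f 2 (E.measureAt x))
    (hs : Tendsto (fun i => eLpNorm (⇑(s i) - f) 2 (E.measureAt x)) l (𝓝 0)) :
    Tendsto (fun i => E.simpleIntegral (s i) x) l (𝓝 (E.act f x)) := by
  rw [tendsto_iff_edist_tendsto_0]
  exact tendsto_of_tendsto_of_tendsto_of_le_of_le tendsto_const_nhds hs (fun _ => zero_le)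
    fun i => E.edist_simpleIntegral_act_le hf h _

theorem act_simpleFunc (s : SimpleFunc ℝ ℂ) (x : H) : E.act s x = E.simpleIntegral s x := by
  have h := E.edist_simpleIntegral_act_le (x := x) s.measurable
    (SimpleFunc.memLp_of_isFiniteMeasure s 2 _) s
  simp only [sub_self, eLpNorm_zero, nonpos_iff_eq_zero, edist_eq_zero] at h
  exact h.symm

theorem act_add (hf : Measurable f) (hg : Measurable g) (h : MemLp f 2 (E.measureAt x))
    (k : MemLp g 2 (E.measureAt x)) : E.act (f + g) x = E.act f x + E.act g x := by
  refine tendsto_nhds_unique ?_ ((E.tendsto_act hf h).add (E.tendsto_act hg k))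
  simp_rw [← E.simpleIntegral_add]
  refine E.tendsto_simpleIntegral_act (hf.add hg) (h.add k) ?_
  have h2 := (tendsto_eLpNorm_approx hf h).add (tendsto_eLpNorm_approx hg k)
  rw [add_zero] at h2
  refine tendsto_of_tendsto_of_tendsto_of_le_of_le tendsto_const_nhds h2 (fun _ => zero_le)
    fun n => ?_
  have : (⇑(approx f hf n + approx g hg n) : ℝ → ℂ) - (f + g) =
      (⇑(approx f hf n) - f) + (⇑(approx g hg n) - g) := by
    ext ω; simp; ring
  simp only [this]
  exact eLpNorm_add_le ((SimpleFunc.aestronglyMeasurable _).sub hf.aestronglyMeasurable)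
    ((SimpleFunc.aestronglyMeasurable _).sub hg.aestronglyMeasurable) (by norm_num)

theorem act_smul (c : ℂ) (hf : Measurable f) (h : MemLp f 2 (E.measureAt x)) :
    E.act (c • f) x = c • E.act f x := by
  refine tendsto_nhds_unique ?_ ((E.tendsto_act hf h).const_smul c)
  simp_rw [← E.simpleIntegral_smul]
  refine E.tendsto_simpleIntegral_act (hf.const_smul c) (h.const_smul c) ?_
  have h2 := ENNReal.Tendsto.const_mul (a := ‖c‖ₑ) (tendsto_eLpNorm_approx hf h) (by simp)
  rw [mul_zero] at h2
  refine h2.congr fun n => ?_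
  rw [← eLpNorm_const_smul, smul_sub]
  rfl

theorem act_neg (hf : Measurable f) (h : MemLp f 2 (E.measureAt x)) :
    E.act (-f) x = -E.act f x := by
  have := E.act_smul (-1) hf h
  simpa using this

theorem act_sub (hf : Measurable f) (hg : Measurable g) (h : MemLp f 2 (E.measureAt x))
    (k : MemLp g 2 (E.measureAt x)) : E.act (f - g) x = E.act f x - E.act g x := by
  rw [sub_eq_add_neg, E.act_add hf hg.neg h k.neg, E.act_neg hg k, sub_eq_add_neg]

/-- The isometry survives the limit because the L² seminorms of the approximants converge, by the
triangle inequality in both directions. -/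
theorem enorm_act (hf : Measurable f) (h : MemLp f 2 (E.measureAt x)) :
    ‖E.act f x‖ₑ = eLpNorm f 2 (E.measureAt x) := by
  have hd := tendsto_eLpNorm_approx hf h
  have h1 : Tendsto (fun n => ‖E.simpleIntegral (approx f hf n) x‖ₑ) atTop (𝓝 ‖E.act f x‖ₑ) :=
    (E.tendsto_act hf h).enorm
  simp_rw [enorm_simpleIntegral] at h1
  have hm : ∀ n, AEStronglyMeasurable (⇑(approx f hf n) - f) (E.measureAt x) := fun n =>
    (SimpleFunc.aestronglyMeasurable _).sub hf.aestronglyMeasurable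
  apply le_antisymm
  · have h2 := hd.const_add (eLpNorm f 2 (E.measureAt x))
    rw [add_zero] at h2
    refine le_of_tendsto_of_tendsto' h1 h2 fun n => ?_
    have : (⇑(approx f hf n) : ℝ → ℂ) = f + (⇑(approx f hf n) - f) := by ext ω; simp
    conv_lhs => rw [this]
    exact eLpNorm_add_le hf.aestronglyMeasurable (hm n) (by norm_num)
  · have h2 := h1.add hd
    rw [add_zero] at h2
    refine le_of_tendsto_of_tendsto' tendsto_const_nhds h2 fun n => ?_
    have : f = ⇑(approx f hf n) - (⇑(approx f hf n) - f) := by ext ω; simp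
    conv_lhs => rw [this]
    exact eLpNorm_sub_le (SimpleFunc.aestronglyMeasurable _) (hm n) (by norm_num)

theorem edist_act (hf : Measurable f) (hg : Measurable g) (h : MemLp f 2 (E.measureAt x))
    (k : MemLp g 2 (E.measureAt x)) :
    edist (E.act f x) (E.act g x) = eLpNorm (f - g) 2 (E.measureAt x) := by
  rw [edist_eq_enorm_sub, ← E.act_sub hf hg h k, E.enorm_act (hf.sub hg) (h.sub k)]

theorem tendsto_act_of_tendsto {ι : Type*} {l : Filter ι} {F : ι → ℝ → ℂ}
    (hF : ∀ i, Measurable (F i)) (hf : Measurable f)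
    (h' : ∀ i, MemLp (F i) 2 (E.measureAt x)) (h : MemLp f 2 (E.measureAt x))
    (hs : Tendsto (fun i => eLpNorm (F i - f) 2 (E.measureAt x)) l (𝓝 0)) :
    Tendsto (fun i => E.act (F i) x) l (𝓝 (E.act f x)) := by
  rw [tendsto_iff_edist_tendsto_0]
  exact hs.congr fun i => (E.edist_act (hF i) hf (h' i) h).symm

/-- Dominated convergence for spectral integrals. -/
theorem tendsto_act_of_dominated {ι : Type*} {l : Filter ι} [l.IsCountablyGenerated]
    {F : ι → ℝ → ℂ} (b : ℝ → ℝ) (hF : ∀ i, Measurable (F i)) (hf : Measurable f)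
    (hb : MemLp b 2 (E.measureAt x)) (hFb : ∀ i ω, ‖F i ω‖ ≤ b ω)
    (hlim : ∀ ω, Tendsto (fun i => F i ω) l (𝓝 (f ω))) :
    Tendsto (fun i => E.act (F i) x) l (𝓝 (E.act f x)) := by
  rcases l.eq_or_neBot with rfl | hl
  · exact tendsto_bot
  have hfb : ∀ ω, ‖f ω‖ ≤ b ω := fun ω =>
    le_of_tendsto' (hlim ω).norm fun i => hFb i ω
  have hfL : MemLp f 2 (E.measureAt x) :=
    hb.mono' hf.aestronglyMeasurable (ae_of_all _ hfb)
  have hFL : ∀ i, MemLp (F i) 2 (E.measureAt x) := fun i =>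
    hb.mono' (hF i).aestronglyMeasurable (ae_of_all _ (hFb i))
  refine E.tendsto_act_of_tendsto hF hf hFL hfL ?_
  have key : Tendsto (fun i => ∫⁻ ω, ‖(F i - f) ω‖ₑ ^ 2 ∂(E.measureAt x)) l
      (𝓝 (∫⁻ _, 0 ∂(E.measureAt x))) := by
    refine tendsto_lintegral_filter_of_dominated_convergence (fun ω => ‖(2 : ℝ) • b ω‖ₑ ^ 2)
      (Eventually.of_forall fun i => ((hF i).sub hf).enorm.pow_const 2)
      (Eventually.of_forall fun i => ae_of_all _ fun ω => ?_) ?_ (ae_of_all _ fun ω => ?_)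
    · gcongr
      rw [enorm_le_iff_norm_le]
      calc ‖(F i - f) ω‖ ≤ ‖F i ω‖ + ‖f ω‖ := norm_sub_le _ _
        _ ≤ b ω + b ω := add_le_add (hFb i ω) (hfb ω)
        _ ≤ ‖(2 : ℝ) • b ω‖ := by rw [← two_mul]; exact le_abs_self _
    · have h3 := (hb.const_smul (2 : ℝ)).eLpNorm_lt_top
      rw [eLpNorm_lt_top_iff_lintegral_rpow_enorm_lt_top (by norm_num) (by norm_num)] at h3
      simpa using h3.ne
    · have := ENNReal.Tendsto.pow (n := 2) ((hlim ω).sub_const (f ω)).enorm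
      simpa using this
  simp only [lintegral_zero] at key
  simp_rw [← sq_eLpNorm_two] at key
  have h4 := ((ENNReal.continuous_rpow_const (y := ((2 : ℕ) : ℝ)⁻¹)).tendsto 0).comp key
  rw [ENNReal.zero_rpow_of_pos (by positivity)] at h4
  exact h4.congr fun i => ENNReal.pow_rpow_inv_natCast two_ne_zero _

end Vector

end ProjMeasure

namespace ProjMeasure

variable {H : Type*} [NormedAddCommGroup H] [InnerProductSpace ℂ H] [CompleteSpace H]
  (E : ProjMeasure H)

/-! ### Multiplicativity -/

theorem apply_apply_self {s : Set ℝ} (hs : MeasurableSet s) (x : H) : E s (E s x) = E s x := by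
  have := congrArg (fun T : H →L[ℂ] H => T x) (E.isProj s hs).isIdempotentElem.eq
  simpa using this

theorem inner_apply_left {s : Set ℝ} (hs : MeasurableSet s) (x y : H) :
    inner ℂ (E s x) y = inner ℂ x (E s y) := by
  have h : ContinuousLinearMap.adjoint (E s) = E s := (E.isProj s hs).isSelfAdjoint
  rw [← ContinuousLinearMap.adjoint_inner_right, h]

/-- `inner_apply_of_disjoint` has the same vector on both sides; taken at `E t x` it says that ‖E s
(E t x)‖² = 0. -/
theorem apply_apply_of_disjoint {s t : Set ℝ} (hs : MeasurableSet s) (ht : MeasurableSet t)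
    (h : Disjoint s t) (x : H) : E s (E t x) = 0 := by
  have h1 := E.inner_apply_of_disjoint hs ht h (E t x)
  rw [E.apply_apply_self ht] at h1
  rw [← inner_self_eq_zero (𝕜 := ℂ), ← E.inner_apply_left hs, E.apply_apply_self hs, h1]

/-- Split `t` along `s` and `s` along `t`; all terms with disjoint sets vanish, leaving `E (s ∩ t)`
twice. -/
theorem apply_apply {s t : Set ℝ} (hs : MeasurableSet s) (ht : MeasurableSet t) (x : H) :
    E s (E t x) = E (s ∩ t) x := by
  have h1 := E.apply_union (hs.inter ht) (ht.diff hs)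
    (Set.disjoint_left.2 fun a ha hb => hb.2 ha.1) x
  have h2 := E.apply_union (hs.inter ht) (hs.diff ht)
    (Set.disjoint_left.2 fun a ha hb => hb.2 ha.2) (E (s ∩ t) x)
  rw [Set.inter_comm, Set.inter_union_sdiff, Set.inter_comm] at h1
  rw [Set.inter_union_sdiff] at h2
  rw [h1, map_add, E.apply_apply_of_disjoint hs (ht.diff hs) Set.disjoint_sdiff_right, add_zero,
    h2, E.apply_apply_self (hs.inter ht), E.apply_apply_of_disjoint (hs.diff ht) (hs.inter ht)
      (Set.disjoint_left.2 fun a ha hb => ha.2 hb.2), add_zero]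

theorem apply_simpleIntegral {s : Set ℝ} (hs : MeasurableSet s) (f : SimpleFunc ℝ ℂ) (x : H) :
    E s (E.simpleIntegral f x) = E.act (s.indicator f) x := by
  induction f using SimpleFunc.induction with
  | const c ht =>
    rename_i t
    rw [simpleIntegral_indicator, map_smul, E.apply_apply hs ht,
      ← E.simpleIntegral_indicator c (hs.inter ht), ← act_simpleFunc]
    congr 1
    ext ω
    by_cases h1 : ω ∈ s <;> by_cases h2 : ω ∈ t <;> simp [Set.indicator, h1, h2]
  | @add f g _ hf hg =>
    rw [simpleIntegral_add, map_add, hf, hg, ← E.act_add (f.measurable.indicator hs)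
      (g.measurable.indicator hs)]
    · congr 1
      ext ω
      by_cases h1 : ω ∈ s <;> simp [Set.indicator, h1]
    · exact (f.memLp_of_isFiniteMeasure 2 _).indicator hs
    · exact (g.memLp_of_isFiniteMeasure 2 _).indicator hs

section Vector

variable {f g : ℝ → ℂ} {x : H}

theorem apply_act {s : Set ℝ} (hs : MeasurableSet s) (hf : Measurable f)
    (h : MemLp f 2 (E.measureAt x)) : E s (E.act f x) = E.act (s.indicator f) x := by
  have h1 := ((E s).continuous.tendsto _).comp (E.tendsto_act hf h)
  refine tendsto_nhds_unique h1 ?_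
  simp only [Function.comp_def, E.apply_simpleIntegral hs]
  refine E.tendsto_act_of_tendsto (fun n => (SimpleFunc.measurable _).indicator hs)
    (hf.indicator hs) (fun n => (SimpleFunc.memLp_of_isFiniteMeasure _ 2 _).indicator hs)
    (h.indicator hs) ?_
  refine tendsto_of_tendsto_of_tendsto_of_le_of_le tendsto_const_nhds
    (tendsto_eLpNorm_approx hf h) (fun _ => zero_le) fun n => ?_
  simp only
  rw [← Set.indicator_sub']
  exact eLpNorm_indicator_le _

theorem act_indicator_one {s : Set ℝ} (hs : MeasurableSet s) (x : H) :
    E.act (s.indicator 1) x = E s x := by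
  have := E.simpleIntegral_indicator 1 hs x
  rw [← act_simpleFunc, one_smul] at this
  rw [← this]
  congr 1

theorem act_const (c : ℂ) (x : H) : E.act (fun _ => c) x = c • x := by
  have := E.simpleIntegral_indicator c .univ x
  rw [← act_simpleFunc, E.univ] at this
  rw [show c • x = c • (1 : H →L[ℂ] H) x from rfl, ← this]
  congr 1
  ext ω
  simp

/-- Cutting off with `E s` multiplies the integrand by an indicator, and the isometry computes the
norm. This turns questions about the domain of a product of spectral integrals into weighted L²
integrability. -/
theorem measureAt_act (hf : Measurable f) (h : MemLp f 2 (E.measureAt x)) :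
    E.measureAt (E.act f x) = (E.measureAt x).withDensity fun ω => ‖f ω‖ₑ ^ 2 := by
  ext s hs
  rw [E.measureAt_apply _ hs, withDensity_apply _ hs, E.apply_act hs hf h,
    ENNReal.ofReal_pow (norm_nonneg _), ofReal_norm, E.enorm_act (hf.indicator hs)
    (h.indicator hs), sq_eLpNorm_two, ← lintegral_indicator hs]
  refine lintegral_congr fun ω => ?_
  by_cases hω : ω ∈ s <;> simp [hω]

theorem eLpNorm_measureAt_act (hf : Measurable f) (h : MemLp f 2 (E.measureAt x))
    (hg : Measurable g) :
    eLpNorm g 2 (E.measureAt (E.act f x)) = eLpNorm (g * f) 2 (E.measureAt x) := by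
  refine (ENNReal.pow_right_strictMono two_ne_zero).injective ?_
  simp only [sq_eLpNorm_two]
  rw [E.measureAt_act hf h, lintegral_withDensity_eq_lintegral_mul _ (by fun_prop) (by fun_prop)]
  refine lintegral_congr fun ω => ?_
  simp [enorm_mul, mul_pow, mul_comm]

theorem memLp_measureAt_act_iff (hf : Measurable f) (h : MemLp f 2 (E.measureAt x))
    (hg : Measurable g) :
    MemLp g 2 (E.measureAt (E.act f x)) ↔ MemLp (g * f) 2 (E.measureAt x) := by
  rw [MemLp, MemLp, E.eLpNorm_measureAt_act hf h hg, and_iff_right hg.aestronglyMeasurable,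
    and_iff_right (hg.mul hf).aestronglyMeasurable]

theorem simpleIntegral_act (hf : Measurable f) (h : MemLp f 2 (E.measureAt x))
    (s : SimpleFunc ℝ ℂ) : E.simpleIntegral s (E.act f x) = E.act (s * f) x := by
  have hm : ∀ t : SimpleFunc ℝ ℂ, MemLp (⇑t * f) 2 (E.measureAt x) := fun t =>
    (E.memLp_measureAt_act_iff hf h t.measurable).1 (t.memLp_of_isFiniteMeasure 2 _)
  induction s using SimpleFunc.induction with
  | const c ht =>
    rename_i t
    rw [simpleIntegral_indicator, E.apply_act ht hf h,
      ← E.act_smul c (hf.indicator ht) (h.indicator ht)]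
    congr 1
    ext ω
    by_cases h2 : ω ∈ t <;> simp [h2]
  | @add r t _ hr ht =>
    rw [simpleIntegral_add, hr, ht, ← E.act_add (r.measurable.mul hf) (t.measurable.mul hf)
      (hm r) (hm t), SimpleFunc.coe_add, add_mul]

/-- Clear for simple `g`. In general, L² convergence of the approximants of `g` for the measure of
`act f x` is the same as L² convergence of their products with `f` for the measure of `x`. -/
theorem act_act (hf : Measurable f) (h : MemLp f 2 (E.measureAt x)) (hg : Measurable g)
    (k : MemLp (g * f) 2 (E.measureAt x)) : E.act g (E.act f x) = E.act (g * f) x := by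
  have k' := (E.memLp_measureAt_act_iff hf h hg).2 k
  refine tendsto_nhds_unique (E.tendsto_act hg k') ?_
  simp only [E.simpleIntegral_act hf h]
  refine E.tendsto_act_of_tendsto (fun n => (SimpleFunc.measurable _).mul hf) (hg.mul hf)
    (fun n => (E.memLp_measureAt_act_iff hf h (SimpleFunc.measurable _)).1
      (SimpleFunc.memLp_of_isFiniteMeasure _ 2 _)) k ?_
  refine (tendsto_eLpNorm_approx hg k').congr fun n => ?_
  rw [E.eLpNorm_measureAt_act hf h ((SimpleFunc.measurable _).sub hg), sub_mul]

theorem memLp_of_bound (hf : Measurable f) {C : ℝ} (hC : ∀ ω, ‖f ω‖ ≤ C) :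
    MemLp f 2 (E.measureAt x) :=
  MemLp.of_bound hf.aestronglyMeasurable C (ae_of_all _ hC)

end Vector

/-! ### Adjoints -/

theorem measurable_star_fun {f : ℝ → ℂ} (hf : Measurable f) : Measurable (star f) :=
  continuous_star.measurable.comp hf

theorem inner_simpleIntegral_left (s : SimpleFunc ℝ ℂ) (x y : H) :
    inner ℂ (E.simpleIntegral s x) y = inner ℂ x (E.simpleIntegral (s.map star) y) := by
  induction s using SimpleFunc.induction with
  | const c ht =>
    rename_i t
    rw [simpleIntegral_indicator, inner_smul_left, E.inner_apply_left ht, ← inner_smul_right,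
      ← act_simpleFunc]
    have := E.simpleIntegral_indicator (star c) ht y
    rw [← act_simpleFunc] at this
    rw [starRingEnd_apply, ← this]
    congr 2
    ext ω
    by_cases h2 : ω ∈ t <;> simp [h2]
  | @add r t _ hr ht =>
    rw [simpleIntegral_add, inner_add_left, hr, ht, ← inner_add_right, ← simpleIntegral_add]
    simp only [← act_simpleFunc]
    congr 2
    ext ω
    simp

theorem inner_act_left {f : ℝ → ℂ} (hf : Measurable f) {x y : H}
    (h : MemLp f 2 (E.measureAt x)) (k : MemLp f 2 (E.measureAt y)) :
    inner ℂ (E.act f x) y = inner ℂ x (E.act (star f) y) := by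
  have h1 := (E.tendsto_act hf h).inner (𝕜 := ℂ) (tendsto_const_nhds (x := y))
  have h2 : Tendsto (fun n => inner ℂ x (E.simpleIntegral ((approx f hf n).map star) y)) atTop
      (𝓝 (inner ℂ x (E.act (star f) y))) := by
    refine tendsto_const_nhds.inner (E.tendsto_simpleIntegral_act (measurable_star_fun hf) k.star ?_)
    refine (tendsto_eLpNorm_approx hf k).congr fun n => ?_
    refine eLpNorm_congr_norm_ae (ae_of_all _ fun ω => ?_)
    simp only [SimpleFunc.coe_map, Pi.sub_apply, Function.comp_apply, Pi.star_apply, ← star_sub,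
      norm_star]
  simp_rw [← E.inner_simpleIntegral_left] at h2
  exact tendsto_nhds_unique h1 h2

/-- Truncation to the sets where |f| ≤ n. The truncated vectors lie in the domain of ∫ f dE, which
yields its density and, below, the control of the adjoint. -/
theorem tendsto_apply_norm_le (f : ℝ → ℂ) (hf : Measurable f) (x : H) :
    Tendsto (fun n : ℕ => E {ω | ‖f ω‖ ≤ n} x) atTop (𝓝 x) := by
  have hm : ∀ n : ℕ, MeasurableSet {ω | ‖f ω‖ ≤ n} := fun n =>
    measurableSet_le hf.norm measurable_const
  have h1 : ∀ n : ℕ, E {ω | ‖f ω‖ ≤ n} x = E.act ({ω | ‖f ω‖ ≤ n}.indicator 1) x := fun n =>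
    (E.act_indicator_one (hm n) x).symm
  have h2 : x = E.act (fun _ => 1) x := by rw [act_const, one_smul]
  simp_rw [h1]
  conv => enter [3, 1]; rw [h2]
  refine E.tendsto_act_of_dominated (fun _ => 1) (fun n => measurable_one.indicator (hm n))
    measurable_const (memLp_const _) (fun n ω => ?_) fun ω => ?_
  · refine (norm_indicator_le_norm_self _ _).trans (by simp)
  · obtain ⟨N, hN⟩ := exists_nat_ge ‖f ω‖
    refine tendsto_const_nhds.congr' ?_
    filter_upwards [eventually_ge_atTop N] with n hn
    have : ω ∈ {ω | ‖f ω‖ ≤ n} := hN.trans (by exact_mod_cast hn)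
    simp [Set.indicator, this]

theorem memLp_apply_norm_le {f : ℝ → ℂ} (hf : Measurable f) (n : ℕ) (x : H) :
    MemLp f 2 (E.measureAt (E {ω | ‖f ω‖ ≤ n} x)) := by
  have hm : MeasurableSet {ω | ‖f ω‖ ≤ n} := measurableSet_le hf.norm measurable_const
  have h1 : MemLp ({ω | ‖f ω‖ ≤ n}.indicator (1 : ℝ → ℂ)) 2 (E.measureAt x) :=
    (memLp_const (1 : ℂ)).indicator hm
  rw [← E.act_indicator_one hm, E.memLp_measureAt_act_iff (measurable_one.indicator hm) h1 hf]
  refine E.memLp_of_bound (hf.mul (measurable_one.indicator hm)) (C := n) fun ω => ?_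
  by_cases hω : ‖f ω‖ ≤ n <;> simp [Set.indicator, hω]

theorem dense_domain_integral (f : ℝ → ℂ) (hf : Measurable f) :
    Dense ((E.integral f hf).domain : Set H) := fun x =>
  mem_closure_of_tendsto (E.tendsto_apply_norm_le f hf x) (Eventually.of_forall fun n =>
    mem_domain_integral.2 (E.memLp_apply_norm_le hf n x))

/-- One inclusion is formal adjointness. Conversely, let z be the adjoint applied to y. Testing
against vectors truncated to |f| ≤ n shows that the truncated integral of `star f` at y is a
projection of z, hence has norm at most ‖z‖. By the isometry and Fatou's lemma, f is in L² for the
measure of y. -/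
theorem adjoint_integral (f : ℝ → ℂ) (hf : Measurable f) :
    (E.integral f hf).adjoint = E.integral (star f) (measurable_star_fun hf) := by
  have hd := E.dense_domain_integral f hf
  have hmem : ∀ {y}, MemLp (star f) 2 (E.measureAt y) ↔ MemLp f 2 (E.measureAt y) :=
    ⟨fun h => by simpa using h.star, fun h => h.star⟩
  have hle : E.integral (star f) (measurable_star_fun hf) ≤ (E.integral f hf).adjoint := by
    refine LinearPMap.IsFormalAdjoint.le_adjoint hd fun x y => ?_
    rw [integral_apply, integral_apply]
    exact E.inner_act_left hf (mem_domain_integral.1 x.2) (hmem.1 (mem_domain_integral.1 y.2))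
  refine (LinearPMap.eq_of_le_of_domain_eq hle (le_antisymm hle.1 fun y hy => ?_)).symm
  rw [mem_domain_integral, hmem]
  set z := (E.integral f hf).adjoint ⟨y, hy⟩ with hz
  have hB : ∀ n : ℕ, MeasurableSet {ω | ‖f ω‖ ≤ n} := fun n =>
    measurableSet_le hf.norm measurable_const
  have hfB : ∀ (n : ℕ) (x : H), MemLp ({ω | ‖f ω‖ ≤ n}.indicator f) 2 (E.measureAt x) :=
    fun n x => E.memLp_of_bound (hf.indicator (hB n)) (C := n) fun ω => by
      by_cases hω : ‖f ω‖ ≤ n <;> simp [Set.indicator, hω]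
  have hmul : ∀ n : ℕ, f * ({ω | ‖f ω‖ ≤ n}.indicator 1) = {ω | ‖f ω‖ ≤ n}.indicator f := by
    intro n
    ext ω
    by_cases hω : ‖f ω‖ ≤ n <;> simp [Set.indicator, hω]
  have key : ∀ n : ℕ, E.act (star ({ω | ‖f ω‖ ≤ n}.indicator f)) y = E {ω | ‖f ω‖ ≤ n} z := by
    intro n
    refine ext_inner_left ℂ fun x => ?_
    rw [← E.inner_act_left (hf.indicator (hB n)) (hfB n x) (hfB n y), ← E.inner_apply_left (hB n)]
    have hx := E.memLp_apply_norm_le hf n x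
    have h1 := LinearPMap.adjoint_isFormalAdjoint hd ⟨y, hy⟩
      ⟨E {ω | ‖f ω‖ ≤ n} x, mem_domain_integral.2 hx⟩
    rw [← hz, integral_apply] at h1
    have h2 : E.act f (E {ω | ‖f ω‖ ≤ n} x) = E.act ({ω | ‖f ω‖ ≤ n}.indicator f) x := by
      rw [← E.act_indicator_one (hB n), E.act_act (measurable_one.indicator (hB n))
        ((memLp_const (1 : ℂ)).indicator (hB n)) hf, hmul]
      rw [hmul]
      exact hfB n x
    simp only [h2] at h1
    rw [← inner_conj_symm, ← h1, inner_conj_symm]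
  have hbd : ∀ n : ℕ, eLpNorm ({ω | ‖f ω‖ ≤ n}.indicator f) 2 (E.measureAt y) ≤ ‖z‖ₑ := by
    intro n
    have h1 := E.enorm_act (x := y) (measurable_star_fun (hf.indicator (hB n))) (hfB n y).star
    rw [key n] at h1
    rw [← eLpNorm_star, ← h1, enorm_le_iff_norm_le]
    have hp := E.norm_sq_apply (hB n) z
    have hq : ‖E {ω | ‖f ω‖ ≤ n} z‖ ^ 2 ≤ ‖z‖ * ‖E {ω | ‖f ω‖ ≤ n} z‖ := by
      rw [hp]
      exact (RCLike.re_le_norm _).trans (norm_inner_le_norm _ _)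
    by_contra! hlt
    nlinarith [norm_nonneg z]
  rw [E.memLp_iff hf]
  refine lt_of_le_of_lt (b := ‖z‖ₑ ^ 2) ?_ (by simp)
  have hlim : ∀ ω, Tendsto (fun n : ℕ => ‖{ω | ‖f ω‖ ≤ n}.indicator f ω‖ₑ ^ 2) atTop
      (𝓝 (‖f ω‖ₑ ^ 2)) := fun ω => by
    obtain ⟨N, hN⟩ := exists_nat_ge ‖f ω‖
    refine tendsto_const_nhds.congr' ?_
    filter_upwards [eventually_ge_atTop N] with n hn
    have : ω ∈ {ω | ‖f ω‖ ≤ n} := hN.trans (by exact_mod_cast hn)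
    simp [Set.indicator, this]
  calc ∫⁻ ω, ‖f ω‖ₑ ^ 2 ∂(E.measureAt y)
      = ∫⁻ ω, liminf (fun n : ℕ => ‖{ω | ‖f ω‖ ≤ n}.indicator f ω‖ₑ ^ 2) atTop
          ∂(E.measureAt y) := lintegral_congr fun ω => (hlim ω).liminf_eq.symm
    _ ≤ liminf (fun n : ℕ => ∫⁻ ω, ‖{ω | ‖f ω‖ ≤ n}.indicator f ω‖ₑ ^ 2 ∂(E.measureAt y))
          atTop := lintegral_liminf_le fun n => ((hf.indicator (hB n)).enorm.pow_const 2)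
    _ ≤ ‖z‖ₑ ^ 2 := by
      refine liminf_le_of_frequently_le' (Frequently.of_forall fun n => ?_)
      rw [← sq_eLpNorm_two]
      exact pow_le_pow_left' (hbd n) 2

theorem integral_congr {f g : ℝ → ℂ} (hf : Measurable f) (h : f = g) :
    E.integral f hf = E.integral g (h ▸ hf) := by subst h; rfl

theorem integral_neg (f : ℝ → ℂ) (hf : Measurable f) :
    E.integral (-f) hf.neg = -E.integral f hf := by
  have hdom : (E.integral (-f) hf.neg).domain = (-E.integral f hf).domain := by
    ext x
    rw [LinearPMap.neg_domain, mem_domain_integral, mem_domain_integral]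
    exact ⟨fun h => by simpa using h.neg, fun h => h.neg⟩
  refine LinearPMap.ext hdom fun x hx hx' => ?_
  rw [LinearPMap.neg_apply, integral_apply, integral_apply]
  exact E.act_neg hf ((mem_domain_integral (hf := hf)).1 hx')

theorem isSkewAdjoint_integral (p : ℝ → ℝ) (hp : Measurable fun ω => Complex.I * (p ω : ℂ)) :
    IsSkewAdjoint (E.integral (fun ω => Complex.I * (p ω : ℂ)) hp) := by
  refine ⟨E.dense_domain_integral _ hp, ?_⟩
  rw [adjoint_integral, ← integral_neg]
  congr 1
  ext ω
  simp

end ProjMeasure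

namespace ProjMeasure

variable {H : Type*} [NormedAddCommGroup H] [InnerProductSpace ℂ H] [CompleteSpace H]
  (E : ProjMeasure H)

/-! ### Bounded functions -/

theorem act_add_vec {f : ℝ → ℂ} (hf : Measurable f) {x y : H}
    (hx : MemLp f 2 (E.measureAt x)) (hy : MemLp f 2 (E.measureAt y)) :
    E.act f (x + y) = E.act f x + E.act f y := by
  have h := (E.integral f hf).map_add ⟨x, mem_domain_integral.2 hx⟩ ⟨y, mem_domain_integral.2 hy⟩
  simp only [integral_apply] at h
  exact h

theorem act_smul_vec {f : ℝ → ℂ} (hf : Measurable f) (c : ℂ) {x : H}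
    (hx : MemLp f 2 (E.measureAt x)) : E.act f (c • x) = c • E.act f x := by
  have h := (E.integral f hf).map_smul c ⟨x, mem_domain_integral.2 hx⟩
  simp only [integral_apply] at h
  exact h

theorem norm_act_le {f : ℝ → ℂ} (hf : Measurable f) {C : ℝ} (hC : ∀ ω, ‖f ω‖ ≤ C) (x : H) :
    ‖E.act f x‖ ≤ C * ‖x‖ := by
  have hC0 : 0 ≤ C := (norm_nonneg _).trans (hC 0)
  have h1 : ‖E.act f x‖ₑ ≤ ‖E.act (fun _ => (C : ℂ)) x‖ₑ := by
    rw [E.enorm_act hf (E.memLp_of_bound hf hC), E.enorm_act measurable_const (memLp_const _)]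
    refine eLpNorm_mono fun ω => (hC ω).trans ?_
    simp [abs_of_nonneg hC0]
  rw [enorm_le_iff_norm_le, act_const, norm_smul] at h1
  simpa [abs_of_nonneg hC0] using h1

/-- The spectral integral of a bounded function, as a bounded operator. -/
def actCLM (f : ℝ → ℂ) (hf : Measurable f) (C : ℝ) (hC : ∀ ω, ‖f ω‖ ≤ C) : H →L[ℂ] H :=
  LinearMap.mkContinuous
    { toFun := E.act f
      map_add' := fun _ _ => E.act_add_vec hf (E.memLp_of_bound hf hC) (E.memLp_of_bound hf hC)
      map_smul' := fun c _ => E.act_smul_vec hf c (E.memLp_of_bound hf hC) }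
    C (E.norm_act_le hf hC)

@[simp]
theorem actCLM_apply {f : ℝ → ℂ} (hf : Measurable f) {C : ℝ} (hC : ∀ ω, ‖f ω‖ ≤ C) (x : H) :
    E.actCLM f hf C hC x = E.act f x := rfl

theorem integral_eq_toPMap {f : ℝ → ℂ} (hf : Measurable f) {C : ℝ} (hC : ∀ ω, ‖f ω‖ ≤ C)
    (T : H →L[ℂ] H) (hT : ∀ x, E.act f x = T x) :
    E.integral f hf = T.toLinearMap.toPMap ⊤ := by
  have hdom : (E.integral f hf).domain = ⊤ :=
    top_unique fun x _ => mem_domain_integral.2 (E.memLp_of_bound hf hC)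
  refine LinearPMap.ext hdom fun x hx _ => ?_
  rw [integral_apply]
  exact hT x

theorem ext_toFun {E F : ProjMeasure H} (h : ∀ s, MeasurableSet s → ∀ x, E s x = F s x) :
    E = F := by
  have : E.toFun = F.toFun := by
    funext s
    by_cases hs : MeasurableSet s
    · ext x; exact h s hs x
    · rw [E.not_measurable s hs, F.not_measurable s hs]
  cases E; cases F; congr

/-! ### Push-forward -/

open Classical in
/-- The push-forward `s ↦ E (φ⁻¹ s)`. -/
def map (φ : ℝ → ℝ) (hφ : Measurable φ) : ProjMeasure H where
  toFun s := if MeasurableSet s then E (φ ⁻¹' s) else 0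
  isProj s hs := by
    rw [if_pos hs]
    exact E.isProj _ (hφ hs)
  not_measurable s hs := if_neg hs
  univ := by simp [E.univ]
  hasSum s hs hd x := by
    rw [if_pos (MeasurableSet.iUnion hs), Set.preimage_iUnion]
    simp only [if_pos (hs _)]
    exact E.hasSum _ (fun n => hφ (hs n)) (fun i j hij => (hd hij).preimage φ) x

variable {φ : ℝ → ℝ} (hφ : Measurable φ)

theorem map_apply {s : Set ℝ} (hs : MeasurableSet s) : E.map φ hφ s = E (φ ⁻¹' s) := if_pos hs

theorem measureAt_map (x : H) : (E.map φ hφ).measureAt x = (E.measureAt x).map φ := by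
  ext s hs
  rw [measureAt_apply _ _ hs, Measure.map_apply hφ hs, measureAt_apply _ _ (hφ hs),
    map_apply E hφ hs]

theorem simpleIntegral_map (s : SimpleFunc ℝ ℂ) (x : H) :
    (E.map φ hφ).simpleIntegral s x = E.simpleIntegral (s.comp φ hφ) x := by
  induction s using SimpleFunc.induction with
  | const c ht =>
    rw [simpleIntegral_indicator, map_apply E hφ ht, ← E.simpleIntegral_indicator c (hφ ht)]
    congr 2
  | @add r t _ hr ht =>
    rw [simpleIntegral_add, hr, ht, ← simpleIntegral_add]
    rfl

theorem memLp_map_iff {f : ℝ → ℂ} (hf : Measurable f) (x : H) :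
    MemLp f 2 ((E.map φ hφ).measureAt x) ↔ MemLp (f ∘ φ) 2 (E.measureAt x) := by
  rw [measureAt_map, memLp_map_measure_iff hf.aestronglyMeasurable hφ.aemeasurable]

theorem act_map {f : ℝ → ℂ} (hf : Measurable f) {x : H}
    (h : MemLp (f ∘ φ) 2 (E.measureAt x)) : (E.map φ hφ).act f x = E.act (f ∘ φ) x := by
  have h' := (E.memLp_map_iff hφ hf x).2 h
  refine tendsto_nhds_unique (tendsto_act _ hf h') ?_
  simp only [simpleIntegral_map]
  refine E.tendsto_simpleIntegral_act (hf.comp hφ) h ?_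
  refine (tendsto_eLpNorm_approx hf h').congr fun n => ?_
  rw [measureAt_map, eLpNorm_map_measure _ hφ.aemeasurable]
  · rfl
  · exact ((SimpleFunc.measurable _).sub hf).aestronglyMeasurable

/-- Change of variables. Together with uniqueness of the spectral measure it yields the composition
rule h(∫ i p dE) = ∫ h(ip) dE. -/
theorem integral_map {f : ℝ → ℂ} (hf : Measurable f) :
    (E.map φ hφ).integral f hf = E.integral (f ∘ φ) (hf.comp hφ) := by
  refine LinearPMap.ext ?_ fun x hx hx' => ?_
  · ext x
    rw [mem_domain_integral, mem_domain_integral, memLp_map_iff E hφ hf]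
  · rw [integral_apply, integral_apply]
    exact E.act_map hφ hf ((mem_domain_integral (hf := hf.comp hφ)).1 hx')

/-! ### Extension from a subspace by a point mass at `0` -/

section Extend

variable {K : Submodule ℂ H} [CompleteSpace K]

open Classical in
theorem default_apply {s : Set ℝ} (hs : MeasurableSet s) (x : H) :
    (default : ProjMeasure H) s x = if (0 : ℝ) ∈ s then x else 0 := by
  change (if MeasurableSet s ∧ (0 : ℝ) ∈ s then (1 : H →L[ℂ] H) else 0) x = _
  simp only [hs, true_and]
  split_ifs <;> rfl

open Classical in
theorem default_apply_eq (s : Set ℝ) :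
    (default : ProjMeasure H) s = 0 ∨ (default : ProjMeasure H) s = 1 := by
  change (if MeasurableSet s ∧ (0 : ℝ) ∈ s then (1 : H →L[ℂ] H) else 0) = 0 ∨
    (if MeasurableSet s ∧ (0 : ℝ) ∈ s then (1 : H →L[ℂ] H) else 0) = 1
  split_ifs <;> simp

/-- The projection-valued measure on `H` that is `F` on `K` and the point mass at `0` on `Kᗮ`. -/
def extend (F : ProjMeasure K) : ProjMeasure H where
  toFun s := K.subtypeL ∘L F s ∘L K.orthogonalProjectionOnto +
    (default : ProjMeasure H) s ∘L (1 - K.starProjection)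
  isProj s hs := by
    refine IsStarProjection.add ⟨?_, ?_⟩ ?_ ?_
    · ext x
      simp [F.apply_apply_self hs]
    · rw [ContinuousLinearMap.isSelfAdjoint_iff_isSymmetric]
      intro x y
      have h := F.inner_apply_left hs (K.orthogonalProjectionOnto x) (K.orthogonalProjectionOnto y)
      simpa using h
    -- The point mass only takes the values 0 and 1, so the second summand is 0 or the projection
    -- onto `Kᗮ`.
    · rcases default_apply_eq (H := H) s with h | h <;> rw [h]
      · rw [ContinuousLinearMap.zero_comp]; exact .zero _
      · exact isStarProjection_starProjection.one_sub
    · ext x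
      rcases default_apply_eq (H := H) s with h | h <;>
        simp [h, -Submodule.coe_orthogonalProjectionOnto_apply, Submodule.starProjection_apply]
  not_measurable s hs := by
    rw [F.not_measurable s hs, (default : ProjMeasure H).not_measurable s hs]; simp
  univ := by
    rw [F.univ, (default : ProjMeasure H).univ]
    ext x
    simp
  hasSum s hs hd x := by
    have h1 := (F.hasSum s hs hd (K.orthogonalProjectionOnto x)).mapL K.subtypeL
    have h2 := (default : ProjMeasure H).hasSum s hs hd (x - K.starProjection x)
    exact h1.add h2

theorem extend_apply (F : ProjMeasure K) (s : Set ℝ) (x : H) :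
    F.extend s x = F s (K.orthogonalProjectionOnto x) +
      (default : ProjMeasure H) s (x - K.starProjection x) := rfl

/-- Pythagoras: the two components of `F.extend s x` are orthogonal, and the one in `Kᗮ` is seen
only when `0 ∈ s`. -/
theorem measureAt_extend (F : ProjMeasure K) (x : H) :
    F.extend.measureAt x = F.measureAt (K.orthogonalProjectionOnto x) +
      ENNReal.ofReal (‖x - K.starProjection x‖ ^ 2) • Measure.dirac 0 := by
  classical
  ext s hs
  rw [measureAt_apply _ _ hs, Measure.add_apply, measureAt_apply _ _ hs, Measure.smul_apply,
    Measure.dirac_apply' _ hs, extend_apply, default_apply hs]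
  by_cases h0 : (0 : ℝ) ∈ s
  · rw [if_pos h0, Set.indicator_of_mem h0, Pi.one_apply, smul_eq_mul, mul_one,
      ← ENNReal.ofReal_add (by positivity) (by positivity)]
    congr 1
    have h := norm_add_sq_eq_norm_sq_add_norm_sq_of_inner_eq_zero (𝕜 := ℂ)
      ((F s (K.orthogonalProjectionOnto x) : K) : H) (x - K.starProjection x)
      (K.sub_starProjection_mem_orthogonal x _ (Submodule.coe_mem _))
    simp only [← pow_two] at h
    rw [h]
    rfl
  · simp [h0]

theorem memLp_extend_iff (F : ProjMeasure K) {f : ℝ → ℂ} (hf : Measurable f) (x : H) :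
    MemLp f 2 (F.extend.measureAt x) ↔
      MemLp f 2 (F.measureAt (K.orthogonalProjectionOnto x)) := by
  rw [memLp_iff _ hf, memLp_iff _ hf, measureAt_extend, lintegral_add_measure,
    lintegral_smul_measure, lintegral_dirac, ENNReal.add_lt_top, and_iff_left]
  exact ENNReal.mul_lt_top (by simp) (by simp)

theorem simpleIntegral_default (s : SimpleFunc ℝ ℂ) (x : H) :
    (default : ProjMeasure H).simpleIntegral s x = s 0 • x := by
  classical
  induction s using SimpleFunc.induction with
  | @const c t ht =>
    rw [simpleIntegral_indicator, default_apply ht]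
    by_cases h0 : (0 : ℝ) ∈ t <;> simp [h0]
  | @add r t _ hr ht =>
    rw [simpleIntegral_add, hr, ht, SimpleFunc.coe_add, Pi.add_apply, add_smul]

theorem simpleIntegral_extend (F : ProjMeasure K) (s : SimpleFunc ℝ ℂ) (x : H) :
    F.extend.simpleIntegral s x = F.simpleIntegral s (K.orthogonalProjectionOnto x) +
      s 0 • (x - K.starProjection x) := by
  rw [← simpleIntegral_default]
  simp only [simpleIntegral, _root_.sum_apply, _root_.smul_apply,
    extend_apply, smul_add, Finset.sum_add_distrib, Submodule.coe_sum, Submodule.coe_smul]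

theorem act_extend (F : ProjMeasure K) {f : ℝ → ℂ} (hf : Measurable f) {x : H}
    (h : MemLp f 2 (F.measureAt (K.orthogonalProjectionOnto x))) :
    F.extend.act f x = F.act f (K.orthogonalProjectionOnto x) +
      f 0 • (x - K.starProjection x) := by
  refine tendsto_nhds_unique (tendsto_act _ hf ((F.memLp_extend_iff hf x).2 h)) ?_
  simp only [simpleIntegral_extend]
  refine ((K.subtypeL.continuous.tendsto _).comp (F.tendsto_act hf h)).add ?_
  exact (SimpleFunc.tendsto_approxOn hf (Set.mem_univ 0) (by simp)).smul_const _

/-- On `Kᗮ` the extended integral is multiplication by `f 0`, whereas `sandwich` is zero there; this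
is where `f 0 = 0` is needed. -/
theorem sandwich_integral (F : ProjMeasure K) {f : ℝ → ℂ} (hf : Measurable f) (h0 : f 0 = 0) :
    sandwich K (F.integral f hf) = F.extend.integral f hf := by
  refine LinearPMap.ext ?_ fun x hx hx' => ?_
  · ext x
    rw [mem_domain_integral, memLp_extend_iff F hf, ← mem_domain_integral (hf := hf)]
    rfl
  · rw [integral_apply, act_extend F hf ((mem_domain_integral (hf := hf)).1 hx), h0, zero_smul,
      add_zero]
    exact congrArg Subtype.val (F.integral_apply (hf := hf) ⟨_, hx⟩)

end Extend

end ProjMeasure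

/-- The projection fixes `K` and `sandwich` takes values in `K`. Once V is known to be a sandwiched
operator, this identifies its restriction to H̃. -/
theorem partIn_sandwich {H : Type*} [NormedAddCommGroup H] [InnerProductSpace ℂ H]
    (K : Submodule ℂ H) [K.HasOrthogonalProjection] (B : K →ₗ.[ℂ] K) :
    partIn K (sandwich K B) = B := by
  have hP : ∀ x : K, K.orthogonalProjectionOnto (x : H) = x := fun x =>
    K.orthogonalProjectionOnto_mem_subspace_eq_self x
  refine LinearPMap.ext ?_ fun x hx hx' => ?_
  · ext x
    constructor
    · rintro ⟨h, _⟩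
      change K.orthogonalProjectionOnto (x : H) ∈ B.domain at h
      rwa [hP] at h
    · intro h
      have h' : (x : H) ∈ (sandwich K B).domain := by
        change K.orthogonalProjectionOnto (x : H) ∈ B.domain
        rwa [hP]
      exact ⟨h', Submodule.coe_mem _⟩
  · refine Subtype.ext ?_
    change ((B ⟨K.orthogonalProjectionOnto (x : H), _⟩ : K) : H) = B ⟨x, hx'⟩
    congr 3
    exact hP x

/-! ### The exponentials and the groups they generate -/

/-- The function `iω ↦ e^{iωt}`, as a function of `ω`. -/
def expFun (t ω : ℝ) : ℂ := Complex.exp (Complex.I * ω * t)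

theorem measurable_expFun (t : ℝ) : Measurable (expFun t) := by unfold expFun; fun_prop

theorem norm_expFun (t ω : ℝ) : ‖expFun t ω‖ = 1 := by
  rw [expFun, show Complex.I * ω * t = (ω * t : ℝ) * Complex.I by push_cast; ring,
    Complex.norm_exp_ofReal_mul_I]

theorem expFun_zero (ω : ℝ) : expFun 0 ω = 1 := by simp [expFun]

theorem expFun_add (s t ω : ℝ) : expFun (s + t) ω = expFun s ω * expFun t ω := by
  simp only [expFun, ← Complex.exp_add]
  push_cast
  ring_nf

theorem hasDerivAt_expFun (t ω : ℝ) :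
    HasDerivAt (fun t => expFun t ω) (Complex.I * ω * expFun t ω) t := by
  have h : HasDerivAt (fun t : ℝ => Complex.I * ω * (t : ℂ)) (Complex.I * ω * 1) t :=
    Complex.ofRealCLM.hasDerivAt.const_mul _
  have := h.cexp
  rw [mul_one] at this
  rw [mul_comm]
  exact this

/-- The difference quotients are thus dominated by |ω|, which is square integrable exactly when the
vector is in the domain of ∫ iω dE. -/
theorem norm_expFun_add_sub_le (t h ω : ℝ) : ‖expFun (t + h) ω - expFun t ω‖ ≤ |h| * |ω| := by
  have h1 : expFun (t + h) ω - expFun t ω =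
      expFun t ω * (Complex.exp (Complex.I * (ω * h : ℝ)) - 1) := by
    rw [expFun_add, mul_sub, mul_one, expFun, expFun]
    push_cast
    ring_nf
  rw [h1, norm_mul, norm_expFun, one_mul]
  refine (Real.norm_exp_I_mul_ofReal_sub_one_le).trans ?_
  rw [Real.norm_eq_abs, abs_mul, mul_comm]

namespace ProjMeasure

variable {H : Type*} [NormedAddCommGroup H] [InnerProductSpace ℂ H] [CompleteSpace H]
  (E : ProjMeasure H)

theorem measurable_I_mul : Measurable fun ω : ℝ => Complex.I * (ω : ℂ) := by fun_prop

theorem memLp_expFun (t : ℝ) (x : H) : MemLp (expFun t) 2 (E.measureAt x) :=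
  E.memLp_of_bound (measurable_expFun t) fun ω => (norm_expFun t ω).le

theorem act_expFun_zero (x : H) : E.act (expFun 0) x = x := by
  have h : expFun 0 = fun _ => 1 := funext expFun_zero
  rw [h, act_const, one_smul]

theorem hasDerivAt_act_expFun {x : H}
    (hx : MemLp (fun ω : ℝ => Complex.I * (ω : ℂ)) 2 (E.measureAt x)) (t : ℝ) :
    HasDerivAt (fun t => E.act (expFun t) x)
      (E.act (fun ω => Complex.I * ω * expFun t ω) x) t := by
  rw [hasDerivAt_iff_tendsto_slope_zero]
  have h1 : ∀ h : ℝ, h⁻¹ • (E.act (expFun (t + h)) x - E.act (expFun t) x) =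
      E.act (((h⁻¹ : ℝ) : ℂ) • (expFun (t + h) - expFun t)) x := fun h => by
    rw [E.act_smul _ ((measurable_expFun _).sub (measurable_expFun _))
      ((E.memLp_expFun _ x).sub (E.memLp_expFun _ x)),
      E.act_sub (measurable_expFun _) (measurable_expFun _) (E.memLp_expFun _ x)
      (E.memLp_expFun _ x), Complex.coe_smul]
  simp_rw [h1]
  refine E.tendsto_act_of_dominated (fun ω => ‖Complex.I * (ω : ℂ)‖)
    (fun h => ((measurable_expFun _).sub (measurable_expFun _)).const_smul _)
    (measurable_I_mul.mul (measurable_expFun t)) hx.norm (fun h ω => ?_) fun ω => ?_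
  · simp only [Pi.smul_apply, Pi.sub_apply, norm_smul, norm_mul, Complex.norm_I, one_mul,
      Complex.norm_real, Real.norm_eq_abs, abs_inv]
    -- The domination is required for every `h`; at `h = 0` the quotient is 0 because `0⁻¹ = 0`.
    rcases eq_or_ne h 0 with rfl | hh
    · simp
    · rw [inv_mul_le_iff₀ (abs_pos.2 hh)]
      exact norm_expFun_add_sub_le t h ω
  · have := (hasDerivAt_iff_tendsto_slope_zero.1 (hasDerivAt_expFun t ω))
    refine this.congr fun h => ?_
    simp only [Pi.smul_apply, Pi.sub_apply, smul_eq_mul, Complex.real_smul]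

/-! ### The generator of the group `e^{tA}` -/

/-- The generator has no larger domain than ∫ iω dE: the difference quotients converge in norm, so
their L² norms converge, and Fatou's lemma bounds the norm of their pointwise limit iω. -/
theorem memLp_of_tendsto_slope {x g : H}
    (h : Tendsto (fun t : ℝ => (t : ℂ)⁻¹ • (E.act (expFun t) x - x)) (𝓝[≠] 0) (𝓝 g)) :
    MemLp (fun ω : ℝ => Complex.I * (ω : ℂ)) 2 (E.measureAt x) := by
  -- Fatou's lemma needs a sequence; this one tends to 0 without taking the value 0.
  set τ : ℕ → ℝ := fun n => 1 / ((n : ℝ) + 1) with hτ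
  have hτ0 : Tendsto τ atTop (𝓝[≠] 0) :=
    tendsto_nhdsWithin_iff.2 ⟨tendsto_one_div_add_atTop_nhds_zero_nat,
      Eventually.of_forall fun n => by simp only [hτ, Set.mem_compl_iff, Set.mem_singleton_iff]; positivity⟩
  have h1 : ∀ t : ℝ, (t : ℂ)⁻¹ • (E.act (expFun t) x - x) =
      E.act ((t : ℂ)⁻¹ • (expFun t - expFun 0)) x := fun t => by
    rw [E.act_smul _ ((measurable_expFun _).sub (measurable_expFun _))
      ((E.memLp_expFun _ x).sub (E.memLp_expFun _ x)),
      E.act_sub (measurable_expFun _) (measurable_expFun _) (E.memLp_expFun _ x)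
      (E.memLp_expFun _ x), act_expFun_zero]
  have hm : ∀ t : ℝ, Measurable ((t : ℂ)⁻¹ • (expFun t - expFun 0)) := fun t =>
    ((measurable_expFun _).sub (measurable_expFun _)).const_smul _
  have h2 : Tendsto (fun n => ‖E.act ((τ n : ℂ)⁻¹ • (expFun (τ n) - expFun 0)) x‖ₑ ^ 2) atTop
      (𝓝 (‖g‖ₑ ^ 2)) := by
    have := ENNReal.Tendsto.pow (n := 2) (h.comp hτ0).enorm
    simpa only [Function.comp_def, h1] using this
  have hlim : ∀ ω : ℝ, Tendsto (fun n => ‖((τ n : ℂ)⁻¹ • (expFun (τ n) - expFun 0)) ω‖ₑ ^ 2)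
      atTop (𝓝 (‖Complex.I * (ω : ℂ)‖ₑ ^ 2)) := fun ω => by
    have h3 := (hasDerivAt_iff_tendsto_slope_zero.1 (hasDerivAt_expFun 0 ω))
    rw [expFun_zero, mul_one] at h3
    have h4 := ENNReal.Tendsto.pow (n := 2) (h3.comp hτ0).enorm
    refine h4.congr fun n => ?_
    simp only [Function.comp_apply, Pi.smul_apply, Pi.sub_apply, smul_eq_mul, Complex.real_smul,
      zero_add, expFun_zero, Complex.ofReal_inv]
  rw [E.memLp_iff measurable_I_mul]
  calc ∫⁻ ω, ‖Complex.I * (ω : ℂ)‖ₑ ^ 2 ∂(E.measureAt x)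
      = ∫⁻ ω, liminf (fun n => ‖((τ n : ℂ)⁻¹ • (expFun (τ n) - expFun 0)) ω‖ₑ ^ 2) atTop
          ∂(E.measureAt x) := lintegral_congr fun ω => (hlim ω).liminf_eq.symm
    _ ≤ liminf (fun n => ∫⁻ ω, ‖((τ n : ℂ)⁻¹ • (expFun (τ n) - expFun 0)) ω‖ₑ ^ 2
          ∂(E.measureAt x)) atTop := lintegral_liminf_le fun n => (hm _).enorm.pow_const 2
    _ = ‖g‖ₑ ^ 2 := by
      rw [← h2.liminf_eq]
      congr 1
      ext n
      rw [E.enorm_act (hm _) (((E.memLp_expFun _ x).sub (E.memLp_expFun _ x)).const_smul _),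
        sq_eLpNorm_two]
    _ < ⊤ := by simp

theorem infGenerator_eq_integral (U : ℝ → H →L[ℂ] H) (hU : ∀ t x, U t x = E.act (expFun t) x) :
    infGenerator U = E.integral (fun ω : ℝ => Complex.I * ω) measurable_I_mul := by
  have hlim : ∀ x, MemLp (fun ω : ℝ => Complex.I * (ω : ℂ)) 2 (E.measureAt x) →
      Tendsto (fun t : ℝ => (t : ℂ)⁻¹ • (U t x - x)) (𝓝[≠] 0)
        (𝓝 (E.act (fun ω : ℝ => Complex.I * ω) x)) := fun x hx => by
    have h := hasDerivAt_iff_tendsto_slope_zero.1 (E.hasDerivAt_act_expFun hx 0)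
    simp only [expFun_zero, mul_one, zero_add, act_expFun_zero] at h
    refine h.congr fun t => ?_
    rw [hU, ← Complex.ofReal_inv, Complex.coe_smul]
  refine LinearPMap.ext ?_ fun x hx hx' => ?_
  · ext x
    rw [mem_domain_integral]
    constructor
    · rintro ⟨g, hg⟩
      simp only [hU] at hg
      exact E.memLp_of_tendsto_slope hg
    · exact fun h => ⟨_, hlim x h⟩
  · rw [integral_apply]
    exact tendsto_nhds_unique (Exists.choose_spec (p := fun g => Tendsto
      (fun t : ℝ => (t : ℂ)⁻¹ • (U t x - x)) (𝓝[≠] 0) (𝓝 g)) hx)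
      (hlim x ((mem_domain_integral (hf := measurable_I_mul)).1 hx'))

/-! ### Uniqueness of the spectral measure -/

theorem inner_act_self {f : ℝ → ℂ} (hf : Measurable f) {C : ℝ} (hC : ∀ ω, ‖f ω‖ ≤ C) (x : H) :
    inner ℂ x (E.act f x) = ∫ ω, f ω ∂(E.measureAt x) := by
  have hs : ∀ s : SimpleFunc ℝ ℂ, inner ℂ x (E.simpleIntegral s x) =
      ∫ ω, s ω ∂(E.measureAt x) := fun s => by
    induction s using SimpleFunc.induction with
    | @const c t ht =>
      have h1 := E.norm_sq_apply ht x
      have h2 : inner ℂ x (E t x) = ((‖E t x‖ ^ 2 : ℝ) : ℂ) := by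
        rw [← E.apply_apply_self ht, ← E.inner_apply_left ht, inner_self_eq_norm_sq_to_K,
          E.apply_apply_self ht]
        norm_cast
      rw [simpleIntegral_indicator, inner_smul_right, h2]
      simp only [SimpleFunc.coe_piecewise, SimpleFunc.coe_const, Set.piecewise_eq_indicator,
        Function.const_zero]
      rw [integral_indicator ht]
      simp [Measure.real, E.measureAt_apply x ht, mul_comm]
    | @add r t _ hr ht =>
      rw [simpleIntegral_add, inner_add_right, hr, ht, ← integral_add]
      · rfl
      · exact SimpleFunc.integrable_of_isFiniteMeasure _
      · exact SimpleFunc.integrable_of_isFiniteMeasure _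
  have h1 := (tendsto_const_nhds (x := x)).inner (𝕜 := ℂ)
    (E.tendsto_act (x := x) hf (E.memLp_of_bound hf hC))
  simp only [hs] at h1
  refine tendsto_nhds_unique h1 (tendsto_integral_of_dominated_convergence (fun _ => C + C)
    (fun n => SimpleFunc.aestronglyMeasurable _) (integrable_const _)
    (fun n => ae_of_all _ fun ω => ?_) (ae_of_all _ fun ω => ?_))
  · exact (SimpleFunc.norm_approxOn_zero_le hf (Set.mem_univ 0) ω n).trans
      (add_le_add (hC ω) (hC ω))
  · exact SimpleFunc.tendsto_approxOn hf (Set.mem_univ 0) (by simp)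

/-- The link with Fourier analysis: finite measures on the line are determined by their
characteristic functions. -/
theorem charFun_measureAt (x : H) (t : ℝ) :
    charFun (E.measureAt x) t = inner ℂ x (E.act (expFun t) x) := by
  rw [E.inner_act_self (measurable_expFun t) (fun ω => (norm_expFun t ω).le),
    charFun_apply_real]
  refine integral_congr_ae (ae_of_all _ fun ω => ?_)
  simp only [expFun]
  ring_nf

/-- A projection-valued measure is determined by the group `t ↦ ∫ e^{iωt} dE`, on a dense set. -/
theorem eq_of_act_expFun_eq {E F : ProjMeasure H} {S : Set H} (hS : Dense S)
    (h : ∀ t, ∀ x ∈ S, E.act (expFun t) x = F.act (expFun t) x) : E = F := by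
  have h1 : ∀ x ∈ S, E.measureAt x = F.measureAt x := fun x hx =>
    Measure.ext_of_charFun (funext fun t => by
      rw [charFun_measureAt, charFun_measureAt, h t x hx])
  -- Both sides are continuous in `x`, so agreement on the dense set `S` is enough; polarisation
  -- then recovers the operators from their quadratic forms.
  have h2 : ∀ s, MeasurableSet s → ∀ x, inner ℂ x (E s x) = inner ℂ x (F s x) := by
    intro s hs
    refine fun x => congrFun (Continuous.ext_on hS
      (f := fun x => inner ℂ x (E s x)) (g := fun x => inner ℂ x (F s x))
      (by fun_prop) (by fun_prop) fun y hy => ?_) x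
    have h3 := congrArg (fun ν => ν s) (h1 y hy)
    simp only [measureAt_apply _ _ hs] at h3
    rw [ENNReal.ofReal_eq_ofReal_iff (by positivity) (by positivity)] at h3
    have h4 : ∀ G : ProjMeasure H, inner ℂ y (G s y) = ((‖G s y‖ ^ 2 : ℝ) : ℂ) := fun G => by
      rw [← G.apply_apply_self hs, ← G.inner_apply_left hs, inner_self_eq_norm_sq_to_K,
        G.apply_apply_self hs]
      norm_cast
    simp only [h4, h3]
  refine ext_toFun fun s hs x => ?_
  have h5 : ((E s : H →L[ℂ] H) : H →ₗ[ℂ] H) = F s :=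
    (ext_inner_map _ _).1 fun y => by
      have := h2 s hs y
      rw [← inner_conj_symm, ContinuousLinearMap.coe_coe, this, inner_conj_symm]
      rfl
  exact congrArg (fun T : H →ₗ[ℂ] H => T x) h5

/-- The conjugate of iω is -iω. This skewness is the conservation of energy in the uniqueness proof
below. -/
theorem re_inner_act_I_mul {x : H}
    (hx : MemLp (fun ω : ℝ => Complex.I * (ω : ℂ)) 2 (E.measureAt x)) :
    RCLike.re (inner ℂ x (E.act (fun ω : ℝ => Complex.I * ω) x)) = 0 := by
  have h1 := E.inner_act_left measurable_I_mul hx hx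
  have h2 : star (fun ω : ℝ => Complex.I * (ω : ℂ)) = -fun ω : ℝ => Complex.I * (ω : ℂ) := by
    ext ω; simp
  rw [h2, E.act_neg measurable_I_mul hx, inner_neg_right, ← inner_conj_symm] at h1
  have h3 := congrArg Complex.re h1
  simp only [Complex.conj_re, Complex.neg_re] at h3
  simp only [RCLike.re_to_complex]
  linarith

theorem act_I_mul_expFun {x : H}
    (hx : MemLp (fun ω : ℝ => Complex.I * (ω : ℂ)) 2 (E.measureAt x)) (t : ℝ) :
    MemLp (fun ω : ℝ => Complex.I * (ω : ℂ)) 2 (E.measureAt (E.act (expFun t) x)) ∧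
    E.act (fun ω : ℝ => Complex.I * ω) (E.act (expFun t) x) =
      E.act (fun ω => Complex.I * ω * expFun t ω) x := by
  have h : MemLp ((fun ω : ℝ => Complex.I * (ω : ℂ)) * expFun t) 2 (E.measureAt x) :=
    hx.of_le (measurable_I_mul.mul (measurable_expFun t)).aestronglyMeasurable
      (ae_of_all _ fun ω => by simp [norm_expFun])
  exact ⟨(E.memLp_measureAt_act_iff (measurable_expFun t) (E.memLp_expFun t x)
    measurable_I_mul).2 h, E.act_act (measurable_expFun t) (E.memLp_expFun t x) measurable_I_mul h⟩

/-- The spectral measure of an operator is unique. -/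
theorem eq_of_integral_I_mul_eq {E F : ProjMeasure H}
    (h : E.integral (fun ω : ℝ => Complex.I * ω) measurable_I_mul =
      F.integral (fun ω : ℝ => Complex.I * ω) measurable_I_mul) : E = F := by
  have hdom : ∀ x, MemLp (fun ω : ℝ => Complex.I * (ω : ℂ)) 2 (E.measureAt x) ↔
      MemLp (fun ω : ℝ => Complex.I * (ω : ℂ)) 2 (F.measureAt x) := fun x => by
    rw [← mem_domain_integral (hf := measurable_I_mul), h, mem_domain_integral]
  have hact : ∀ x, MemLp (fun ω : ℝ => Complex.I * (ω : ℂ)) 2 (E.measureAt x) →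
      E.act (fun ω : ℝ => Complex.I * ω) x = F.act (fun ω : ℝ => Complex.I * ω) x := fun x hx => by
    have h1 := @(LinearPMap.ext_iff.1 h).2 x (mem_domain_integral.2 hx)
      (mem_domain_integral.2 ((hdom x).1 hx))
    rwa [integral_apply, integral_apply] at h1
  refine eq_of_act_expFun_eq (E.dense_domain_integral _ measurable_I_mul) fun t x hx => ?_
  replace hx : MemLp (fun ω : ℝ => Complex.I * (ω : ℂ)) 2 (E.measureAt x) :=
    (mem_domain_integral (hf := measurable_I_mul)).1 hx
  have hx' := (hdom x).1 hx
  -- `w` solves w' = Aw with w(0) = 0, where A is the common operator. Since A is skew, ‖w‖² is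
  -- constant, so the two groups agree on the domain of A, which is dense.
  set w : ℝ → H := fun t => E.act (expFun t) x - F.act (expFun t) x with hw
  have hd : ∀ t, HasDerivAt w (E.act (fun ω : ℝ => Complex.I * ω) (w t)) t ∧
      MemLp (fun ω : ℝ => Complex.I * (ω : ℂ)) 2 (E.measureAt (w t)) := by
    intro t
    obtain ⟨m1, e1⟩ := E.act_I_mul_expFun hx t
    obtain ⟨m2, e2⟩ := F.act_I_mul_expFun hx' t
    replace m2 := (hdom _).2 m2
    rw [← hact _ m2] at e2
    have h3 := (E.hasDerivAt_act_expFun hx t).sub (F.hasDerivAt_act_expFun hx' t)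
    rw [← e1, ← e2] at h3
    have h4 := (E.integral _ measurable_I_mul).map_sub ⟨_, mem_domain_integral.2 m1⟩
      ⟨_, mem_domain_integral.2 m2⟩
    simp only [integral_apply] at h4
    rw [← h4] at h3
    exact ⟨h3, mem_domain_integral.1 (Submodule.sub_mem _
      (mem_domain_integral.2 m1 : _ ∈ (E.integral _ measurable_I_mul).domain)
      (mem_domain_integral.2 m2))⟩
  have hd2 : ∀ t, HasDerivAt (fun t => RCLike.re (inner ℂ (w t) (w t))) 0 t := by
    intro t
    have h1 := (hd t).1.inner ℂ (hd t).1
    have h2 := (Complex.reCLM.hasFDerivAt.comp_hasDerivAt t h1)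
    have h3 := E.re_inner_act_I_mul (hd t).2
    have h4 : Complex.reCLM (inner ℂ (w t) (E.act (fun ω : ℝ => Complex.I * ω) (w t)) +
        inner ℂ (E.act (fun ω : ℝ => Complex.I * ω) (w t)) (w t)) = 0 := by
      rw [← inner_conj_symm (E.act _ (w t)), map_add, Complex.reCLM_apply, Complex.reCLM_apply,
        Complex.conj_re, ← RCLike.re_to_complex, h3, add_zero]
    rw [h4] at h2
    exact h2
  have h5 := is_const_of_deriv_eq_zero (fun t => (hd2 t).differentiableAt)
    (fun t => (hd2 t).deriv) t 0
  have h6 : w 0 = 0 := by simp only [hw, act_expFun_zero, sub_self]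
  simp only [h6, inner_zero_left, map_zero] at h5
  rw [inner_self_eq_norm_sq] at h5
  exact sub_eq_zero.1 (norm_eq_zero.1 (pow_eq_zero_iff two_ne_zero |>.1 h5))

theorem isSpectralMeasureOf_spectralMeasure {A : H →ₗ.[ℂ] H} (h : E.IsSpectralMeasureOf A) :
    (spectralMeasure A).IsSpectralMeasureOf A :=
  Classical.epsilon_spec (p := fun E : ProjMeasure H => E.IsSpectralMeasureOf A) ⟨E, h⟩

theorem spectralMeasure_eq {A : H →ₗ.[ℂ] H} (h : E.IsSpectralMeasureOf A) :
    spectralMeasure A = E :=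
  eq_of_integral_I_mul_eq ((isSpectralMeasureOf_spectralMeasure E h).trans h.symm)

end ProjMeasure

/-! ### Bochner's theorem on the real line -/

section Bochner

open ProbabilityTheory NNReal

variable {φ : ℝ → ℂ}

/-- The Fourier transform of `φ` against a centred Gaussian of variance `v`. -/
def gaussFourier (φ : ℝ → ℂ) (v : ℝ≥0) (ω : ℝ) : ℂ :=
  ∫ r, Complex.exp (-(ω * r * Complex.I)) * φ r ∂gaussianReal 0 v

theorem norm_exp_neg_mul_I (ω r : ℝ) : ‖Complex.exp (-(ω * r * Complex.I))‖ = 1 := by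
  rw [show -(ω * r * Complex.I) = (-(ω * r) : ℝ) * Complex.I by push_cast; ring,
    Complex.norm_exp_ofReal_mul_I]

theorem continuous_gaussFourier (hφ : Continuous φ) (hb : ∀ t, ‖φ t‖ ≤ 1) (v : ℝ≥0) :
    Continuous (gaussFourier φ v) := by
  refine continuous_of_dominated (bound := fun _ => 1) (fun ω => ?_) (fun ω => ?_)
    (integrable_const _) (ae_of_all _ fun r => ?_)
  · exact Continuous.aestronglyMeasurable (by fun_prop)
  · refine ae_of_all _ fun r => ?_
    rw [norm_mul, norm_exp_neg_mul_I, one_mul]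
    exact hb r
  · fun_prop

theorem norm_gaussFourier_le (hb : ∀ t, ‖φ t‖ ≤ 1) (v : ℝ≥0) (ω : ℝ) :
    ‖gaussFourier φ v ω‖ ≤ 1 := by
  refine (norm_integral_le_of_norm_le_const (C := 1) (ae_of_all _ fun r => ?_)).trans (by simp)
  rw [norm_mul, norm_exp_neg_mul_I, one_mul]
  exact hb r

/-- The regularised inverse Fourier transform of `φ`, as a measure. -/
def gaussRegularized (φ : ℝ → ℂ) (v : ℝ≥0) : Measure ℝ :=
  (gaussianReal 0 v).withDensity fun ω => ENNReal.ofReal (v * (gaussFourier φ v ω).re)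

theorem isFiniteMeasure_gaussRegularized (hφ : Continuous φ) (hb : ∀ t, ‖φ t‖ ≤ 1) (v : ℝ≥0) :
    IsFiniteMeasure (gaussRegularized φ v) := by
  have hc := continuous_gaussFourier hφ hb v
  refine isFiniteMeasure_withDensity_ofReal (Integrable.hasFiniteIntegral ?_)
  refine Integrable.of_bound (C := v) (Continuous.aestronglyMeasurable (by fun_prop))
    (ae_of_all _ fun ω => ?_)
  rw [norm_mul, Real.norm_eq_abs, Real.norm_eq_abs, NNReal.abs_eq]
  exact mul_le_of_le_one_right v.coe_nonneg
    ((Complex.abs_re_le_norm _).trans (norm_gaussFourier_le hb v ω))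

/-- The characteristic function of N(0, v) at t - r is, up to normalisation, the density of N(t,
1/v) at r. The factor `v` is the normalisation: v / √(2πv) = 1 / √(2π/v). -/
theorem gaussianPDFReal_mul_exp (v : ℝ≥0) (hv : v ≠ 0) (t r : ℝ) :
    gaussianPDFReal 0 v r * (v * Real.exp (-(v * (t - r) ^ 2 / 2))) =
      gaussianPDFReal t v⁻¹ r * Real.exp (-(r ^ 2 / (2 * v))) := by
  have hv' : (0 : ℝ) < v := by positivity
  simp only [gaussianPDFReal, NNReal.coe_inv, sub_zero]
  have h1 : (√(2 * Real.pi * v))⁻¹ * v = (√(2 * Real.pi * (v : ℝ)⁻¹))⁻¹ := by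
    rw [← Real.sqrt_inv, ← Real.sqrt_inv]
    nth_rw 2 [← Real.sqrt_sq hv'.le]
    rw [← Real.sqrt_mul (by positivity)]
    congr 1
    field_simp
  rw [← h1]
  have h2 : -(r - t) ^ 2 / (2 * (v : ℝ)⁻¹) = -(v * (t - r) ^ 2 / 2) := by
    field_simp
    ring
  rw [h2]
  ring_nf

/-- By Fubini the ω-integral can be taken first, and it is a Gaussian characteristic function. What
remains is an average of φ, damped by a wide Gaussian, over a law centred at t of variance 1/v; for
large v this is close to φ(t). -/
theorem charFun_gaussRegularized (hφ : Continuous φ) (hb : ∀ t, ‖φ t‖ ≤ 1)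
    (hpos : ∀ (v : ℝ≥0) ω, ∃ c : ℝ, 0 ≤ c ∧ gaussFourier φ v ω = c) {v : ℝ≥0} (hv : v ≠ 0)
    (t : ℝ) : charFun (gaussRegularized φ v) t =
      ∫ r, (Real.exp (-(r ^ 2 / (2 * v))) : ℂ) * φ r ∂gaussianReal t v⁻¹ := by
  have hc := continuous_gaussFourier hφ hb v
  have hre : ∀ ω, ((gaussFourier φ v ω).re : ℂ) = gaussFourier φ v ω ∧
      0 ≤ (gaussFourier φ v ω).re := fun ω => by
    obtain ⟨c, h0, h⟩ := hpos v ω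
    simp [h, h0]
  have h1 : charFun (gaussRegularized φ v) t =
      ∫ ω, ∫ r, v * (Complex.exp ((t - r) * ω * Complex.I) * φ r)
        ∂gaussianReal 0 v ∂gaussianReal 0 v := by
    rw [charFun_apply_real, gaussRegularized, integral_withDensity_eq_integral_toReal_smul
      (by fun_prop) (ae_of_all _ fun ω => ENNReal.ofReal_lt_top)]
    refine integral_congr_ae (ae_of_all _ fun ω => ?_)
    simp only
    rw [ENNReal.toReal_ofReal (mul_nonneg v.coe_nonneg (hre ω).2), Complex.real_smul, Complex.ofReal_mul,
      (hre ω).1, gaussFourier, ← integral_const_mul, ← integral_mul_const]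
    refine integral_congr_ae (ae_of_all _ fun r => ?_)
    simp only
    rw [show ((t : ℂ) - r) * ω * Complex.I = -(ω * r * Complex.I) + t * ω * Complex.I by ring,
      Complex.exp_add]
    ring
  rw [h1, integral_integral_swap, integral_gaussianReal_eq_integral_smul hv,
    integral_gaussianReal_eq_integral_smul (inv_ne_zero hv)]
  · refine integral_congr_ae (ae_of_all _ fun r => ?_)
    simp only
    have h2 : ∫ ω, (v : ℂ) * (Complex.exp ((t - r) * ω * Complex.I) * φ r) ∂gaussianReal 0 v =
        ((v * Real.exp (-(v * (t - r) ^ 2 / 2)) : ℝ) : ℂ) * φ r := by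
      rw [integral_const_mul, integral_mul_const]
      have h3 := charFun_gaussianReal (μ := 0) (v := v) (t - r)
      rw [charFun_apply_real] at h3
      push_cast at h3 ⊢
      rw [h3]
      ring_nf
    rw [h2, ← Complex.coe_smul, ← Complex.coe_smul, smul_eq_mul, smul_eq_mul, ← mul_assoc,
      ← mul_assoc, ← Complex.ofReal_mul, ← Complex.ofReal_mul, gaussianPDFReal_mul_exp v hv]
  · refine Integrable.of_bound (C := v) (Continuous.aestronglyMeasurable (by fun_prop))
      (ae_of_all _ fun p => ?_)
    simp only [Function.uncurry]
    rw [norm_mul, norm_mul, show ((t : ℂ) - p.2) * p.1 * Complex.I =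
      ((t - p.2) * p.1 : ℝ) * Complex.I by push_cast; ring, Complex.norm_exp_ofReal_mul_I, one_mul]
    simp only [Complex.norm_real, Real.norm_eq_abs, NNReal.abs_eq]
    exact mul_le_of_le_one_right v.coe_nonneg (hb _)

/-- Rescaling to the standard Gaussian makes the measure independent of `n`, so that dominated
convergence applies as `n` grows. -/
theorem integral_gaussianReal_eq (t : ℝ) (n : ℕ) {f : ℝ → ℂ} (hf : Continuous f) :
    ∫ r, f r ∂gaussianReal t ((n : ℝ≥0) + 1)⁻¹ =
      ∫ u, f (t + (√((n : ℝ) + 1))⁻¹ * u) ∂gaussianReal 0 1 := by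
  have h1 : gaussianReal t ((n : ℝ≥0) + 1)⁻¹ =
      (gaussianReal 0 1).map fun u => t + (√((n : ℝ) + 1))⁻¹ * u := by
    have : (fun u : ℝ => t + (√((n : ℝ) + 1))⁻¹ * u) =
        (t + ·) ∘ ((√((n : ℝ) + 1))⁻¹ * ·) := rfl
    rw [this, ← Measure.map_map (by fun_prop) (by fun_prop), gaussianReal_map_const_mul,
      gaussianReal_map_const_add]
    congr 1
    · ring
    · rw [mul_one]
      ext
      simp only [NNReal.coe_inv, NNReal.coe_add, NNReal.coe_natCast, NNReal.coe_one, NNReal.coe_mk]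
      rw [inv_pow, Real.sq_sqrt (by positivity)]
  rw [h1, integral_map (by fun_prop) hf.aestronglyMeasurable]

theorem tendsto_charFun_gaussRegularized (hφ : Continuous φ) (hb : ∀ t, ‖φ t‖ ≤ 1)
    (hpos : ∀ (v : ℝ≥0) ω, ∃ c : ℝ, 0 ≤ c ∧ gaussFourier φ v ω = c) (t : ℝ) :
    Tendsto (fun n : ℕ => charFun (gaussRegularized φ (n + 1)) t) atTop (𝓝 (φ t)) := by
  have h : ∀ n : ℕ, ((n : ℝ≥0) + 1) ≠ 0 := fun n => by positivity
  have hcont : ∀ n : ℕ, Continuous fun r : ℝ =>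
      (Real.exp (-(r ^ 2 / (2 * ((n + 1 : ℝ≥0) : ℝ)))) : ℂ) * φ r := fun n => by fun_prop
  simp_rw [fun n => charFun_gaussRegularized hφ hb hpos (h n) t,
    fun n => integral_gaussianReal_eq t n (hcont n)]
  simp only [NNReal.coe_add, NNReal.coe_natCast, NNReal.coe_one]
  have h0 : φ t = ∫ _, φ t ∂gaussianReal 0 1 := by simp
  rw [h0]
  have hinv : Tendsto (fun n : ℕ => (√((n : ℝ) + 1))⁻¹) atTop (𝓝 0) :=
    tendsto_inv_atTop_zero.comp (Real.tendsto_sqrt_atTop.comp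
      (tendsto_atTop_add_const_right _ _ tendsto_natCast_atTop_atTop))
  have hinv2 : Tendsto (fun n : ℕ => ((n : ℝ) + 1)⁻¹) atTop (𝓝 0) :=
    tendsto_inv_atTop_zero.comp (tendsto_atTop_add_const_right _ _ tendsto_natCast_atTop_atTop)
  refine tendsto_integral_of_dominated_convergence (fun _ => 1)
    (fun n => Continuous.aestronglyMeasurable (by fun_prop)) (integrable_const _)
    (fun n => ae_of_all _ fun u => ?_) (ae_of_all _ fun u => ?_)
  · rw [norm_mul, Complex.norm_real, Real.norm_eq_abs, Real.abs_exp]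
    refine mul_le_one₀ (Real.exp_le_one_iff.2 ?_) (norm_nonneg _) (hb _)
    rw [neg_nonpos]
    positivity
  · have h1 : Tendsto (fun n : ℕ => t + (√((n : ℝ) + 1))⁻¹ * u) atTop (𝓝 (t + 0 * u)) :=
      (hinv.mul_const u).const_add t
    rw [zero_mul, add_zero] at h1
    have h2 : Tendsto (fun n : ℕ => -((t + (√((n : ℝ) + 1))⁻¹ * u) ^ 2 / (2 * ((n : ℝ) + 1))))
        atTop (𝓝 (-(t ^ 2 * (2⁻¹ * 0)))) := by
      refine (((h1.pow 2).mul (hinv2.const_mul 2⁻¹)).neg).congr fun n => ?_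
      rw [div_eq_mul_inv, mul_inv]
    have h3 := ((Complex.continuous_ofReal.tendsto _).comp
      ((Real.continuous_exp.tendsto _).comp h2)).mul ((hφ.tendsto t).comp h1)
    simpa [Function.comp_def] using h3

/-- **Bochner's theorem** on the real line, for functions normalised by `φ 0 = 1`. -/
theorem exists_charFun_eq (hφ : Continuous φ) (hb : ∀ t, ‖φ t‖ ≤ 1) (h1 : φ 0 = 1)
    (hpos : ∀ (v : ℝ≥0) ω, ∃ c : ℝ, 0 ≤ c ∧ gaussFourier φ v ω = c) :
    ∃ ν : Measure ℝ, IsFiniteMeasure ν ∧ ∀ t, charFun ν t = φ t := by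
  have hfin : ∀ n : ℕ, IsFiniteMeasure (gaussRegularized φ (n + 1)) := fun n =>
    isFiniteMeasure_gaussRegularized hφ hb _
  set ρ : ℕ → FiniteMeasure ℝ := fun n => ⟨gaussRegularized φ (n + 1), hfin n⟩ with hρ
  have hlim : ∀ t, Tendsto (fun n => charFun (ρ n : Measure ℝ) t) atTop (𝓝 (φ t)) := fun t =>
    tendsto_charFun_gaussRegularized hφ hb hpos t
  have hmass : Tendsto (fun n => ((ρ n).mass : ℂ)) atTop (𝓝 1) := by
    have := hlim 0
    rw [h1] at this
    refine this.congr fun n => ?_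
    rw [charFun_zero]
    rfl
  -- The regularised measures need not be probabilities, but their masses tend to φ(0) = 1, so
  -- normalising does not change the limits.
  set P : ℕ → ProbabilityMeasure ℝ := fun n => (ρ n).normalize with hP
  have hP1 : ∀ t n, charFun (ρ n : Measure ℝ) t = ((ρ n).mass : ℂ) * charFun (P n : Measure ℝ) t := by
    intro t n
    have h2 : (ρ n : Measure ℝ) = (ρ n).mass • (P n : Measure ℝ) :=
      congrArg FiniteMeasure.toMeasure (ρ n).self_eq_mass_smul_normalize
    conv_lhs => rw [h2]
    rw [charFun_apply_real, charFun_apply_real, integral_smul_nnreal_measure]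
    rfl
  have hP2 : ∀ t, Tendsto (fun n => charFun (P n : Measure ℝ) t) atTop (𝓝 (φ t)) := by
    intro t
    have h2 := (hlim t).div hmass one_ne_zero
    rw [div_one] at h2
    refine h2.congr' ?_
    filter_upwards [hmass.eventually_ne one_ne_zero] with n hn
    simp only [Pi.div_apply]
    rw [hP1 t n, mul_div_cancel_left₀ _ hn]
  -- Continuity of the limit φ at 0 prevents mass from escaping to infinity, as in Lévy's theorem;
  -- Prokhorov's theorem then gives relative compactness.
  have htight := isTightMeasureSet_of_tendsto_charFun (μ := fun n => (P n : Measure ℝ))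
    hφ.continuousAt hP2
  have hcomp : IsCompact (closure (Set.range P)) := by
    refine isCompact_closure_of_isTightMeasureSet ?_
    convert htight using 1
    ext ν
    simp
  -- A limit along a free ultrafilter replaces the choice of a subsequence.
  let F : Ultrafilter ℕ := Filter.hyperfilter ℕ
  have hF : (F : Filter ℕ) ≤ atTop := by
    rw [← Nat.cofinite_eq_atTop]; exact Filter.hyperfilter_le_cofinite
  obtain ⟨ν, -, hν⟩ := hcomp.ultrafilter_le_nhds (F.map P)
    (.trans (by simp) (Filter.monotone_principal subset_closure))
  refine ⟨ν, inferInstance, fun t => tendsto_nhds_unique (f := fun n => charFun (P n : Measure ℝ) t)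
    (l := (F : Filter ℕ)) ?_ ((hP2 t).mono_left hF)⟩
  have hν' : Tendsto P F (𝓝 ν) := hν
  rw [ProbabilityMeasure.tendsto_iff_forall_integral_rclike_tendsto ℂ] at hν'
  simp_rw [charFun_eq_integral_innerProbChar]
  exact hν' (BoundedContinuousFunction.innerProbChar t)

end Bochner

/-! ### Stone's theorem -/

/-- Moving the negative coefficients to the other side gives two positive measures with equal
characteristic functions. Algebraic properties of the spectral projections are reduced to this: a
real linear relation between Fourier transforms is a relation between measures. -/
theorem sum_measureReal_eq_zero {n : ℕ} (c : Fin n → ℝ) (ν : Fin n → Measure ℝ)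
    (hν : ∀ i, IsFiniteMeasure (ν i)) (h : ∀ t, ∑ i, (c i : ℂ) * charFun (ν i) t = 0)
    (s : Set ℝ) : ∑ i, c i * (ν i).real s = 0 := by
  have hsub : ∀ i, ((c i).toNNReal : ℝ) - ((-c i).toNNReal : ℝ) = c i := fun i =>
    by simp
  have hfin : ∀ d : Fin n → NNReal, IsFiniteMeasure (∑ i, d i • ν i) := fun d => inferInstance
  have hchar : ∀ (d : Fin n → NNReal) t, charFun (∑ i, d i • ν i) t =
      ∑ i, ((d i : ℝ) : ℂ) * charFun (ν i) t := fun d t => by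
    simp only [charFun_eq_integral_innerProbChar]
    rw [integral_finsetSum_measure fun i _ => BoundedContinuousFunction.integrable _ _]
    refine Finset.sum_congr rfl fun i _ => ?_
    rw [integral_smul_nnreal_measure]
    rfl
  have hreal : ∀ d : Fin n → NNReal, (∑ i, d i • ν i).real s = ∑ i, (d i : ℝ) * (ν i).real s :=
    fun d => by
      simp only [Measure.real, Measure.coe_finsetSum, Finset.sum_apply, Measure.smul_apply]
      rw [ENNReal.toReal_sum fun i _ => by
        rw [ENNReal.smul_def]; exact ENNReal.mul_ne_top (by simp) (measure_ne_top _ _)]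
      refine Finset.sum_congr rfl fun i _ => ?_
      rw [ENNReal.smul_def, smul_eq_mul, ENNReal.toReal_mul, ENNReal.coe_toReal]
  have heq : ∑ i, (c i).toNNReal • ν i = ∑ i, (-c i).toNNReal • ν i := by
    refine Measure.ext_of_charFun (funext fun t => ?_)
    rw [← sub_eq_zero, hchar, hchar, ← Finset.sum_sub_distrib, ← h t]
    refine Finset.sum_congr rfl fun i _ => ?_
    rw [← sub_mul, ← Complex.ofReal_sub, hsub]
  have h1 := congrArg (fun m : Measure ℝ => m.real s) heq
  simp only [hreal] at h1
  rw [← sub_eq_zero, ← Finset.sum_sub_distrib] at h1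
  rw [← h1]
  refine Finset.sum_congr rfl fun i _ => ?_
  rw [← sub_mul, hsub]

/-- A strongly continuous one-parameter group of isometries. -/
structure IsUnitaryGroup {H : Type*} [NormedAddCommGroup H] [InnerProductSpace ℂ H]
    (U : ℝ → H →L[ℂ] H) : Prop where
  zero : U 0 = 1
  add : ∀ s t x, U (s + t) x = U s (U t x)
  norm_map : ∀ t x, ‖U t x‖ = ‖x‖
  continuous : ∀ x, Continuous fun t => U t x

namespace IsUnitaryGroup

variable {H : Type*} [NormedAddCommGroup H] [InnerProductSpace ℂ H] {U : ℝ → H →L[ℂ] H}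
  (hU : IsUnitaryGroup U)

include hU

theorem inner_map_map (t : ℝ) (x y : H) : inner ℂ (U t x) (U t y) = inner ℂ x y :=
  LinearIsometry.inner_map_map (⟨(U t : H →ₗ[ℂ] H), hU.norm_map t⟩ : H →ₗᵢ[ℂ] H) x y

theorem inner_map_left (t : ℝ) (x y : H) : inner ℂ (U t x) y = inner ℂ x (U (-t) y) := by
  rw [← hU.inner_map_map (-t), ← hU.add, neg_add_cancel, hU.zero]
  rfl

theorem continuous_inner (x y : H) : Continuous fun t => inner ℂ x (U t y) :=
  continuous_const.inner (hU.continuous y)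

theorem norm_inner_le (x : H) (hx : ‖x‖ = 1) (t : ℝ) : ‖inner ℂ x (U t x)‖ ≤ 1 := by
  refine (norm_inner_le_norm _ _).trans ?_
  rw [hU.norm_map, hx, one_mul]

variable [CompleteSpace H]

/-- Positive-definiteness in averaged form. N(0, v) is the convolution of γ = N(0, v/2) with itself
and γ is symmetric, so the group law factors the double integral into ⟨G, G⟩ with G = ∫ e^{-iωt} U t
x dγ(t). -/
theorem gaussFourier_inner_nonneg (x : H) (v : NNReal) (ω : ℝ) :
    ∃ c : ℝ, 0 ≤ c ∧ gaussFourier (fun t => inner ℂ x (U t x)) v ω = c := by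
  set γ := ProbabilityTheory.gaussianReal 0 (v / 2) with hγ
  have hconv : ProbabilityTheory.gaussianReal 0 v = γ ∗ γ := by
    rw [hγ, ProbabilityTheory.gaussianReal_conv_gaussianReal, add_zero, add_halves]
  have hcu : ∀ y, Continuous fun t => U t y := hU.continuous
  set g : ℝ → H := fun t => Complex.exp (-(ω * t * Complex.I)) • U t x with hg
  have hgc : Continuous g := by
    have := hcu x
    simp only [hg]
    fun_prop
  have hgi : Integrable g γ := Integrable.of_bound (C := ‖x‖) hgc.aestronglyMeasurable
    (ae_of_all _ fun t => by
      simp only [hg]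
      rw [norm_smul, norm_exp_neg_mul_I, one_mul, hU.norm_map])
  refine ⟨‖∫ t, g t ∂γ‖ ^ 2, by positivity, ?_⟩
  have hsymm : ∫ s, g (-s) ∂γ = ∫ s, g s ∂γ := by
    have : γ = γ.map fun s => -s := by
      rw [hγ, ProbabilityTheory.gaussianReal_map_neg, neg_zero]
    conv_rhs => rw [this]
    rw [integral_map (by fun_prop) hgc.aestronglyMeasurable]
  have hsplit : ∀ s t : ℝ, Complex.exp (-(ω * ((s + t : ℝ) : ℂ) * Complex.I)) *
      inner ℂ x (U (s + t) x) = inner ℂ (g (-s)) (g t) := by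
    intro s t
    simp only [hg]
    rw [inner_smul_left, inner_smul_right, hU.inner_map_left, neg_neg, ← hU.add, ← mul_assoc,
      ← Complex.exp_conj, ← Complex.exp_add]
    congr 2
    simp only [map_neg, map_mul, Complex.conj_ofReal, Complex.conj_I, Complex.ofReal_neg,
      Complex.ofReal_add]
    ring
  rw [gaussFourier, hconv, integral_conv]
  · simp only [hsplit]
    have h1 : ∀ s, ∫ t, inner ℂ (g (-s)) (g t) ∂γ = inner ℂ (g (-s)) (∫ t, g t ∂γ) := fun s =>
      integral_inner hgi _
    simp only [h1]
    have h2 : ∫ s, inner ℂ (g (-s)) (∫ t, g t ∂γ) ∂γ =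
        (starRingEnd ℂ) (∫ s, inner ℂ (∫ t, g t ∂γ) (g (-s)) ∂γ) := by
      rw [← integral_conj]
      simp only [inner_conj_symm]
    have hgi' : Integrable (fun s => g (-s)) γ :=
      Integrable.of_bound (C := ‖x‖) (hgc.comp continuous_neg).aestronglyMeasurable
      (ae_of_all _ fun t => by
        simp only [hg]
        rw [norm_smul, norm_exp_neg_mul_I, one_mul, hU.norm_map])
    rw [h2, integral_inner hgi', hsymm, inner_conj_symm, inner_self_eq_norm_sq_to_K]
    norm_cast
  · refine Integrable.of_bound (C := ‖x‖ * ‖x‖) (Continuous.aestronglyMeasurable ?_)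
      (ae_of_all _ fun t => ?_)
    · have := hU.continuous_inner x x
      fun_prop
    · rw [norm_mul, norm_exp_neg_mul_I, one_mul]
      exact (norm_inner_le_norm _ _).trans (by rw [hU.norm_map])

theorem exists_measure (x : H) :
    ∃ ν : Measure ℝ, IsFiniteMeasure ν ∧ ∀ t, charFun ν t = inner ℂ x (U t x) := by
  rcases eq_or_ne x 0 with rfl | hx
  · exact ⟨0, inferInstance, fun t => by simp⟩
  have hx' : ‖x‖ ≠ 0 := norm_ne_zero_iff.2 hx
  set y : H := ((‖x‖⁻¹ : ℝ) : ℂ) • x with hy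
  have hy1 : ‖y‖ = 1 := by
    rw [hy, norm_smul, Complex.norm_real, norm_inv, norm_norm, inv_mul_cancel₀ hx']
  obtain ⟨ν, hν, h⟩ := exists_charFun_eq (hU.continuous_inner y y) (hU.norm_inner_le y hy1)
    (by rw [hU.zero, one_apply_eq_self, inner_self_eq_norm_sq_to_K, hy1]; simp)
    (hU.gaussFourier_inner_nonneg y)
  refine ⟨(‖x‖₊ ^ 2) • ν, inferInstance, fun t => ?_⟩
  have h1 : charFun ((‖x‖₊ ^ 2) • ν) t = ((‖x‖ ^ 2 : ℝ) : ℂ) * charFun ν t := by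
    rw [charFun_apply_real, charFun_apply_real, integral_smul_nnreal_measure,
      NNReal.smul_def, Complex.real_smul]
    push_cast
    rfl
  rw [h1, h, hy, map_smul, inner_smul_left, inner_smul_right, Complex.conj_ofReal]
  push_cast
  have : (‖x‖ : ℂ) ≠ 0 := by exact_mod_cast hx'
  field_simp

end IsUnitaryGroup

/-! ### From the measures of a unitary group to its spectral projections -/

namespace IsUnitaryGroup

variable {H : Type*} [NormedAddCommGroup H] [InnerProductSpace ℂ H] {U : ℝ → H →L[ℂ] H}
  [CompleteSpace H] (hU : IsUnitaryGroup U)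

/-- The measure with Fourier transform `t ↦ ⟨x, U t x⟩`. -/
def specMeasure (x : H) : Measure ℝ := (hU.exists_measure x).choose

instance (x : H) : IsFiniteMeasure (hU.specMeasure x) := (hU.exists_measure x).choose_spec.1

theorem charFun_specMeasure (x : H) (t : ℝ) :
    charFun (hU.specMeasure x) t = inner ℂ x (U t x) := (hU.exists_measure x).choose_spec.2 t

theorem specMeasure_real_univ (x : H) : (hU.specMeasure x).real Set.univ = ‖x‖ ^ 2 := by
  have h := hU.charFun_specMeasure x 0
  rw [charFun_zero, hU.zero, one_apply_eq_self] at h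
  rw [← inner_self_eq_norm_sq (𝕜 := ℂ), ← h]
  simp

theorem specMeasure_real_le (x : H) (s : Set ℝ) : (hU.specMeasure x).real s ≤ ‖x‖ ^ 2 := by
  rw [← hU.specMeasure_real_univ]
  exact measureReal_mono (Set.subset_univ s)

theorem sum_specMeasure_real_eq_zero {n : ℕ} (c : Fin n → ℝ) (v : Fin n → H)
    (h : ∀ t, ∑ i, (c i : ℂ) * inner ℂ (v i) (U t (v i)) = 0) (s : Set ℝ) :
    ∑ i, c i * (hU.specMeasure (v i)).real s = 0 :=
  sum_measureReal_eq_zero c (fun i => hU.specMeasure (v i)) (fun _ => inferInstance)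
    (fun t => by simpa only [charFun_specMeasure] using h t) s

theorem specMeasure_real_smul (c : ℂ) (x : H) (s : Set ℝ) :
    (hU.specMeasure (c • x)).real s = ‖c‖ ^ 2 * (hU.specMeasure x).real s := by
  have h := hU.sum_specMeasure_real_eq_zero ![1, -‖c‖ ^ 2] ![c • x, x] (fun t => by
    simp only [Fin.sum_univ_succ, Finset.univ_eq_empty, Finset.sum_empty, Matrix.cons_val_zero,
      Matrix.cons_val_succ, map_smul, inner_smul_left, inner_smul_right]
    rw [← mul_assoc c, Complex.mul_conj, Complex.normSq_eq_norm_sq]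
    push_cast
    ring) s
  simp only [Fin.sum_univ_succ, Finset.univ_eq_empty, Finset.sum_empty, Matrix.cons_val_zero,
      Matrix.cons_val_succ] at h
  linarith

/-- Four times the real part of the polarised form. -/
def polar (s : Set ℝ) (x y : H) : ℝ :=
  (hU.specMeasure (x + y)).real s - (hU.specMeasure (x - y)).real s

theorem polar_comm (s : Set ℝ) (x y : H) : hU.polar s x y = hU.polar s y x := by
  have h := hU.specMeasure_real_smul (-1) (x - y) s
  rw [neg_one_smul, neg_sub] at h
  simp only [polar, add_comm x y, h]
  simp

theorem polar_smul_I (s : Set ℝ) (x y : H) :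
    hU.polar s (Complex.I • x) (Complex.I • y) = hU.polar s x y := by
  simp only [polar, ← smul_add, ← smul_sub, specMeasure_real_smul, Complex.norm_I]
  ring

/-- After expansion, the functions t ↦ ⟨v, U t v⟩ of the six vectors cancel with these signs; the
same then holds for their measures. The next lemma uses the same device. -/
theorem polar_add (s : Set ℝ) (x y z : H) :
    hU.polar s x (y + z) = hU.polar s x y + hU.polar s x z := by
  have h := hU.sum_specMeasure_real_eq_zero ![1, -1, -1, 1, -1, 1]
    ![x + (y + z), x - (y + z), x + y, x - y, x + z, x - z] (fun t => by
      simp [Fin.sum_univ_succ]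
      ring) s
  simp [Fin.sum_univ_succ] at h
  simp only [polar]
  linarith

theorem polar_smul (s : Set ℝ) (c : ℂ) (x y : H) :
    hU.polar s x (c • y) = c.re * hU.polar s x y + c.im * hU.polar s x (Complex.I • y) := by
  have h := hU.sum_specMeasure_real_eq_zero ![1, -1, -c.re, c.re, -c.im, c.im]
    ![x + c • y, x - c • y, x + y, x - y, x + Complex.I • y, x - Complex.I • y] (fun t => by
      simp only [Fin.sum_univ_succ, Finset.univ_eq_empty, Finset.sum_empty, Matrix.cons_val_zero,
        Matrix.cons_val_succ, map_add, map_sub, map_smul, inner_add_left, inner_add_right,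
        inner_sub_left, inner_sub_right, inner_smul_left, inner_smul_right, Complex.conj_I]
      have hc : c = c.re + c.im * Complex.I := (Complex.re_add_im c).symm
      have hc' : (starRingEnd ℂ) c = c.re - c.im * Complex.I := by
        apply Complex.ext <;> simp
      rw [hc']
      generalize inner ℂ x (U t y) = a
      generalize inner ℂ y (U t x) = b
      push_cast
      linear_combination (2 * a) * hc) s
  simp [Fin.sum_univ_succ] at h
  simp only [polar]
  linarith

theorem abs_polar_le (s : Set ℝ) (x y : H) : |hU.polar s x y| ≤ (‖x‖ + ‖y‖) ^ 2 := by
  have h1 : (hU.specMeasure (x + y)).real s ≤ (‖x‖ + ‖y‖) ^ 2 :=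
    (hU.specMeasure_real_le _ s).trans (by gcongr; exact norm_add_le _ _)
  have h2 : (hU.specMeasure (x - y)).real s ≤ (‖x‖ + ‖y‖) ^ 2 :=
    (hU.specMeasure_real_le _ s).trans (by gcongr; exact norm_sub_le _ _)
  rw [polar, abs_le]
  constructor <;> linarith [measureReal_nonneg (μ := hU.specMeasure (x + y)) (s := s),
    measureReal_nonneg (μ := hU.specMeasure (x - y)) (s := s)]

/-- The sesquilinear form with quadratic form `x ↦ specMeasure x s`. -/
def sesqForm (s : Set ℝ) : H →ₗ⋆[ℂ] H →ₗ[ℂ] ℂ :=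
  -- If B is the form sought, then `polar s x y` is 4 Re B(x, y) and `polar s x (i y)` is 4 Re(i
  -- B(x, y)) = -4 Im B(x, y), whence the minus sign.
  LinearMap.mk₂'ₛₗ _ _ (fun x y => (hU.polar s x y - Complex.I * hU.polar s x (Complex.I • y)) / 4)
    (fun x x' y => by
      simp only [hU.polar_comm s _ y, hU.polar_comm s _ (Complex.I • y), polar_add]
      push_cast
      ring)
    (fun c x y => by
      have h1 : ∀ z, hU.polar s (c • x) z =
          c.re * hU.polar s x z + c.im * hU.polar s (Complex.I • x) z := fun z => by
        rw [hU.polar_comm, hU.polar_smul, hU.polar_comm s z, hU.polar_comm s z]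
      have h2 : hU.polar s (Complex.I • x) y = -hU.polar s x (Complex.I • y) := by
        rw [← hU.polar_smul_I, smul_smul, Complex.I_mul_I, hU.polar_comm, hU.polar_smul,
          hU.polar_comm s _ x]
        simp
      rw [h1, h1, h2, hU.polar_smul_I, starRingEnd_apply, smul_eq_mul]
      apply Complex.ext <;> simp <;> ring)
    (fun x y y' => by
      rw [smul_add, polar_add, polar_add]
      push_cast
      ring)
    (fun c x y => by
      rw [smul_comm, hU.polar_smul s c x y, hU.polar_smul s c x (Complex.I • y), smul_smul,
        Complex.I_mul_I, hU.polar_smul s (-1), smul_eq_mul]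
      apply Complex.ext <;> simp <;> ring)

theorem sesqForm_apply (s : Set ℝ) (x y : H) : hU.sesqForm s x y =
    (hU.polar s x y - Complex.I * hU.polar s x (Complex.I • y)) / 4 := rfl

/-- For unit vectors each `polar` is at most 4, which gives (4 + 4)/4 = 2; the general case follows
by scaling. -/
theorem norm_sesqForm_le (s : Set ℝ) (x y : H) : ‖hU.sesqForm s x y‖ ≤ 2 * ‖x‖ * ‖y‖ := by
  have key : ∀ u v : H, ‖u‖ = 1 → ‖v‖ = 1 → ‖hU.sesqForm s u v‖ ≤ 2 := fun u v hu hv => by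
    have h1 := hU.abs_polar_le s u v
    have h2 := hU.abs_polar_le s u (Complex.I • v)
    rw [norm_smul, Complex.norm_I, one_mul] at h2
    rw [hu, hv] at h1 h2
    rw [sesqForm_apply, norm_div]
    refine (div_le_div_of_nonneg_right (norm_sub_le _ _) (norm_nonneg _)).trans ?_
    rw [norm_mul, Complex.norm_I, one_mul, Complex.norm_real, Complex.norm_real,
      Real.norm_eq_abs, Real.norm_eq_abs]
    norm_num
    linarith
  rcases eq_or_ne x 0 with rfl | hx
  · simp
  rcases eq_or_ne y 0 with rfl | hy
  · simp
  have hx' : ‖x‖ ≠ 0 := norm_ne_zero_iff.2 hx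
  have hy' : ‖y‖ ≠ 0 := norm_ne_zero_iff.2 hy
  have h := key (((‖x‖⁻¹ : ℝ) : ℂ) • x) (((‖y‖⁻¹ : ℝ) : ℂ) • y)
    (by rw [norm_smul, Complex.norm_real, norm_inv, norm_norm, inv_mul_cancel₀ hx'])
    (by rw [norm_smul, Complex.norm_real, norm_inv, norm_norm, inv_mul_cancel₀ hy'])
  rw [LinearMap.map_smulₛₗ₂, map_smul, norm_smul, norm_smul, Complex.conj_ofReal,
    Complex.norm_real, Complex.norm_real, norm_inv, norm_inv, norm_norm, norm_norm] at h
  rw [← mul_assoc, ← mul_inv, inv_mul_le_iff₀ (by positivity)] at h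
  linarith

/-- The bounded operator with quadratic form `x ↦ specMeasure x s`. -/
def specProj (s : Set ℝ) : H →L[ℂ] H :=
  InnerProductSpace.continuousLinearMapOfBilin
    ((hU.sesqForm s).mkContinuous₂ 2 (hU.norm_sesqForm_le s))

theorem inner_specProj (s : Set ℝ) (x y : H) : inner ℂ (hU.specProj s x) y = hU.sesqForm s x y :=
  InnerProductSpace.continuousLinearMapOfBilin_apply _ x y

theorem inner_specProj_self (s : Set ℝ) (x : H) :
    inner ℂ (hU.specProj s x) x = (hU.specMeasure x).real s := by
  have h1 : x + x = (2 : ℂ) • x := (two_smul ℂ x).symm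
  have h2 : x + Complex.I • x = (1 + Complex.I) • x := by rw [add_smul, one_smul]
  have h3 : x - Complex.I • x = (1 - Complex.I) • x := by rw [sub_smul, one_smul]
  have h4 : x - x = (0 : ℂ) • x := by simp
  have h5 : ‖1 + Complex.I‖ ^ 2 = 2 := by
    rw [← Complex.normSq_eq_norm_sq, Complex.normSq_apply]; norm_num
  have h6 : ‖1 - Complex.I‖ ^ 2 = 2 := by
    rw [← Complex.normSq_eq_norm_sq, Complex.normSq_apply]; norm_num
  rw [inner_specProj, sesqForm_apply, polar, polar, h1, h2, h3, h4, specMeasure_real_smul,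
    specMeasure_real_smul, specMeasure_real_smul, specMeasure_real_smul, h5, h6]
  norm_num

theorem specProj_isSymmetric (s : Set ℝ) : (hU.specProj s : H →ₗ[ℂ] H).IsSymmetric := by
  rw [LinearMap.isSymmetric_iff_inner_map_self_real]
  intro x
  rw [ContinuousLinearMap.coe_coe, inner_specProj_self, Complex.conj_ofReal]

omit [CompleteSpace H] in
theorem specProj_ext {S T : H →L[ℂ] H} (h : ∀ x, inner ℂ (S x) x = inner ℂ (T x) x) : S = T := by
  have h5 : (S : H →ₗ[ℂ] H) = T := (ext_inner_map _ _).1 h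
  ext x
  exact congrArg (fun T : H →ₗ[ℂ] H => T x) h5

/-- The operators U r and U t commute, so `U t y` and `y` have the same measure, and conjugation by
`U t` preserves the quadratic form. -/
theorem specProj_map (s : Set ℝ) (t : ℝ) (x : H) :
    hU.specProj s (U t x) = U t (hU.specProj s x) := by
  have h : (U (-t)).comp ((hU.specProj s).comp (U t)) = hU.specProj s := specProj_ext fun y => by
    have h1 := hU.sum_specMeasure_real_eq_zero ![1, -1] ![U t y, y] (fun r => by
      have h2 : U r (U t y) = U t (U r y) := by rw [← hU.add, add_comm, hU.add]
      simp [Fin.sum_univ_succ, h2, hU.inner_map_map]) s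
    simp [Fin.sum_univ_succ] at h1
    rw [ContinuousLinearMap.comp_apply, ContinuousLinearMap.comp_apply, hU.inner_map_left,
      neg_neg, inner_specProj_self, inner_specProj_self]
    norm_cast
    linarith
  have h2 := congrArg (fun T : H →L[ℂ] H => U t (T x)) h
  simp only [ContinuousLinearMap.comp_apply] at h2
  rw [← h2, ← hU.add, add_neg_cancel, hU.zero]
  rfl

/-- With e = e^{iωt}, the measures of x ± c U t x have densities |1 ± ce|² = 2(1 ± Re(ce)) with
respect to that of x; their difference has density 4 Re(ce). The auxiliary measure ν carries the
density 1 + Re(ce), where the 1 makes it nonnegative, and is compared with four copies of the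
measure of x. -/
theorem polar_map {c : ℂ} (hc : ‖c‖ = 1) {s : Set ℝ} (hs : MeasurableSet s) (t : ℝ) (x : H) :
    hU.polar s x (c • U t x) = 4 * ∫ ω in s, (c * expFun t ω).re ∂(hU.specMeasure x) := by
  set f : ℝ → ℝ := fun ω => 1 + (c * expFun t ω).re with hf
  have hfm : Measurable f := by
    have := measurable_expFun t
    fun_prop
  have hre : ∀ ω, |(c * expFun t ω).re| ≤ 1 := fun ω =>
    (Complex.abs_re_le_norm _).trans (by rw [norm_mul, hc, norm_expFun, one_mul])
  have hf0 : ∀ ω, 0 ≤ f ω := fun ω => by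
    have := neg_abs_le (c * expFun t ω).re
    simp only [hf]
    linarith [hre ω]
  have hei : ∀ t, Integrable (expFun t) (hU.specMeasure x) := fun t =>
    Integrable.of_bound (C := 1) (measurable_expFun t).aestronglyMeasurable
      (ae_of_all _ fun ω => (norm_expFun t ω).le)
  have hci : Integrable (fun ω => (c * expFun t ω).re) (hU.specMeasure x) :=
    ((hei t).const_mul c).re
  have hfi : Integrable f (hU.specMeasure x) := (integrable_const _).add hci
  have hφ : ∀ r, ∫ ω, expFun r ω ∂(hU.specMeasure x) = inner ℂ x (U r x) := fun r => by
    rw [← hU.charFun_specMeasure, charFun_apply_real]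
    refine integral_congr_ae (ae_of_all _ fun ω => ?_)
    simp only [expFun]
    ring_nf
  set ν := (hU.specMeasure x).withDensity fun ω => ENNReal.ofReal (f ω) with hν
  have hνf : IsFiniteMeasure ν := isFiniteMeasure_withDensity_ofReal hfi.hasFiniteIntegral
  have hνs : ν.real s = (hU.specMeasure x).real s +
      ∫ ω in s, (c * expFun t ω).re ∂(hU.specMeasure x) := by
    rw [Measure.real, hν, withDensity_apply _ hs, ← ofReal_integral_eq_lintegral_ofReal
      hfi.integrableOn (ae_of_all _ hf0), ENNReal.toReal_ofReal (integral_nonneg hf0),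
      integral_add (integrable_const _) hci.integrableOn]
    simp
  have hgi : ∀ r, Integrable (fun ω => (c * expFun (r + t) ω +
      (starRingEnd ℂ) c * expFun (r - t) ω) / 2) (hU.specMeasure x) := fun r =>
    (((hei _).const_mul _).add ((hei _).const_mul _)).div_const _
  have hνc : ∀ r, charFun ν r = inner ℂ x (U r x) +
      (c * inner ℂ x (U (r + t) x) + (starRingEnd ℂ) c * inner ℂ x (U (r - t) x)) / 2 := fun r => by
    rw [charFun_apply_real, hν, integral_withDensity_eq_integral_toReal_smul (by fun_prop)
      (ae_of_all _ fun ω => ENNReal.ofReal_lt_top), ← hφ, ← hφ, ← hφ, ← integral_const_mul,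
      ← integral_const_mul, ← integral_add ((hei _).const_mul _) ((hei _).const_mul _),
      ← integral_div, ← integral_add (hei r) (hgi r)]
    refine integral_congr_ae (ae_of_all _ fun ω => ?_)
    simp only
    rw [ENNReal.toReal_ofReal (hf0 ω), Complex.real_smul]
    have h1 : (f ω : ℂ) = 1 + (c * expFun t ω + (starRingEnd ℂ) c * expFun (-t) ω) / 2 := by
      simp only [hf]
      push_cast
      rw [Complex.re_eq_add_conj, map_mul]
      congr 4
      simp only [expFun, ← Complex.exp_conj, map_mul, Complex.conj_I, Complex.conj_ofReal]
      push_cast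
      ring_nf
    have h2 : Complex.exp (r * ω * Complex.I) = expFun r ω := by
      simp only [expFun]
      ring_nf
    rw [h1, h2, expFun_add, sub_eq_add_neg, expFun_add]
    ring
  have h := sum_measureReal_eq_zero ![1, -1, -4, 4]
    ![hU.specMeasure (x + c • U t x), hU.specMeasure (x - c • U t x), ν, hU.specMeasure x]
    (fun i => by fin_cases i <;> simp <;> infer_instance) (fun r => by
      simp only [Fin.sum_univ_succ, Finset.univ_eq_empty, Finset.sum_empty, Matrix.cons_val_zero,
        Matrix.cons_val_succ, charFun_specMeasure, hνc, map_add, map_sub, map_smul,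
        inner_add_left, inner_add_right,
        inner_sub_left, inner_sub_right, inner_smul_left, inner_smul_right]
      rw [← hU.add, hU.inner_map_left t x, ← hU.add]
      rw [show -t + r = r - t by ring]
      push_cast
      ring) s
  simp only [Fin.sum_univ_succ, Finset.univ_eq_empty, Finset.sum_empty, Matrix.cons_val_zero,
        Matrix.cons_val_succ, hνs] at h
  rw [polar]
  linarith

/-- The preceding lemma with c = 1 and c = i supplies the real and imaginary parts of ∫ e^{iωt} over
`s`. -/
theorem inner_specProj_map {s : Set ℝ} (hs : MeasurableSet s) (t : ℝ) (x : H) :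
    inner ℂ (hU.specProj s x) (U t x) = charFun ((hU.specMeasure x).restrict s) t := by
  have hei : Integrable (expFun t) ((hU.specMeasure x).restrict s) :=
    Integrable.of_bound (C := 1) (measurable_expFun t).aestronglyMeasurable
      (ae_of_all _ fun ω => (norm_expFun t ω).le)
  have h1 := hU.polar_map (c := 1) (by simp) hs t x
  have h2 := hU.polar_map (c := Complex.I) (by simp) hs t x
  rw [one_smul] at h1
  have h3 : charFun ((hU.specMeasure x).restrict s) t =
      ∫ ω in s, expFun t ω ∂(hU.specMeasure x) := by
    rw [charFun_apply_real]
    refine integral_congr_ae (ae_of_all _ fun ω => ?_)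
    simp only [expFun]
    ring_nf
  rw [inner_specProj, sesqForm_apply, h1, h2, h3, ← integral_re_add_im hei]
  simp only [one_mul, Complex.mul_re, Complex.I_re, zero_mul, Complex.I_im, zero_sub, integral_neg,
    RCLike.re_to_complex, RCLike.im_to_complex, RCLike.I_to_complex]
  push_cast
  simp only [Complex.coe_algebraMap]
  ring

/-- Write P for the operator. It is symmetric and commutes with the group, so the functions ⟨v, U r
v⟩ for v = x + Px and v = x - Px differ by 4⟨Px, U r x⟩, the transform of four times the measure of
x restricted to `s`. Evaluating the resulting identity of measures on `s` itself gives 4⟨PPx, x⟩ =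
4⟨Px, x⟩. -/
theorem specProj_specProj {s : Set ℝ} (hs : MeasurableSet s) (x : H) :
    hU.specProj s (hU.specProj s x) = hU.specProj s x := by
  have key : (hU.specProj s).comp (hU.specProj s) = hU.specProj s := specProj_ext fun x => by
    have h := sum_measureReal_eq_zero ![1, -1, -4]
      ![hU.specMeasure (x + hU.specProj s x), hU.specMeasure (x - hU.specProj s x),
        (hU.specMeasure x).restrict s]
      (fun i => by fin_cases i <;> simp <;> infer_instance) (fun r => by
        simp only [Fin.sum_univ_succ, Finset.univ_eq_empty, Finset.sum_empty, Matrix.cons_val_zero,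
          Matrix.cons_val_succ, charFun_specMeasure, map_add, map_sub, inner_add_left,
          inner_add_right, inner_sub_left, inner_sub_right, ← hU.inner_specProj_map hs,
          ← hU.specProj_map]
        have h1 : inner ℂ x (hU.specProj s (U r x)) = inner ℂ (hU.specProj s x) (U r x) :=
          (hU.specProj_isSymmetric s x (U r x)).symm
        rw [h1]
        push_cast
        ring) s
    simp only [Fin.sum_univ_succ, Finset.univ_eq_empty, Finset.sum_empty, Matrix.cons_val_zero,
        Matrix.cons_val_succ] at h
    rw [measureReal_restrict_apply hs, Set.inter_self] at h
    have h2 := congrArg (fun r : ℝ => (r : ℂ)) h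
    push_cast at h2
    rw [← inner_specProj_self, ← inner_specProj_self, ← inner_specProj_self] at h2
    have h3 : inner ℂ (hU.specProj s x) (hU.specProj s x) =
        inner ℂ (hU.specProj s (hU.specProj s x)) x :=
      (hU.specProj_isSymmetric s (hU.specProj s x) x).symm
    simp only [map_add, map_sub, inner_add_left, inner_add_right, inner_sub_left,
      inner_sub_right, h3] at h2
    rw [ContinuousLinearMap.comp_apply]
    linear_combination h2 / 4
  exact congrArg (fun T : H →L[ℂ] H => T x) key

theorem norm_specProj_sq {s : Set ℝ} (hs : MeasurableSet s) (x : H) :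
    ‖hU.specProj s x‖ ^ 2 = (hU.specMeasure x).real s := by
  have h3 : inner ℂ (hU.specProj s x) (hU.specProj s x) =
      inner ℂ (hU.specProj s (hU.specProj s x)) x :=
    (hU.specProj_isSymmetric s (hU.specProj s x) x).symm
  rw [hU.specProj_specProj hs, inner_specProj_self] at h3
  rw [← inner_self_eq_norm_sq (𝕜 := ℂ), h3]
  simp

theorem specProj_biUnion (F : Finset ℕ) {s : ℕ → Set ℝ} (hs : ∀ n, MeasurableSet (s n))
    (hd : Pairwise (Function.onFun Disjoint s)) :
    hU.specProj (⋃ n ∈ F, s n) = ∑ n ∈ F, hU.specProj (s n) := specProj_ext fun x => by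
  rw [inner_specProj_self, measureReal_biUnion_finset (fun i _ j _ hij => hd hij)
    (fun n _ => hs n), _root_.sum_apply, sum_inner]
  push_cast
  simp only [inner_specProj_self]

theorem specProj_diff {s t : Set ℝ} (hs : MeasurableSet s) (hst : s ⊆ t) :
    hU.specProj (t \ s) = hU.specProj t - hU.specProj s := specProj_ext fun x => by
  rw [inner_specProj_self, measureReal_sdiff hst hs, _root_.sub_apply, inner_sub_left,
    inner_specProj_self, inner_specProj_self]
  push_cast
  rfl

open Classical in
/-- The spectral measure of a strongly continuous unitary group. -/
def projMeasure : ProjMeasure H where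
  toFun s := if MeasurableSet s then hU.specProj s else 0
  isProj s hs := by
    rw [if_pos hs]
    refine ⟨?_, ?_⟩
    · ext x
      exact hU.specProj_specProj hs x
    · rw [ContinuousLinearMap.isSelfAdjoint_iff_isSymmetric]
      exact hU.specProj_isSymmetric s
  not_measurable s hs := if_neg hs
  univ := by
    rw [if_pos .univ]
    refine specProj_ext fun x => ?_
    rw [inner_specProj_self, specMeasure_real_univ, one_apply_eq_self, inner_self_eq_norm_sq_to_K]
    norm_cast
  hasSum s hs hd x := by
    rw [if_pos (MeasurableSet.iUnion hs)]
    simp only [if_pos (hs _)]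
    have h1 : HasSum (fun n => (hU.specMeasure x).real (s n))
        ((hU.specMeasure x).real (⋃ n, s n)) := by
      have h0 := measure_iUnion (μ := hU.specMeasure x) hd hs
      have hne : ∑' n, hU.specMeasure x (s n) ≠ ⊤ := by
        rw [← h0]; exact measure_ne_top _ _
      rw [Measure.real, h0, ENNReal.tsum_toReal_eq (ENNReal.ne_top_of_tsum_ne_top hne)]
      exact ENNReal.hasSum_toReal hne
    -- The squared error of a partial sum is the measure of the remaining set, so strong additivity
    -- follows from that of a finite measure.
    have h2 : ∀ F : Finset ℕ, ‖∑ n ∈ F, hU.specProj (s n) x - hU.specProj (⋃ n, s n) x‖ ^ 2 =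
        (hU.specMeasure x).real (⋃ n, s n) - ∑ n ∈ F, (hU.specMeasure x).real (s n) := fun F => by
      have hF : MeasurableSet (⋃ n ∈ F, s n) := F.measurableSet_biUnion fun n _ => hs n
      have hsub : (⋃ n ∈ F, s n) ⊆ ⋃ n, s n :=
        Set.iUnion₂_subset fun n _ => Set.subset_iUnion s n
      have h3 := hU.norm_specProj_sq ((MeasurableSet.iUnion hs).diff hF) x
      rw [hU.specProj_diff hF hsub, measureReal_sdiff hsub hF, hU.specProj_biUnion F hs hd,
        measureReal_biUnion_finset (fun i _ j _ hij => hd hij) (fun n _ => hs n)] at h3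
      rw [norm_sub_rev, ← h3]
      simp
    rw [HasSum, tendsto_iff_norm_sub_tendsto_zero]
    have h4 := (h1.const_sub ((hU.specMeasure x).real (⋃ n, s n))).sqrt
    rw [sub_self, Real.sqrt_zero] at h4
    refine h4.congr fun F => ?_
    rw [← h2 F, Real.sqrt_sq (norm_nonneg _)]

theorem measureAt_projMeasure (x : H) : hU.projMeasure.measureAt x = hU.specMeasure x := by
  ext s hs
  have : hU.projMeasure s = hU.specProj s := if_pos hs
  rw [ProjMeasure.measureAt_apply _ _ hs, this, hU.norm_specProj_sq hs, ofReal_measureReal]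

/-- **Stone's theorem**: `U t = ∫ e^{iωt} dE(ω)`. -/
theorem act_projMeasure_expFun (t : ℝ) (x : H) : hU.projMeasure.act (expFun t) x = U t x := by
  have h : hU.projMeasure.actCLM (expFun t) (measurable_expFun t) 1
      (fun ω => (norm_expFun t ω).le) = U t := specProj_ext fun x => by
    rw [ProjMeasure.actCLM_apply, ← inner_conj_symm, ← hU.projMeasure.charFun_measureAt,
      measureAt_projMeasure, charFun_specMeasure, inner_conj_symm]
  rw [← h]
  rfl

end IsUnitaryGroup

/-! ### Resolvents and convergence -/

theorem unboundedResolvent_eq {H : Type*} [NormedAddCommGroup H] [InnerProductSpace ℂ H]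
    {A : H →ₗ.[ℂ] H} {w : ℂ} {R : H →L[ℂ] H} (h : IsResolventAt A w R) :
    unboundedResolvent A w = R := by
  have hex : ∃ R : H →L[ℂ] H, IsResolventAt A w R := ⟨R, h⟩
  rw [unboundedResolvent, dif_pos hex]
  ext y
  obtain ⟨hy, hy'⟩ := h.2 y
  have := hex.choose_spec.1 ⟨R y, hy⟩
  rwa [hy'] at this

namespace ProjMeasure

variable {H : Type*} [NormedAddCommGroup H] [InnerProductSpace ℂ H] [CompleteSpace H]
  (E : ProjMeasure H)

/-- `ω ↦ (w - iω)⁻¹`, cut off on `N`. -/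
def resolventFun (w : ℂ) (N : Set ℝ) : ℝ → ℂ :=
  Nᶜ.indicator fun ω => (w - Complex.I * ω)⁻¹

theorem measurable_resolventFun (w : ℂ) {N : Set ℝ} (hN : MeasurableSet N) :
    Measurable (resolventFun w N) := by
  refine Measurable.indicator ?_ hN.compl
  fun_prop

theorem norm_resolventFun_le {w : ℂ} {N : Set ℝ} {ε : ℝ} (hε : 0 < ε)
    (h : ∀ ω ∉ N, ε ≤ ‖w - Complex.I * (ω : ℂ)‖) (ω : ℝ) : ‖resolventFun w N ω‖ ≤ ε⁻¹ := by
  by_cases hω : ω ∈ N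
  · simp [resolventFun, hω, hε.le]
  · simp only [resolventFun, Set.indicator_of_mem (Set.mem_compl hω), norm_inv]
    exact inv_anti₀ hε (h ω hω)

theorem apply_compl_of_null {N : Set ℝ} (hN : MeasurableSet N) (h0 : E N = 0) (x : H) :
    E Nᶜ x = x := by
  have h := E.apply_union hN hN.compl disjoint_compl_right x
  rw [Set.union_compl_self, E.univ, h0] at h
  simpa using h.symm

/-- Off the null set `N` the function w - iω is bounded away from 0. Its reciprocal there is
bounded, and the product of the two is the indicator of `Nᶜ`, which acts as the identity. `N` is
empty for w off the imaginary axis, and a ball around a point in a spectral gap. -/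
theorem isResolventAt_integral {w : ℂ} {N : Set ℝ} (hN : MeasurableSet N) (h0 : E N = 0) {ε : ℝ}
    (hε : 0 < ε) (h : ∀ ω ∉ N, ε ≤ ‖w - Complex.I * (ω : ℂ)‖) :
    IsResolventAt (E.integral (fun ω : ℝ => Complex.I * ω) measurable_I_mul) w
      (E.actCLM (resolventFun w N) (measurable_resolventFun w hN) ε⁻¹
        (norm_resolventFun_le hε h)) := by
  set g := resolventFun w N with hg
  have hgm : Measurable g := measurable_resolventFun w hN
  have hgb : ∀ ω, ‖g ω‖ ≤ ε⁻¹ := norm_resolventFun_le hε h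
  have hgL : ∀ x, MemLp g 2 (E.measureAt x) := fun x => E.memLp_of_bound hgm hgb
  have hlm : Measurable fun ω : ℝ => w - Complex.I * ω := by fun_prop
  have hmul : g * (fun ω : ℝ => w - Complex.I * ω) = Nᶜ.indicator 1 := by
    ext ω
    by_cases hω : ω ∈ N
    · simp [hg, resolventFun, hω]
    · have : w - Complex.I * (ω : ℂ) ≠ 0 := norm_pos_iff.1 (hε.trans_le (h ω hω))
      simp [hg, resolventFun, hω, inv_mul_cancel₀ this]
  have h1L : ∀ x, MemLp (Nᶜ.indicator (1 : ℝ → ℂ)) 2 (E.measureAt x) := fun x =>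
    (memLp_const (1 : ℂ)).indicator hN.compl
  refine ⟨fun x => ?_, fun y => ?_⟩
  · have hx := mem_domain_integral.1 x.2
    have hlL : MemLp (fun ω : ℝ => w - Complex.I * (ω : ℂ)) 2 (E.measureAt (x : H)) :=
      (memLp_const w).sub hx
    have h2 : w • (x : H) - E.act (fun ω : ℝ => Complex.I * ω) x =
        E.act (fun ω : ℝ => w - Complex.I * ω) x := by
      rw [← act_const, ← E.act_sub measurable_const measurable_I_mul (memLp_const w) hx]
      rfl
    rw [integral_apply, h2, actCLM_apply, E.act_act hlm hlL hgm (by rw [hmul]; exact h1L _), hmul,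
      E.act_indicator_one hN.compl, E.apply_compl_of_null hN h0]
  -- iω g is bounded although iω is not, since iω g = w g minus the indicator of `Nᶜ`.
  · have hIg : MemLp ((fun ω : ℝ => Complex.I * (ω : ℂ)) * g) 2 (E.measureAt y) := by
      refine E.memLp_of_bound (measurable_I_mul.mul hgm) (C := ‖w‖ * ε⁻¹ + 1) fun ω => ?_
      have h3 : ((fun ω : ℝ => Complex.I * (ω : ℂ)) * g) ω =
          w * g ω - Nᶜ.indicator (1 : ℝ → ℂ) ω := by
        rw [← hmul]; simp only [Pi.mul_apply]; ring
      rw [h3]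
      refine (norm_sub_le _ _).trans (add_le_add ?_ ?_)
      · rw [norm_mul]; gcongr; exact hgb ω
      · exact (norm_indicator_le_norm_self _ _).trans (by simp)
    have hdom : E.act g y ∈ (E.integral (fun ω : ℝ => Complex.I * ω) measurable_I_mul).domain :=
      mem_domain_integral.2 ((E.memLp_measureAt_act_iff hgm (hgL y) measurable_I_mul).2 hIg)
    refine ⟨hdom, ?_⟩
    rw [integral_apply]
    simp only [actCLM_apply]
    rw [E.act_act hgm (hgL y) measurable_I_mul hIg, ← E.act_smul w hgm (hgL y),
      ← E.act_sub (hgm.const_smul w) (measurable_I_mul.mul hgm) ((hgL y).const_smul w) hIg]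
    have h4 : w • g - (fun ω : ℝ => Complex.I * (ω : ℂ)) * g = Nᶜ.indicator 1 := by
      rw [← hmul]; ext ω
      simp only [Pi.sub_apply, Pi.smul_apply, Pi.mul_apply, smul_eq_mul]
      ring
    rw [h4, E.act_indicator_one hN.compl, E.apply_compl_of_null hN h0]

theorem abs_re_le_norm_sub (w : ℂ) (ω : ℝ) : |w.re| ≤ ‖w - Complex.I * (ω : ℂ)‖ := by
  have := Complex.abs_re_le_norm (w - Complex.I * (ω : ℂ))
  simpa using this

theorem isResolventAt_of_re_ne_zero {w : ℂ} (hw : w.re ≠ 0) :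
    IsResolventAt (E.integral (fun ω : ℝ => Complex.I * ω) measurable_I_mul) w
      (E.actCLM (resolventFun w ∅) (measurable_resolventFun w .empty) |w.re|⁻¹
        (norm_resolventFun_le (abs_pos.2 hw) fun ω _ => abs_re_le_norm_sub w ω)) :=
  E.isResolventAt_integral .empty (by ext x; exact E.apply_empty x) (abs_pos.2 hw)
    fun ω _ => abs_re_le_norm_sub w ω

theorem mem_resolventSet_of_ball {ω₀ ε : ℝ} (hε : 0 < ε) (h : E (Metric.ball ω₀ ε) = 0) :
    Complex.I * ω₀ ∈ unboundedResolventSet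
      (E.integral (fun ω : ℝ => Complex.I * ω) measurable_I_mul) := by
  refine ⟨_, E.isResolventAt_integral measurableSet_ball h hε fun ω hω => ?_⟩
  rw [Metric.mem_ball, not_lt, dist_comm, Real.dist_eq] at hω
  rw [← mul_sub, norm_mul, Complex.norm_I, one_mul, ← Complex.ofReal_sub, Complex.norm_real]
  exact hω

/-- On the range of E(ball of radius ε) the operator iω₀ - A has norm at most ε, so its inverse `R`
forces ‖y‖ ≤ ‖R‖ ε ‖y‖ there. The radius is chosen so that ‖R‖ ε < 1, hence y = 0. -/
theorem exists_ball_of_mem_resolventSet {ω₀ : ℝ} (h : Complex.I * ω₀ ∈ unboundedResolventSet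
      (E.integral (fun ω : ℝ => Complex.I * ω) measurable_I_mul)) :
    ∃ ε > 0, E (Metric.ball ω₀ ε) = 0 := by
  obtain ⟨R, hR, -⟩ := h
  have hε : 0 < (‖R‖ + 1)⁻¹ := by positivity
  refine ⟨(‖R‖ + 1)⁻¹, hε, ?_⟩
  set ε := (‖R‖ + 1)⁻¹ with hεdef
  set B := Metric.ball ω₀ ε with hB
  have hBm : MeasurableSet B := measurableSet_ball
  ext x
  set y := E B x with hy
  have hyB : E.act (B.indicator 1) y = y := by
    rw [E.act_indicator_one hBm, hy, E.apply_apply_self hBm]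
  have h1L : MemLp (B.indicator (1 : ℝ → ℂ)) 2 (E.measureAt y) :=
    (memLp_const (1 : ℂ)).indicator hBm
  have h1m : Measurable (B.indicator (1 : ℝ → ℂ)) := measurable_one.indicator hBm
  have hbd : ∀ ω, ‖((fun ω : ℝ => Complex.I * (ω : ℂ)) * B.indicator (1 : ℝ → ℂ)) ω‖ ≤ |ω₀| + ε :=
    fun ω => by
      by_cases hω : ω ∈ B
      · rw [hB, Metric.mem_ball, Real.dist_eq] at hω
        have h2 : |ω| ≤ |ω - ω₀| + |ω₀| := by simpa using abs_add_le (ω - ω₀) ω₀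
        have h3 : ω ∈ B := hω
        simp only [Pi.mul_apply, Set.indicator_of_mem h3, Pi.one_apply, mul_one, norm_mul,
          Complex.norm_I, one_mul, Complex.norm_real, Real.norm_eq_abs]
        linarith
      · simp only [Pi.mul_apply, Set.indicator_of_notMem hω, mul_zero, norm_zero]
        positivity
  have hm : Measurable ((fun ω : ℝ => Complex.I * (ω : ℂ)) * B.indicator (1 : ℝ → ℂ)) :=
    measurable_I_mul.mul h1m
  have hL := E.memLp_of_bound (x := y) hm hbd
  have hdom : MemLp (fun ω : ℝ => Complex.I * (ω : ℂ)) 2 (E.measureAt y) := by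
    have := (E.memLp_measureAt_act_iff h1m h1L measurable_I_mul).2 hL
    rwa [hyB] at this
  have hA : E.act (fun ω : ℝ => Complex.I * ω) y =
      E.act ((fun ω : ℝ => Complex.I * ω) * B.indicator 1) y := by
    conv_lhs => rw [← hyB]
    rw [E.act_act h1m h1L measurable_I_mul hL]
  have hw : (Complex.I * (ω₀ : ℂ)) • y - E.act (fun ω : ℝ => Complex.I * ω) y =
      E.act ((Complex.I * (ω₀ : ℂ)) • B.indicator 1 -
        (fun ω : ℝ => Complex.I * ω) * B.indicator 1) y := by
    rw [E.act_sub (h1m.const_smul _) hm (h1L.const_smul _) hL, E.act_smul _ h1m h1L, hyB, hA]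
  have hn : ‖(Complex.I * (ω₀ : ℂ)) • y - E.act (fun ω : ℝ => Complex.I * ω) y‖ ≤ ε * ‖y‖ := by
    rw [hw]
    refine E.norm_act_le ((h1m.const_smul _).sub hm) (fun ω => ?_) y
    by_cases hω : ω ∈ B
    · have h3 := hω
      rw [hB, Metric.mem_ball, dist_comm, Real.dist_eq] at hω
      simp only [Pi.sub_apply, Pi.smul_apply, Pi.mul_apply, Set.indicator_of_mem h3, Pi.one_apply,
        mul_one, smul_eq_mul]
      rw [← mul_sub, norm_mul, Complex.norm_I, one_mul, ← Complex.ofReal_sub, Complex.norm_real]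
      exact hω.le
    · simp [hω, hε.le]
  have h5 := hR ⟨y, mem_domain_integral.2 hdom⟩
  rw [integral_apply] at h5
  have h6 : ‖y‖ ≤ ‖R‖ * (ε * ‖y‖) := by
    refine (congrArg norm h5).symm.trans_le ?_
    exact (R.le_opNorm _).trans (by gcongr)
  have h7 : ‖R‖ * ε < 1 := by
    rw [hεdef, ← div_eq_mul_inv, div_lt_one (by positivity)]
    linarith
  have h8 : ‖y‖ = 0 := by nlinarith [norm_nonneg y]
  exact norm_eq_zero.1 h8

theorem apply_eq_zero_of_subset {s t : Set ℝ} (hs : MeasurableSet s) (ht : MeasurableSet t)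
    (hst : s ⊆ t) (h : E t = 0) : E s = 0 := by
  ext x
  have := E.apply_apply hs ht x
  rw [h, Set.inter_eq_left.2 hst] at this
  simpa using this.symm

/-! ### The operators `∫ i p dE` -/

section Real

variable {p : ℝ → ℝ} (hp : Measurable p)

include hp in
theorem measurable_I_mul_comp : Measurable fun ω => Complex.I * (p ω : ℂ) := by fun_prop

theorem isSpectralMeasureOf_map : (E.map p hp).IsSpectralMeasureOf
    (E.integral (fun ω => Complex.I * (p ω : ℂ)) (measurable_I_mul_comp hp)) :=
  E.integral_map hp measurable_I_mul

/-- By uniqueness, the chosen spectral measure of ∫ i p dE must be the push-forward. This is what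
allows functional calculi to be nested. -/
theorem spectralMeasure_integral :
    spectralMeasure (E.integral (fun ω => Complex.I * (p ω : ℂ)) (measurable_I_mul_comp hp)) =
      E.map p hp :=
  spectralMeasure_eq _ (E.isSpectralMeasureOf_map hp)

theorem borelCalculus_integral {f : ℝ → ℂ} (hf : Measurable f) :
    borelCalculus (E.integral (fun ω => Complex.I * (p ω : ℂ)) (measurable_I_mul_comp hp)) f hf =
      E.integral (f ∘ p) (hf.comp hp) := by
  rw [borelCalculus, spectralMeasure_integral E hp, integral_map E hp hf]

theorem isResolventAt_integral_comp {w : ℂ} (hw : w.re ≠ 0) : IsResolventAt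
    (E.integral (fun ω => Complex.I * (p ω : ℂ)) (measurable_I_mul_comp hp)) w
      (E.actCLM (resolventFun w ∅ ∘ p) ((measurable_resolventFun w .empty).comp hp) |w.re|⁻¹
        fun ω => norm_resolventFun_le (abs_pos.2 hw) (fun ω _ => abs_re_le_norm_sub w ω) (p ω)) := by
  have h := (E.map p hp).isResolventAt_of_re_ne_zero hw
  rw [E.integral_map hp measurable_I_mul] at h
  convert! h using 1
  ext x
  rw [actCLM_apply, actCLM_apply, act_map E hp (measurable_resolventFun w .empty)]
  exact E.memLp_of_bound ((measurable_resolventFun w .empty).comp hp) fun ω =>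
    norm_resolventFun_le (abs_pos.2 hw) (fun ω _ => abs_re_le_norm_sub w ω) (p ω)

end Real

/-! ### Convergence when p_z(ω) is eventually equal to ω -/

section Convergence

variable {p : ℝ → ℝ → ℝ} (hp : ∀ z, Measurable (p z))
  (hlim : ∀ ω, ∀ᶠ z in 𝓝[>] (0 : ℝ), p z ω = ω)

-- For each ω the integrand is eventually equal to f(ω), so bounded Borel functions are allowed,
-- indicators included, with a constant as dominating function. Every convergence statement below is
-- an instance of this one.
include hp hlim in
theorem tendsto_act_comp {f : ℝ → ℂ} (hf : Measurable f) {C : ℝ} (hC : ∀ ω, ‖f ω‖ ≤ C) (x : H) :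
    Tendsto (fun z => E.act (f ∘ p z) x) (𝓝[>] 0) (𝓝 (E.act f x)) := by
  refine E.tendsto_act_of_dominated (fun _ => C) (fun z => hf.comp (hp z)) hf (memLp_const C)
    (fun z ω => hC _) fun ω => tendsto_const_nhds.congr' ?_
  filter_upwards [hlim ω] with z hz
  rw [Function.comp_apply, hz]

include hlim in
theorem strongOpConv_borelCalculus {f : ℝ → ℂ} (hf : Measurable f) {C : ℝ}
    (hC : ∀ ω, ‖f ω‖ ≤ C) :
    StrongOpConv (fun z => borelCalculus
      (E.integral (fun ω => Complex.I * (p z ω : ℂ)) (measurable_I_mul_comp (hp z))) f hf)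
      (borelCalculus (E.integral (fun ω : ℝ => Complex.I * ω) measurable_I_mul) f hf) := by
  refine ⟨fun z => E.actCLM (f ∘ p z) (hf.comp (hp z)) C fun ω => hC _, E.actCLM f hf C hC,
    fun z _ => ?_, ?_, fun x => E.tendsto_act_comp hp hlim hf hC x⟩
  · refine (E.borelCalculus_integral (hp z) hf).trans ?_
    exact E.integral_eq_toPMap _ (C := C) (fun ω => hC _) _ fun _ => rfl
  · rw [borelCalculus, E.spectralMeasure_eq rfl]
    exact E.integral_eq_toPMap _ hC _ fun _ => rfl

include hlim in
theorem strongResolventConv : StrongResolventConv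
    (fun z => E.integral (fun ω => Complex.I * (p z ω : ℂ)) (measurable_I_mul_comp (hp z)))
    (E.integral (fun ω : ℝ => Complex.I * ω) measurable_I_mul) := by
  intro w hw
  refine ⟨⟨_, E.isResolventAt_of_re_ne_zero hw⟩,
    fun z _ => ⟨_, E.isResolventAt_integral_comp (hp z) hw⟩, fun x => ?_⟩
  simp only [unboundedResolvent_eq (E.isResolventAt_integral_comp (hp _) hw),
    unboundedResolvent_eq (E.isResolventAt_of_re_ne_zero hw), actCLM_apply]
  exact E.tendsto_act_comp hp hlim (measurable_resolventFun w .empty)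
    (norm_resolventFun_le (abs_pos.2 hw) fun ω _ => abs_re_le_norm_sub w ω) x

include hlim in
theorem tendsto_spectralMeasure {s : Set ℝ} (hs : MeasurableSet s) (x : H) :
    Tendsto (fun z => spectralMeasure
      (E.integral (fun ω => Complex.I * (p z ω : ℂ)) (measurable_I_mul_comp (hp z))) s x) (𝓝[>] 0)
      (𝓝 (spectralMeasure (E.integral (fun ω : ℝ => Complex.I * ω) measurable_I_mul) s x)) := by
  have h : ∀ z, spectralMeasure (E.integral (fun ω => Complex.I * (p z ω : ℂ))
      (measurable_I_mul_comp (hp z))) s x = E.act (s.indicator 1 ∘ p z) x := fun z => by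
    rw [E.spectralMeasure_integral (hp z), map_apply E (hp z) hs, ← E.act_indicator_one (hp z hs)]
    rfl
  rw [E.spectralMeasure_eq rfl, ← E.act_indicator_one hs]
  simp only [h]
  exact E.tendsto_act_comp hp hlim (measurable_one.indicator hs) (C := 1)
    (fun ω => (norm_indicator_le_norm_self _ _).trans (by simp)) x

/-- A gap of the new operator around ω₀ is a ball whose preimage under `p` is null. Near ω₀ this
preimage contains a smaller ball, since `p` is the identity there, and that would be a gap of the
original operator. -/
theorem mem_spectrum_integral_comp {p : ℝ → ℝ} (hp : Measurable p) {ω₀ δ : ℝ} (hδ : 0 < δ)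
    (hball : ∀ ω ∈ Metric.ball ω₀ δ, p ω = ω)
    (h : Complex.I * ω₀ ∈ unboundedSpectrum
      (E.integral (fun ω : ℝ => Complex.I * ω) measurable_I_mul)) :
    Complex.I * ω₀ ∈ unboundedSpectrum
      (E.integral (fun ω => Complex.I * (p ω : ℂ)) (measurable_I_mul_comp hp)) := by
  intro h'
  rw [show E.integral (fun ω => Complex.I * (p ω : ℂ)) (measurable_I_mul_comp hp) =
    (E.map p hp).integral (fun ω : ℝ => Complex.I * ω) measurable_I_mul from
    (E.integral_map hp measurable_I_mul).symm] at h'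
  obtain ⟨ε, hε, h0⟩ := exists_ball_of_mem_resolventSet _ h'
  rw [map_apply E hp measurableSet_ball] at h0
  refine h (E.mem_resolventSet_of_ball (lt_min hε hδ) (E.apply_eq_zero_of_subset
    measurableSet_ball (hp measurableSet_ball) (fun ω hω => ?_) h0))
  rw [Set.mem_preimage, hball ω (Metric.ball_subset_ball (min_le_right _ _) hω)]
  exact Metric.ball_subset_ball (min_le_left _ _) hω

theorem zero_mem_spectrum_integral_comp {p : ℝ → ℝ} (hp : Measurable p) (hp0 : p 0 = 0)
    (h : E {0} ≠ 0) : (0 : ℂ) ∈ unboundedSpectrum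
      (E.integral (fun ω => Complex.I * (p ω : ℂ)) (measurable_I_mul_comp hp)) := by
  intro h'
  rw [show E.integral (fun ω => Complex.I * (p ω : ℂ)) (measurable_I_mul_comp hp) =
    (E.map p hp).integral (fun ω : ℝ => Complex.I * ω) measurable_I_mul from
    (E.integral_map hp measurable_I_mul).symm,
    show (0 : ℂ) = Complex.I * ((0 : ℝ) : ℂ) by simp] at h'
  obtain ⟨ε, hε, h0⟩ := exists_ball_of_mem_resolventSet _ h'
  rw [map_apply E hp measurableSet_ball] at h0
  exact h (E.apply_eq_zero_of_subset (measurableSet_singleton 0) (hp measurableSet_ball)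
    (fun ω hω => by rw [Set.mem_singleton_iff.1 hω]; simp [hp0, hε]) h0)

end Convergence

end ProjMeasure

/-! ### Restriction of a unitary group to the complement of a fixed vector -/

namespace IsUnitaryGroup

variable {H : Type*} [NormedAddCommGroup H] [InnerProductSpace ℂ H] {U : ℝ → H →L[ℂ] H}

theorem map_mem_orthogonal (hU : IsUnitaryGroup U) {e : H} (he : ∀ t, U t e = e) (t : ℝ) {x : H}
    (hx : x ∈ (ℂ ∙ e)ᗮ) : U t x ∈ (ℂ ∙ e)ᗮ := by
  rw [Submodule.mem_orthogonal_singleton_iff_inner_right] at hx ⊢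
  rw [← hx, ← hU.inner_map_map t e x, he]

/-- The group induced on the orthogonal complement of a fixed vector. -/
def restrict (hU : IsUnitaryGroup U) {e : H} (he : ∀ t, U t e = e) (t : ℝ) :
    (ℂ ∙ e)ᗮ →L[ℂ] (ℂ ∙ e)ᗮ :=
  ((U t).comp (ℂ ∙ e)ᗮ.subtypeL).codRestrict _ fun x => hU.map_mem_orthogonal he t x.2

theorem coe_restrict (hU : IsUnitaryGroup U) {e : H} (he : ∀ t, U t e = e) (t : ℝ)
    (x : (ℂ ∙ e)ᗮ) : (hU.restrict he t x : H) = U t x := rfl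

theorem isUnitaryGroup_restrict (hU : IsUnitaryGroup U) {e : H} (he : ∀ t, U t e = e) :
    IsUnitaryGroup (hU.restrict he) where
  zero := by
    ext x
    rw [coe_restrict, hU.zero]
    rfl
  add s t x := Subtype.ext (hU.add s t x)
  norm_map t x := hU.norm_map t x
  continuous x := (hU.continuous x).subtype_mk _

variable [CompleteSpace H] (hU : IsUnitaryGroup U)

theorem map_projMeasure_singleton (t : ℝ) (x : H) :
    U t (hU.projMeasure {0} x) = hU.projMeasure {0} x := by
  have h0 : MeasurableSet ({0} : Set ℝ) := measurableSet_singleton 0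
  have h1 : MemLp (({0} : Set ℝ).indicator (1 : ℝ → ℂ)) 2 (hU.projMeasure.measureAt x) :=
    (memLp_const (1 : ℂ)).indicator h0
  have h2 : expFun t * ({0} : Set ℝ).indicator (1 : ℝ → ℂ) = ({0} : Set ℝ).indicator 1 := by
    ext ω
    by_cases hω : ω = 0
    · simp [hω, expFun]
    · simp [hω]
  rw [← hU.act_projMeasure_expFun, ← hU.projMeasure.act_indicator_one h0,
    hU.projMeasure.act_act (measurable_one.indicator h0) h1 (measurable_expFun t) (by rwa [h2]), h2]

/-- The spectral measure of the restricted group. -/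
def restrictMeasure {e : H} (he : ∀ t, U t e = e) : ProjMeasure (ℂ ∙ e)ᗮ :=
  (hU.isUnitaryGroup_restrict he).projMeasure

/-- Vectors in the range of the projection at {0} are fixed by the group, so they are multiples of
`e`; being also orthogonal to `e`, they vanish. -/
theorem restrictMeasure_singleton {e : H} (he : ∀ t, U t e = e)
    (herg : ∀ y, (∀ t, U t y = y) → y ∈ ℂ ∙ e) : hU.restrictMeasure he {0} = 0 := by
  ext x
  set y := hU.restrictMeasure he {0} x
  have hy : ((y : (ℂ ∙ e)ᗮ) : H) ∈ ℂ ∙ e := herg _ fun t =>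
    congrArg Subtype.val ((hU.isUnitaryGroup_restrict he).map_projMeasure_singleton t x)
  exact inner_self_eq_zero.1 (y.2 _ hy)

/-- On the line spanned by `e` the group is trivial, in agreement with the point mass at 0, where
e^{iωt} = 1. -/
theorem act_extend_restrictMeasure {e : H} (he : ∀ t, U t e = e) (t : ℝ) (x : H) :
    (hU.restrictMeasure he).extend.act (expFun t) x = U t x := by
  have h1 : x - (ℂ ∙ e)ᗮ.starProjection x ∈ ℂ ∙ e := by
    have := (ℂ ∙ e)ᗮ.sub_starProjection_mem_orthogonal x
    rwa [Submodule.orthogonal_orthogonal] at this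
  obtain ⟨c, hc⟩ := Submodule.mem_span_singleton.1 h1
  have h2 : U t (x - (ℂ ∙ e)ᗮ.starProjection x) = x - (ℂ ∙ e)ᗮ.starProjection x := by
    rw [← hc, map_smul, he]
  rw [ProjMeasure.act_extend _ (measurable_expFun t) (ProjMeasure.memLp_expFun _ _ _),
    restrictMeasure, act_projMeasure_expFun, coe_restrict, expFun, Complex.ofReal_zero, mul_zero,
    zero_mul, Complex.exp_zero, one_smul]
  conv_lhs => rw [← h2, ← map_add]
  congr 1
  exact add_sub_cancel _ _

theorem infGenerator_eq {e : H} (he : ∀ t, U t e = e) :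
    infGenerator U = (hU.restrictMeasure he).extend.integral (fun ω : ℝ => Complex.I * ω)
      ProjMeasure.measurable_I_mul :=
  ProjMeasure.infGenerator_eq_integral _ U fun t x => (hU.act_extend_restrictMeasure he t x).symm

theorem partIn_infGenerator {e : H} (he : ∀ t, U t e = e) :
    partIn (ℂ ∙ e)ᗮ (infGenerator U) = (hU.restrictMeasure he).integral
      (fun ω : ℝ => Complex.I * ω) ProjMeasure.measurable_I_mul := by
  rw [hU.infGenerator_eq he, ← ProjMeasure.sandwich_integral _ _ (by simp), partIn_sandwich]

theorem extend_restrictMeasure_singleton_ne_zero {e : H} (he : ∀ t, U t e = e) (he0 : e ≠ 0) :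
    (hU.restrictMeasure he).extend {0} ≠ 0 := by
  classical
  intro h
  have h1 : (ℂ ∙ e)ᗮ.orthogonalProjectionOnto e = 0 := by
    rw [Submodule.orthogonalProjectionOnto_eq_zero_iff, Submodule.orthogonal_orthogonal]
    exact Submodule.mem_span_singleton_self e
  have h2 : (ℂ ∙ e)ᗮ.starProjection e = 0 := congrArg Subtype.val h1
  have h3 := ProjMeasure.extend_apply (hU.restrictMeasure he) {0} e
  rw [h, h1, h2, ProjMeasure.default_apply (measurableSet_singleton 0)] at h3
  simp at h3
  exact he0 h3.symm

end IsUnitaryGroup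

/-! ### The Koopman group -/

section Koopman

variable {M : Type*} [TopologicalSpace M] [MeasurableSpace M] [BorelSpace M] [AddAction ℝ M]
  [ContinuousVAdd ℝ M] (μ : Measure M) [ErgodicVAdd ℝ M μ]

theorem coeFn_koopman (t : ℝ) (f : Lp ℂ 2 μ) : koopman μ t f =ᵐ[μ] fun x => f (t +ᵥ x) :=
  Lp.coeFn_compMeasurePreserving f (measurePreserving_vadd t μ)

theorem koopman_toLp (t : ℝ) {f : M → ℂ} (hf : MemLp f 2 μ) :
    koopman μ t (hf.toLp f) =
      (hf.comp_measurePreserving (measurePreserving_vadd t μ)).toLp _ := rfl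

theorem koopman_zero : koopman μ 0 = 1 := by
  ext1 f
  refine Lp.ext ((coeFn_koopman μ 0 f).trans (ae_of_all _ fun x => ?_))
  simp

theorem koopman_add (s t : ℝ) (f : Lp ℂ 2 μ) :
    koopman μ (s + t) f = koopman μ s (koopman μ t f) := by
  refine Lp.ext ?_
  filter_upwards [coeFn_koopman μ (s + t) f, coeFn_koopman μ s (koopman μ t f),
    (measurePreserving_vadd s μ).quasiMeasurePreserving.ae_eq_comp (coeFn_koopman μ t f)]
    with x h1 h2 h3
  rw [h1, h2]
  refine Eq.trans ?_ h3.symm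
  simp only [Function.comp_apply]
  rw [vadd_vadd, add_comm]

variable [IsProbabilityMeasure μ]

theorem koopman_const (t : ℝ) (c : ℂ) : koopman μ t (Lp.const 2 μ c) = Lp.const 2 μ c := by
  refine Lp.ext ?_
  filter_upwards [coeFn_koopman μ t (Lp.const 2 μ c), Lp.coeFn_const (p := 2) (μ := μ) c,
    (measurePreserving_vadd t μ).quasiMeasurePreserving.ae_eq_comp
      (Lp.coeFn_const (p := 2) (μ := μ) c)] with x h1 h2 h3
  rw [h1, h2]
  exact h3

/-- Each preimage under f of a Borel set is invariant up to a null set that may depend on t.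
Ergodicity makes it null or conull, and a function for which all these preimages are trivial is
almost everywhere constant. -/
theorem exists_eq_const_of_koopman_eq {f : Lp ℂ 2 μ} (h : ∀ t, koopman μ t f = f) :
    ∃ c, f = Lp.const 2 μ c := by
  have hm : NullMeasurable f μ := (Lp.aestronglyMeasurable f).aemeasurable.nullMeasurable
  obtain ⟨c, hc⟩ := exists_eventuallyEq_const_of_forall_separating (l := ae μ) (f := f)
    MeasurableSet fun s hs => eventuallyConst_set.1
      (aeconst_of_forall_preimage_vadd_ae_eq ℝ (s := f ⁻¹' s) (hm hs) fun t => by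
        have h1 : (fun x => f (t +ᵥ x)) =ᵐ[μ] f := by
          have := coeFn_koopman μ t f
          rw [h] at this
          exact this.symm
        refine (h1.mono fun x hx => ?_).set_eq
        exact iff_of_eq (congrArg (· ∈ s) hx))
  exact ⟨c, Lp.ext (hc.trans (Lp.coeFn_const (p := 2) (μ := μ) c).symm)⟩

end Koopman

section KoopmanMetric

variable {M : Type*} [MetricSpace M] [MeasurableSpace M] [BorelSpace M] [AddAction ℝ M]
  [ContinuousVAdd ℝ M] (μ : Measure M) [IsProbabilityMeasure μ] [ErgodicVAdd ℝ M μ]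

theorem continuous_koopman_boundedContinuous (g : BoundedContinuousFunction M ℂ) :
    Continuous fun t => koopman μ t (BoundedContinuousFunction.toLp 2 μ ℂ g) := by
  refine continuous_iff_continuousAt.2 fun s => ?_
  have hg : MemLp g 2 μ := MemLp.of_bound g.continuous.aestronglyMeasurable ‖g‖
    (ae_of_all _ g.norm_coe_le_norm)
  have heq : BoundedContinuousFunction.toLp 2 μ ℂ g = hg.toLp g := by
    refine Lp.ext ?_
    exact (BoundedContinuousFunction.coeFn_toLp 2 μ ℂ g).trans hg.coeFn_toLp.symm
  rw [heq]
  simp only [koopman_toLp]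
  rw [ContinuousAt, Lp.tendsto_Lp_iff_tendsto_eLpNorm'']
  have h0 : Tendsto (fun t : ℝ => ∫⁻ x, ‖g (t +ᵥ x) - g (s +ᵥ x)‖ₑ ^ (2 : ℝ) ∂μ) (𝓝 s)
      (𝓝 (∫⁻ _, 0 ∂μ)) := by
    have hc : ∀ t : ℝ, Continuous fun x : M => g (t +ᵥ x) := fun t =>
      g.continuous.comp (continuous_const_vadd t)
    refine tendsto_lintegral_filter_of_dominated_convergence
      (fun _ => ENNReal.ofReal (‖g‖ + ‖g‖) ^ (2 : ℝ)) (Eventually.of_forall fun t => ?_)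
      (Eventually.of_forall fun t => ae_of_all _ fun x => ?_) ?_ (ae_of_all _ fun x => ?_)
    · have := hc t
      have := hc s
      exact Continuous.measurable (by fun_prop)
    · refine ENNReal.rpow_le_rpow ?_ (by norm_num)
      rw [← ofReal_norm]
      exact ENNReal.ofReal_le_ofReal ((norm_sub_le _ _).trans
        (add_le_add (g.norm_coe_le_norm _) (g.norm_coe_le_norm _)))
    · rw [lintegral_const]
      exact ENNReal.mul_ne_top (by simp) (measure_ne_top _ _)
    · have h1 : Continuous fun t : ℝ => ‖g (t +ᵥ x) - g (s +ᵥ x)‖ₑ ^ (2 : ℝ) := by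
        have h2 : Continuous fun t : ℝ => t +ᵥ x := continuous_id.vadd continuous_const
        have h3 := g.continuous.comp h2
        exact ENNReal.continuous_rpow_const.comp (h3.sub continuous_const).enorm
      simpa using h1.tendsto s
  have h1 := (ENNReal.continuous_rpow_const (y := 1 / 2)).tendsto _ |>.comp h0
  rw [lintegral_zero, ENNReal.zero_rpow_of_pos (by norm_num)] at h1
  refine h1.congr fun t => ?_
  rw [eLpNorm_eq_lintegral_rpow_enorm_toReal (by norm_num) (by norm_num)]
  rfl

/-- Bounded continuous functions are dense in L² of a finite Borel measure on a metric space, and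
there continuity in t is dominated convergence. The Koopman operators are isometries, so it extends
to all of L². -/
theorem continuous_koopman (f : Lp ℂ 2 μ) : Continuous fun t => koopman μ t f := by
  have hd : DenseRange (BoundedContinuousFunction.toLp 2 μ ℂ :
      BoundedContinuousFunction M ℂ →L[ℂ] Lp ℂ 2 μ) :=
    BoundedContinuousFunction.toLp_denseRange (α := M) ℂ μ ℂ (by norm_num)
  have h := continuous_prod_of_dense_continuous_lipschitzWith
    (fun p : Lp ℂ 2 μ × ℝ => koopman μ p.2 p.1) 1 hd
    (by rintro _ ⟨g, rfl⟩; exact continuous_koopman_boundedContinuous μ g)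
    (fun t => (Lp.compMeasurePreservingₗᵢ ℂ (fun x : M => t +ᵥ x)
      (measurePreserving_vadd t μ)).lipschitz)
  exact h.comp (Continuous.prodMk_right f)

theorem isUnitaryGroup_koopman : IsUnitaryGroup (koopman μ) where
  zero := koopman_zero μ
  add := koopman_add μ
  norm_map t := (Lp.compMeasurePreservingₗᵢ ℂ (fun x : M => t +ᵥ x)
      (measurePreserving_vadd t μ)).norm_map
  continuous := continuous_koopman μ

end KoopmanMetric

/-! ### The compressed frequency and its inverse -/

/-- `q_z(iω) = i lamFun z ω`. -/
def lamFun (z ω : ℝ) : ℝ := ω / (z ^ 2 + ω ^ 2)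

/-- `q̃_z⁻¹(q_z(iω)) = i pFun z ω`. -/
def pFun (z ω : ℝ) : ℝ :=
  (1 + √(1 - 4 * z ^ 2 * lamFun z ω ^ 2)) / (2 * lamFun z ω)

theorem measurable_lamFun (z : ℝ) : Measurable (lamFun z) := by unfold lamFun; fun_prop

theorem measurable_pFun (z : ℝ) : Measurable (pFun z) := by
  have := measurable_lamFun z
  unfold pFun
  fun_prop

theorem qFun_eq (z : ℝ) : qFun z = fun ω => Complex.I * (lamFun z ω : ℂ) := by
  ext ω
  simp [qFun, lamFun, mul_div_assoc]

/-- Division by zero returns 0 here. The value is immaterial on H̃, where {0} is null, but it makes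
the extended integral vanish on the constants, as V_z does. -/
theorem pFun_zero (z : ℝ) : pFun z 0 = 0 := by simp [pFun, lamFun]

theorem pFun_of_le_abs {z ω : ℝ} (hz : 0 < z) (hω : z ≤ |ω|) : pFun z ω = ω := by
  have h : Complex.I * (pFun z ω : ℂ) = Complex.I * ω := (qInv_qFun hz hω).2.2
  exact_mod_cast mul_left_cancel₀ Complex.I_ne_zero h

theorem eventually_pFun_eq (ω : ℝ) : ∀ᶠ z in 𝓝[>] (0 : ℝ), pFun z ω = ω := by
  rcases eq_or_ne ω 0 with rfl | hω
  · exact Eventually.of_forall pFun_zero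
  · filter_upwards [Ioc_mem_nhdsGT (abs_pos.2 hω)] with z hz
    exact pFun_of_le_abs hz.1 hz.2

theorem abs_lamFun_le {z : ℝ} (hz : 0 < z) (ω : ℝ) : |lamFun z ω| ≤ 1 / (2 * z) := by
  have hp : 0 < z ^ 2 + ω ^ 2 := by positivity
  rw [lamFun, abs_div, abs_of_pos hp, div_le_div_iff₀ hp (by positivity), ← sq_abs ω]
  nlinarith [sq_nonneg (z - |ω|)]

/-- The bound |λ| ≤ 1/(2z) holds for all ω, so only λ = 0 leaves the domain of the branch, and that
means ω = 0. -/
theorem preimage_lamFun_compl_branchDomain {z : ℝ} (hz : 0 < z) :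
    lamFun z ⁻¹' (branchDomain z)ᶜ = {0} := by
  ext ω
  have hp : z ^ 2 + ω ^ 2 ≠ 0 := by positivity
  rw [Set.mem_preimage, Set.mem_compl_iff, branchDomain, Set.mem_ofPred_eq,
    and_iff_left (abs_lamFun_le hz ω), abs_pos, not_not, lamFun, div_eq_zero_iff, or_iff_left hp,
    Set.mem_singleton_iff]

theorem measurableSet_branchDomain (z : ℝ) : MeasurableSet (branchDomain z) :=
  (measurableSet_lt measurable_const measurable_norm).inter
    (measurableSet_le measurable_norm measurable_const)

/-! ### The approximation for a projection-valued measure without mass at `0` -/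

namespace ProjMeasure

variable {H : Type*} [NormedAddCommGroup H] [InnerProductSpace ℂ H] [CompleteSpace H]
  (E : ProjMeasure H)

theorem borelCalculus_integral_qFun (z : ℝ) :
    borelCalculus (E.integral (fun ω : ℝ => Complex.I * ω) measurable_I_mul) (qFun z)
      (measurable_qFun z) = E.integral (fun ω => Complex.I * (lamFun z ω : ℂ))
        (measurable_I_mul_comp (measurable_lamFun z)) := by
  rw [borelCalculus, E.spectralMeasure_eq rfl]
  exact integral_congr E _ (qFun_eq z)

theorem borelCalculus_integral_qInv (z : ℝ) :
    borelCalculus (E.integral (fun ω => Complex.I * (lamFun z ω : ℂ))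
      (measurable_I_mul_comp (measurable_lamFun z))) (qInv z) (measurable_qInv z) =
      E.integral (fun ω => Complex.I * (pFun z ω : ℂ))
        (measurable_I_mul_comp (measurable_pFun z)) :=
  E.borelCalculus_integral (measurable_lamFun z) (measurable_qInv z)

theorem domain_integral_lamFun {z : ℝ} (hz : 0 < z) :
    (E.integral (fun ω => Complex.I * (lamFun z ω : ℂ))
      (measurable_I_mul_comp (measurable_lamFun z))).domain = ⊤ := by
  refine eq_top_iff.2 fun x _ => mem_domain_integral.2 ?_
  refine E.memLp_of_bound (measurable_I_mul_comp (measurable_lamFun z)) (C := 1 / (2 * z))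
    fun ω => ?_
  rw [norm_mul, Complex.norm_I, one_mul, Complex.norm_real, Real.norm_eq_abs]
  exact abs_lamFun_le hz ω

theorem spectralMeasure_lamFun_compl_branchDomain (h0 : E {0} = 0) {z : ℝ} (hz : 0 < z) :
    spectralMeasure (E.integral (fun ω => Complex.I * (lamFun z ω : ℂ))
      (measurable_I_mul_comp (measurable_lamFun z))) (branchDomain z)ᶜ = 0 := by
  rw [E.spectralMeasure_integral (measurable_lamFun z),
    map_apply E _ (measurableSet_branchDomain z).compl, preimage_lamFun_compl_branchDomain hz, h0]

theorem re_eq_zero_of_mem_spectrum {l : ℂ} (hl : l ∈ unboundedSpectrum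
    (E.integral (fun ω : ℝ => Complex.I * ω) measurable_I_mul)) : l.re = 0 := by
  by_contra h
  exact hl ⟨_, E.isResolventAt_of_re_ne_zero h⟩

theorem spectralConv_pFun (h0 : E {0} ≠ 0) : SpectralConv
    (fun z => E.integral (fun ω => Complex.I * (pFun z ω : ℂ))
      (measurable_I_mul_comp (measurable_pFun z)))
    (E.integral (fun ω : ℝ => Complex.I * ω) measurable_I_mul) where
  spectrum l hl := by
    obtain ⟨ω₀, rfl⟩ : ∃ ω₀ : ℝ, l = Complex.I * ω₀ :=
      ⟨l.im, Complex.ext (by simp [E.re_eq_zero_of_mem_spectrum hl]) (by simp)⟩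
    -- The approximating spectral points can be constant: iω₀ itself lies in the spectrum of every
    -- approximant with z ≤ δ. The sequence of parameters is then δ/(n + 1).
    obtain ⟨δ, hδ, h⟩ : ∃ δ > 0, ∀ z, 0 < z → z ≤ δ → Complex.I * (ω₀ : ℂ) ∈ unboundedSpectrum
        (E.integral (fun ω => Complex.I * (pFun z ω : ℂ))
          (measurable_I_mul_comp (measurable_pFun z))) := by
      rcases eq_or_ne ω₀ 0 with rfl | hω
      · refine ⟨1, one_pos, fun z _ _ => ?_⟩
        rw [Complex.ofReal_zero, mul_zero]
        exact E.zero_mem_spectrum_integral_comp (measurable_pFun z) (pFun_zero z) h0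
      -- On the ball of radius |ω₀|/2 around ω₀ one has |ω| ≥ |ω₀|/2 ≥ z, where p_z is the identity.
      · have hδ : 0 < |ω₀| / 2 := half_pos (abs_pos.2 hω)
        refine ⟨|ω₀| / 2, hδ, fun z hz hzδ => ?_⟩
        refine E.mem_spectrum_integral_comp (measurable_pFun z) hδ (fun ω hω => ?_) hl
        refine pFun_of_le_abs hz (hzδ.trans ?_)
        rw [Metric.mem_ball, dist_comm, Real.dist_eq] at hω
        linarith [abs_sub_abs_le_abs_sub ω₀ ω]
    refine ⟨fun n => δ / (n + 1), fun _ => Complex.I * ω₀, fun n => by positivity, ?_,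
      tendsto_const_div_atTop_nhds_zero_nat δ |>.comp (tendsto_add_atTop_nat 1) |>.congr (by simp),
      fun n => h _ (by positivity) ?_, tendsto_const_nhds⟩
    · intro m n hmn
      have : (m : ℝ) < n := by exact_mod_cast hmn
      exact div_lt_div_of_pos_left hδ (by positivity) (by linarith)
    · exact div_le_self hδ.le (by linarith [n.cast_nonneg (α := ℝ)])
  calculus h := E.strongOpConv_borelCalculus measurable_pFun eventually_pFun_eq
    h.continuous.measurable h.norm_coe_le_norm
  projections _ hs _ _ x := E.tendsto_spectralMeasure measurable_pFun eventually_pFun_eq hs x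

end ProjMeasure

/-! ### The Koopman generator and the main theorem -/

theorem exists_projMeasure_koopman {M : Type*} [MetricSpace M] [MeasurableSpace M] [BorelSpace M]
    [AddAction ℝ M] [ContinuousVAdd ℝ M] (μ : Measure M) [IsProbabilityMeasure μ]
    [ErgodicVAdd ℝ M μ] : ∃ F : ProjMeasure (zeroMean μ), F {0} = 0 ∧ F.extend {0} ≠ 0 ∧
      (∀ t x, F.extend.act (expFun t) x = koopman μ t x) ∧
      koopmanGenerator μ = F.extend.integral (fun ω : ℝ => Complex.I * ω)
        ProjMeasure.measurable_I_mul ∧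
      partIn (zeroMean μ) (koopmanGenerator μ) = F.integral (fun ω : ℝ => Complex.I * ω)
        ProjMeasure.measurable_I_mul := by
  have hU := isUnitaryGroup_koopman μ
  have he : ∀ t, koopman μ t (Lp.const 2 μ (1 : ℂ)) = Lp.const 2 μ 1 := fun t =>
    koopman_const μ t 1
  refine ⟨hU.restrictMeasure he, hU.restrictMeasure_singleton he fun y hy => ?_,
    hU.extend_restrictMeasure_singleton_ne_zero he ?_, hU.act_extend_restrictMeasure he,
    hU.infGenerator_eq he, hU.partIn_infGenerator he⟩
  · obtain ⟨c, rfl⟩ := exists_eq_const_of_koopman_eq μ hy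
    refine Submodule.mem_span_singleton.2 ⟨c, ?_⟩
    have h := (Lp.constₗ 2 μ ℂ).map_smul c (1 : ℂ)
    rw [smul_eq_mul, mul_one] at h
    exact h.symm
  · rw [← norm_ne_zero_iff, Lp.norm_const _ _ _ (by norm_num)]
    simp

/-- `spectralMeasure` is arbitrary when no spectral measure exists, so the conjuncts before the
convergence statements certify that the functional calculi of V, of its restriction to H̃, of Q_z
and of V_z are the genuine ones, and that the branch is used only where it is defined, up to a null
set. -/
theorem mainTheorem2 {M : Type*} [MetricSpace M] [MeasurableSpace M] [BorelSpace M]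
    [AddAction ℝ M] [ContinuousVAdd ℝ M] (μ : Measure M) [IsProbabilityMeasure μ]
    [ErgodicVAdd ℝ M μ] :
    (IsSkewAdjoint (koopmanGenerator μ) ∧
      (spectralMeasure (koopmanGenerator μ)).IsSpectralMeasureOf (koopmanGenerator μ) ∧
      ∀ t : ℝ, expOp t (koopmanGenerator μ) = (koopman μ t).toLinearMap.toPMap ⊤) ∧
    (IsSkewAdjoint (partIn (zeroMean μ) (koopmanGenerator μ)) ∧
      (spectralMeasure (partIn (zeroMean μ) (koopmanGenerator μ))).IsSpectralMeasureOf
        (partIn (zeroMean μ) (koopmanGenerator μ))) ∧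
    (∀ z > 0, (Qop μ z).domain = ⊤ ∧ IsSkewAdjoint (Qop μ z) ∧
      (spectralMeasure (Qop μ z)).IsSpectralMeasureOf (Qop μ z) ∧
      spectralMeasure (Qop μ z) (branchDomain z)ᶜ = 0 ∧
      IsSkewAdjoint (Vop μ z) ∧
      (spectralMeasure (Vop μ z)).IsSpectralMeasureOf (Vop μ z)) ∧
    StrongResolventConv (Vop μ) (koopmanGenerator μ) ∧
    StrongDynamicalConv (Vop μ) (koopmanGenerator μ) ∧
    (∀ t : ℝ, StrongOpConv (fun z => expOp t (Vop μ z))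
      ((koopman μ t).toLinearMap.toPMap ⊤)) ∧
    SpectralConv (Vop μ) (koopmanGenerator μ) := by
  obtain ⟨F, hF0, hE0, hU, hV, hV'⟩ := exists_projMeasure_koopman μ
  have hQ : ∀ z, Qop μ z = F.integral (fun ω => Complex.I * (lamFun z ω : ℂ))
      (ProjMeasure.measurable_I_mul_comp (measurable_lamFun z)) := fun z => by
    rw [Qop, hV', F.borelCalculus_integral_qFun]
  -- The two calculi compose to ∫ i p_z dF on H̃, and p_z(0) = 0 lets the sandwich be absorbed into
  -- the extended measure. From here on V and V_z are integrals against the same measure.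
  have hVz : Vop μ = fun z => F.extend.integral (fun ω => Complex.I * (pFun z ω : ℂ))
      (ProjMeasure.measurable_I_mul_comp (measurable_pFun z)) := funext fun z => by
    rw [Vop, Vtilde, hQ, F.borelCalculus_integral_qInv,
      ProjMeasure.sandwich_integral _ _ (by simp [pFun_zero])]
  have hexp : ∀ t, expOp t (koopmanGenerator μ) = (koopman μ t).toLinearMap.toPMap ⊤ := fun t => by
    rw [expOp, borelCalculus, hV, F.extend.spectralMeasure_eq rfl]
    exact F.extend.integral_eq_toPMap (measurable_expFun t) (fun ω => (norm_expFun t ω).le) _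
      (hU t)
  have hdyn : StrongDynamicalConv (Vop μ) (koopmanGenerator μ) := fun t => by
    rw [hVz, hV]
    exact F.extend.strongOpConv_borelCalculus measurable_pFun eventually_pFun_eq
      (measurable_expFun t) fun ω => (norm_expFun t ω).le
  refine ⟨⟨?_, ?_, hexp⟩, ⟨?_, ?_⟩, fun z hz => ⟨?_, ?_, ?_, ?_, ?_, ?_⟩, ?_, hdyn,
    fun t => hexp t ▸ hdyn t, ?_⟩
  · rw [hV]
    exact F.extend.isSkewAdjoint_integral id ProjMeasure.measurable_I_mul
  · rw [hV]
    exact F.extend.isSpectralMeasureOf_spectralMeasure rfl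
  · rw [hV']
    exact F.isSkewAdjoint_integral id ProjMeasure.measurable_I_mul
  · rw [hV']
    exact F.isSpectralMeasureOf_spectralMeasure rfl
  · rw [hQ]
    exact F.domain_integral_lamFun hz
  · rw [hQ]
    exact F.isSkewAdjoint_integral _ _
  · rw [hQ]
    exact ProjMeasure.isSpectralMeasureOf_spectralMeasure _
      (F.isSpectralMeasureOf_map (measurable_lamFun z))
  · rw [hQ]
    exact F.spectralMeasure_lamFun_compl_branchDomain hF0 hz
  · rw [hVz]
    exact F.extend.isSkewAdjoint_integral _ _
  · rw [hVz]
    exact ProjMeasure.isSpectralMeasureOf_spectralMeasure _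
      (F.extend.isSpectralMeasureOf_map (measurable_pFun z))
  · rw [hVz, hV]
    exact F.extend.strongResolventConv measurable_pFun eventually_pFun_eq
  · rw [hVz, hV]
    exact F.extend.spectralConv_pFun hE0
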